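/- Let $\Sigma$ be a closed connected Riemann surface of genus $\gamma\ge 2$ (for instance one of the smooth surfaces $\Sigma_R$, $R>0$, of a plumbing family), let $(E,h)\to\Sigma$ be a smooth hermitian vector bundle of complex rank $2$, and fix a smooth unitary background connection $A_0$ on $E$. Let $q$ be a holomorphic quadratic differential on $\Sigma$ all of whose zeros are simple, and put $\Sigma^\times=\Sigma\setminus q^{-1}(0)$. By a smooth Higgs field on an open set $W\subseteq\Sigma$ we mean a smooth trace-free form $\Phi\in\Omega^{1,0}(W,\mathfrak{sl}(E))$. A limiting configuration with determinant $q$ is a pair $(A_\infty,\Phi_\infty)$ of a smooth unitary connection $A_\infty$ on $E|_{\Sigma^\times}$ that induces the same connection on $\det E$ as $A_0$, and a smooth Higgs field $\Phi_\infty$ on $\Sigma^\times$ with $\det\Phi_\infty=q$, such that on $\Sigma^\times$ $$F_{A_\infty}^\perp=0,\qquad [\Phi_\infty\wedge\Phi_\infty^*]=0,\qquad \bar\partial_{A_\infty}\Phi_\infty=0$$ (where $F^\perp$ is the trace-free part of the curvature), and such that near each zero of $q$, in some smooth unitary frame of $E$ and some local holomorphic coordinate $z=re^{i\theta}$ with $q=-z\,dz^2$,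 $$\Phi_\infty=\begin{pmatrix}0&r^{1/2}\\ r^{1/2}e^{i\theta}&0\end{pmatrix}dz,\qquad A_\infty^{\circ}=\frac18\begin{pmatrix}1&0\\0&-1\end{pmatrix}\Big(\frac{dz}{z}-\frac{d\bar z}{\bar z}\Big),$$ where $A_\infty^{\circ}$ is the trace-free part of the connection matrix of $A_\infty$. The component $\Phi_\infty$ is then called a limiting Higgs field. For a Higgs field $\Phi$ on $\Sigma^\times$ with $\det\Phi=q$ let $$L_\Phi=\{\gamma\in\mathfrak{sl}(E)\mid[\Phi\wedge\gamma]=0\},\qquad \widehat L_\Phi=\{\gamma\in\operatorname{End}(E)\mid[\Phi\wedge\gamma]=0\}$$ over $\Sigma^\times$. Let $\Phi$ be a smooth Higgs field on $\Sigma$ with $\det\Phi=q$. Then: 1. There exists a limiting configuration $(A_\infty,\Phi_\infty)$ with determinant $q$; in particular there is a limiting Higgs field $\Phi_\infty$ with $\det\Phi_\infty=q$. 2. For every such $\Phi_\infty$, and more generally for every smooth Higgs field $\Phi_\infty$ on $\Sigma^\times$ with $[\Phi_\infty\wedge\Phi_\infty^*]=0$ and $\det\Phi_\infty=q$, the spaces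 $L_\Phi$ and $L_{\Phi_\infty}$ are smooth complex line subbundles of $\operatorname{End}(E)|_{\Sigma^\times}$ and are isomorphic as smooth complex vector bundles over $\Sigma^\times$. Likewise $\widehat L_\Phi$ and $\widehat L_{\Phi_\infty}$ are smooth complex subbundles of rank $2$ and are isomorphic as smooth complex vector bundles over $\Sigma^\times$. -/

import Mathlib

open scoped Manifold ContDiff Matrix Topology InnerProductSpace

noncomputable section

namespace HiggsSurface

universe u v

section Surface

variable {X : Type u} [TopologicalSpace X] [ChartedSpace ℂ X]

/-- The holomorphic tangent line of `X` at `x`; as a real vector space it is the tangent plane. -/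
abbrev Tangent (x : X) : Type := TangentSpace 𝓘(ℂ) x

/-- The tangent vector `w ∂_z` at the point with coordinate `z`, for a local holomorphic
coordinate `e`. In real terms, `w = 1` and `w = I` give `∂_x` and `∂_y` for `z = x + i y`. -/
def push (e : OpenPartialHomeomorph X ℂ) (z w : ℂ) : Tangent (e.symm z) :=
  mfderiv 𝓘(ℂ) 𝓘(ℂ) e.symm z w

/-- A form `α = a(z) dz` of type (1,0) is holomorphic if its coefficients `a` are. -/
def IsHolomorphicForm (α : ∀ x : X, Tangent x →ₗ[ℂ] ℂ) : Prop :=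
  ∀ e ∈ atlas ℂ X, DifferentiableOn ℂ (fun z => α (e.symm z) (push e z 1)) e.target

variable (X) in
/-- The space `H⁰(X, K)` of holomorphic one-forms. -/
def holomorphicForms : Submodule ℂ (∀ x : X, Tangent x →ₗ[ℂ] ℂ) where
  carrier := {α | IsHolomorphicForm α}
  add_mem' := fun ha hb e he => (ha e he).add (hb e he)
  zero_mem' := fun _ _ => differentiableOn_const 0
  smul_mem' := fun c _ ha e he => (ha e he).const_smul c

variable (X) in
/-- The genus `dim H⁰(X, K)` of a closed Riemann surface. -/
def genus : ℕ := Module.finrank ℂ (holomorphicForms X)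

variable (X) in
/-- A section of `K²`: a complex quadratic form on every tangent line. -/
abbrev QuadraticDifferential : Type u := ∀ x : X, QuadraticForm ℂ (Tangent x)

/-- The coefficient `a(z)` of `q = a(z) dz²` in the coordinate `e`. -/
def QuadraticDifferential.coeff (q : QuadraticDifferential X) (e : OpenPartialHomeomorph X ℂ)
    (z : ℂ) : ℂ :=
  q (e.symm z) (push e z 1)

def QuadraticDifferential.IsHolomorphic (q : QuadraticDifferential X) : Prop :=
  ∀ e ∈ atlas ℂ X, DifferentiableOn ℂ (q.coeff e) e.target

def QuadraticDifferential.HasSimpleZeros (q : QuadraticDifferential X) : Prop :=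
  ∀ e ∈ atlas ℂ X, ∀ z ∈ e.target, q.coeff e z = 0 → deriv (q.coeff e) z ≠ 0

/-- The punctured surface `X \ q⁻¹(0)`. -/
def QuadraticDifferential.punctured (q : QuadraticDifferential X) : Set X := {x | q x ≠ 0}

end Surface

/-- A smooth hermitian vector bundle of rank two over `X`: a family of hermitian vector spaces
together with local unitary frames, defined over the members of an open cover, whose transition
matrices are smooth. The values of `frame i` outside `dom i` play no role. -/
structure HermitianBundle (X : Type u) [TopologicalSpace X] [ChartedSpace ℂ X] where
  fiber : X → Type v
  [normed : ∀ x, NormedAddCommGroup (fiber x)]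
  [innerProduct : ∀ x, InnerProductSpace ℂ (fiber x)]
  ι : Type v
  dom : ι → Set X
  isOpen_dom : ∀ i, IsOpen (dom i)
  cover : ∀ x, ∃ i, x ∈ dom i
  frame : ι → ∀ x, OrthonormalBasis (Fin 2) ℂ (fiber x)
  smooth_transition : ∀ i j a b,
    ContMDiffOn 𝓘(ℝ, ℂ) 𝓘(ℝ, ℂ) ∞ (fun x => ⟪frame i x a, frame j x b⟫_ℂ) (dom i ∩ dom j)

attribute [instance] HermitianBundle.normed HermitianBundle.innerProduct

section Bundle

variable {X : Type u} [TopologicalSpace X] [ChartedSpace ℂ X]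

instance (E : HermitianBundle.{u, v} X) (x : X) : FiniteDimensional ℂ (E.fiber x) :=
  let ⟨i, _⟩ := E.cover x
  (E.frame i x).toBasis.finiteDimensional_of_finite

/-- The fibre of `End(E)` at `x`. -/
abbrev HermitianBundle.EndAt (E : HermitianBundle.{u, v} X) (x : X) : Type v :=
  Module.End ℂ (E.fiber x)

/-- A smooth local unitary frame of `E` over the open set `dom`. -/
structure UnitaryFrame (E : HermitianBundle.{u, v} X) where
  dom : Set X
  isOpen_dom : IsOpen dom
  vec : ∀ x, OrthonormalBasis (Fin 2) ℂ (E.fiber x)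
  smooth : ∀ i a b,
    ContMDiffOn 𝓘(ℝ, ℂ) 𝓘(ℝ, ℂ) ∞ (fun x => ⟪E.frame i x a, vec x b⟫_ℂ) (E.dom i ∩ dom)

variable {E : HermitianBundle.{u, v} X}

/-- The matrix of an endomorphism of the fibre in a unitary frame. -/
def UnitaryFrame.matrix (f : UnitaryFrame E) (x : X) (γ : E.EndAt x) : Matrix (Fin 2) (Fin 2) ℂ :=
  LinearMap.toMatrix (f.vec x).toBasis (f.vec x).toBasis γ

/-- The transition matrix `g` between two frames, `f'_b = ∑ₐ f_a g_ab`. -/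
def UnitaryFrame.transition (f f' : UnitaryFrame E) (x : X) : Matrix (Fin 2) (Fin 2) ℂ :=
  Matrix.of fun a b => ⟪f.vec x a, f'.vec x b⟫_ℂ

/-- The section `γ` of `End(E)` is smooth on `U`. -/
def SmoothOn (γ : ∀ x, E.EndAt x) (U : Set X) : Prop :=
  ∀ (f : UnitaryFrame E) (a b : Fin 2),
    ContMDiffOn 𝓘(ℝ, ℂ) 𝓘(ℝ, ℂ) ∞ (fun x => f.matrix x (γ x) a b) (f.dom ∩ U)

variable (E) in
/-- A smooth (trace-free) Higgs field over `W`: an element of `Ω^{1,0}(W, sl(E))`. Being a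
(1,0)-form is complex linearity. The values outside `W` play no role. -/
structure HiggsField (W : Set X) where
  toFun : ∀ x : X, Tangent x →ₗ[ℂ] E.EndAt x
  trace_eq_zero : ∀ x ∈ W, ∀ v, LinearMap.trace ℂ (E.fiber x) (toFun x v) = 0
  smooth : ∀ (f : UnitaryFrame E), ∀ e ∈ atlas ℂ X, ∀ a b : Fin 2,
    ContDiffOn ℝ ∞ (fun z => f.matrix (e.symm z) (toFun (e.symm z) (push e z 1)) a b)
      (e.target ∩ e.symm ⁻¹' (f.dom ∩ W))

/-- The matrix `φ(z)` of `Φ = φ(z) dz` in a unitary frame and a holomorphic coordinate. -/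
def HiggsField.matrix {W : Set X} (Φ : HiggsField E W) (f : UnitaryFrame E)
    (e : OpenPartialHomeomorph X ℂ) (z : ℂ) : Matrix (Fin 2) (Fin 2) ℂ :=
  f.matrix (e.symm z) (Φ.toFun (e.symm z) (push e z 1))

/-- `det Φ = q` on `W`. -/
def HiggsField.HasDet {W : Set X} (Φ : HiggsField E W) (q : QuadraticDifferential X) : Prop :=
  ∀ x ∈ W, ∀ v, LinearMap.det (Φ.toFun x v) = q x v

/-- The `End(E)`-valued two-form `[Φ ∧ Φ*]`, where `Φ*(v) = Φ(v)*`. -/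
def HiggsField.wedgeAdjoint {W : Set X} (Φ : HiggsField E W) (x : X) (v v' : Tangent x) :
    E.EndAt x :=
  ⁅Φ.toFun x v, LinearMap.adjoint (Φ.toFun x v')⁆ -
    ⁅Φ.toFun x v', LinearMap.adjoint (Φ.toFun x v)⁆

/-- The equation `[Φ ∧ Φ*] = 0` on `W`. -/
def HiggsField.IsNormal {W : Set X} (Φ : HiggsField E W) : Prop :=
  ∀ x ∈ W, ∀ v v', Φ.wedgeAdjoint x v v' = 0

/-- The entrywise derivative of a matrix-valued function at `z` in the real direction `w`. -/
def dirDeriv (M : ℂ → Matrix (Fin 2) (Fin 2) ℂ) (z w : ℂ) : Matrix (Fin 2) (Fin 2) ℂ :=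
  Matrix.of fun a b => fderiv ℝ (fun ζ => M ζ a b) z w

/-- The trace-free part of a matrix. -/
def traceFree (M : Matrix (Fin 2) (Fin 2) ℂ) : Matrix (Fin 2) (Fin 2) ℂ :=
  M - (M.trace / 2) • (1 : Matrix (Fin 2) (Fin 2) ℂ)

variable (E) in
/-- A smooth unitary connection on `E` over `W`: to every local unitary frame `f` it assigns a
skew-hermitian matrix-valued one-form `A_f` over `f.dom ∩ W` (so that `d_A = d + A_f` in this
frame), with `A_{f'} = g⁻¹ A_f g + g⁻¹ dg` for `f' = f g`. Here `g⁻¹ = gᴴ`. -/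
structure UnitaryConnection (W : Set X) where
  form : UnitaryFrame E → ∀ x : X, Tangent x →ₗ[ℝ] Matrix (Fin 2) (Fin 2) ℂ
  skew : ∀ f, ∀ x ∈ f.dom ∩ W, ∀ v, (form f x v)ᴴ = -form f x v
  smooth : ∀ f, ∀ e ∈ atlas ℂ X, ∀ (w : ℂ) (a b : Fin 2),
    ContDiffOn ℝ ∞ (fun z => form f (e.symm z) (push e z w) a b)
      (e.target ∩ e.symm ⁻¹' (f.dom ∩ W))
  change_frame : ∀ f f', ∀ e ∈ atlas ℂ X,
    ∀ z ∈ e.target ∩ e.symm ⁻¹' (f.dom ∩ f'.dom ∩ W), ∀ w : ℂ,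
      form f' (e.symm z) (push e z w) =
        (f.transition f' (e.symm z))ᴴ * form f (e.symm z) (push e z w) *
            f.transition f' (e.symm z) +
          (f.transition f' (e.symm z))ᴴ * dirDeriv (fun ζ => f.transition f' (e.symm ζ)) z w

/-- The matrix `A(w ∂_z)` of the connection form in a unitary frame and a coordinate. -/
def UnitaryConnection.matrix {W : Set X} (A : UnitaryConnection E W) (f : UnitaryFrame E)
    (e : OpenPartialHomeomorph X ℂ) (w z : ℂ) : Matrix (Fin 2) (Fin 2) ℂ :=
  A.form f (e.symm z) (push e z w)

/-- The curvature `F_A(∂_x, ∂_y) = ∂_x A_y - ∂_y A_x + [A_x, A_y]` in a frame and a coordinate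
`z = x + i y`. -/
def UnitaryConnection.curvature {W : Set X} (A : UnitaryConnection E W) (f : UnitaryFrame E)
    (e : OpenPartialHomeomorph X ℂ) (z : ℂ) : Matrix (Fin 2) (Fin 2) ℂ :=
  dirDeriv (A.matrix f e Complex.I) z 1 - dirDeriv (A.matrix f e 1) z Complex.I +
    ⁅A.matrix f e 1 z, A.matrix f e Complex.I z⁆

/-- The coefficient `∂φ/∂z̄ + [A_z̄, φ]` of `∂̄_A Φ`, where `Φ = φ dz`, in a frame and a
coordinate. -/
def dbar {W : Set X} (A : UnitaryConnection E W) (Φ : HiggsField E W) (f : UnitaryFrame E)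
    (e : OpenPartialHomeomorph X ℂ) (z : ℂ) : Matrix (Fin 2) (Fin 2) ℂ :=
  (1 / 2 : ℂ) • (dirDeriv (Φ.matrix f e) z 1 + Complex.I • dirDeriv (Φ.matrix f e) z Complex.I) +
    ⁅(1 / 2 : ℂ) • (A.matrix f e 1 z + Complex.I • A.matrix f e Complex.I z), Φ.matrix f e z⁆

/-- The coefficient of the limiting fiducial Higgs field
`(0, r^{1/2}; r^{1/2} e^{iθ}, 0) dz`, `z = r e^{iθ} ≠ 0`. -/
def fiducialHiggs (z : ℂ) : Matrix (Fin 2) (Fin 2) ℂ :=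
  !![0, (Real.sqrt ‖z‖ : ℂ); (Real.sqrt ‖z‖ : ℂ) * (z / (‖z‖ : ℂ)), 0]

/-- The limiting fiducial connection form `(1/8) diag(1, -1) (dz / z - dz̄ / z̄)`, evaluated at
`z ≠ 0` on the vector `w ∂_z`. -/
def fiducialConnection (z w : ℂ) : Matrix (Fin 2) (Fin 2) ℂ :=
  ((1 / 8 : ℂ) * (w / z - starRingEnd ℂ w / starRingEnd ℂ z)) • !![1, 0; 0, -1]

/-- `(A, Φ)` is a limiting configuration with `det Φ = q`, where `q` has simple zeros and `A₀` is
the background connection: the connection `A` induces the same connection on `det E` as `A₀`, the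
decoupled self-duality equations `F_A^⊥ = 0`, `[Φ ∧ Φ*] = 0`, `∂̄_A Φ = 0` hold on the punctured
surface, and near every zero of `q` the pair is the limiting fiducial one in some unitary frame
and some local holomorphic coordinate with `q = -z dz²`. As the central part of `A` is prescribed
by `A₀`, it is the trace-free part of `A` that is compared with the (trace-free) fiducial
connection. -/
structure IsLimitingConfiguration (A₀ : UnitaryConnection E Set.univ)
    (q : QuadraticDifferential X) (A : UnitaryConnection E q.punctured)
    (Φ : HiggsField E q.punctured) : Prop where
  hasDet : Φ.HasDet q
  trace_eq : ∀ f : UnitaryFrame E, ∀ x ∈ f.dom ∩ q.punctured, ∀ v,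
    (A.form f x v).trace = (A₀.form f x v).trace
  curvature_eq_zero : ∀ f : UnitaryFrame E, ∀ e ∈ atlas ℂ X,
    ∀ z ∈ e.target ∩ e.symm ⁻¹' (f.dom ∩ q.punctured), traceFree (A.curvature f e z) = 0
  normal : Φ.IsNormal
  dbar_eq_zero : ∀ f : UnitaryFrame E, ∀ e ∈ atlas ℂ X,
    ∀ z ∈ e.target ∩ e.symm ⁻¹' (f.dom ∩ q.punctured), dbar A Φ f e z = 0
  fiducial : ∀ p : X, q p = 0 →
    ∃ (f : UnitaryFrame E) (e : OpenPartialHomeomorph X ℂ) (ε : ℝ),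
      e ∈ IsManifold.maximalAtlas 𝓘(ℂ) ω X ∧ p ∈ e.source ∧ e p = 0 ∧ 0 < ε ∧
      Metric.ball 0 ε ⊆ e.target ∩ e.symm ⁻¹' f.dom ∧
      (∀ z ∈ Metric.ball (0 : ℂ) ε, q.coeff e z = -z) ∧
      ∀ z ∈ Metric.ball (0 : ℂ) ε, z ≠ 0 →
        Φ.matrix f e z = fiducialHiggs z ∧
        ∀ w, traceFree (A.matrix f e w z) = fiducialConnection z w

/-- The fibre at `x` of the bundle `{γ ∈ End(E) | [Φ ∧ γ] = 0}`. -/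
def HiggsField.centralizer {W : Set X} (Φ : HiggsField E W) (x : X) :
    Submodule ℂ (E.EndAt x) where
  carrier := {γ | ∀ v, ⁅Φ.toFun x v, γ⁆ = 0}
  add_mem' := fun {a b} ha hb v => by
    have h1 := ha v
    have h2 := hb v
    rw [Ring.lie_def, sub_eq_zero] at h1 h2 ⊢
    rw [mul_add, add_mul, h1, h2]
  zero_mem' := fun v => by rw [Ring.lie_def, mul_zero, zero_mul, sub_zero]
  smul_mem' := fun c _ ha v => by
    have h1 := ha v
    rw [Ring.lie_def, sub_eq_zero] at h1 ⊢
    rw [mul_smul_comm, smul_mul_assoc, h1]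

/-- The fibre at `x` of `L_Φ`: the trace-free endomorphisms commuting with `Φ`. -/
def HiggsField.centralizerLine {W : Set X} (Φ : HiggsField E W) (x : X) :
    Submodule ℂ (E.EndAt x) :=
  Φ.centralizer x ⊓ LinearMap.ker (LinearMap.trace ℂ (E.fiber x))

/-- The fibres `L x`, `x ∈ W`, form a smooth complex subbundle of `End(E)` of rank `r` over `W`:
near every point there are smooth sections that are a basis of `L x` for all `x`. -/
def IsSubbundle (L : ∀ x, Submodule ℂ (E.EndAt x)) (r : ℕ) (W : Set X) : Prop :=
  ∀ x ∈ W, ∃ U : Set X, IsOpen U ∧ x ∈ U ∧ U ⊆ W ∧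
    ∃ σ : Fin r → ∀ y, E.EndAt y, (∀ k, SmoothOn (σ k) U) ∧
      ∀ y ∈ U, LinearIndependent ℂ (fun k => σ k y) ∧
        Submodule.span ℂ (Set.range fun k => σ k y) = L y

/-- The fibrewise complex linear maps `T x : L x → L' x` over `W` are a smooth homomorphism of
complex vector bundles: they map smooth local sections of `L` to smooth local sections of `L'`.
Each `T x` is written as the restriction of a linear map on the whole of `End(E)_x`. -/
def IsBundleHom (L L' : ∀ x, Submodule ℂ (E.EndAt x)) (W : Set X)
    (T : ∀ x, E.EndAt x →ₗ[ℂ] E.EndAt x) : Prop :=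
  (∀ x ∈ W, ∀ γ ∈ L x, T x γ ∈ L' x) ∧
  ∀ U : Set X, IsOpen U → U ⊆ W → ∀ σ : ∀ x, E.EndAt x,
    (∀ x ∈ U, σ x ∈ L x) → SmoothOn σ U → SmoothOn (fun x => T x (σ x)) U

/-- `L` and `L'` are isomorphic as smooth complex vector bundles over `W`. -/
def BundleIsomorphic (L L' : ∀ x, Submodule ℂ (E.EndAt x)) (W : Set X) : Prop :=
  ∃ T S : ∀ x, E.EndAt x →ₗ[ℂ] E.EndAt x,
    IsBundleHom L L' W T ∧ IsBundleHom L' L W S ∧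
    ∀ x ∈ W, (∀ γ ∈ L x, S x (T x γ) = γ) ∧ ∀ γ ∈ L' x, T x (S x γ) = γ

end Bundle

end HiggsSurface

end

/-!
Limiting configurations on a Riemann surface, and the centralizer bundles of Higgs fields.

**Centralizers.** Off the zeros of `q` a Higgs field `Φ` with determinant `q` is regular semisimple,
so its commutant is spanned by `1` and `Φ(v)`, for any `v ≠ 0`. The map `transfer` that fixes `1` and
sends `Φ(v)` to `Φ'(v)` can be written with traces,
`γ ↦ (tr γ / 2) 1 - (tr (γ Φ(v)) / (2 q(v))) Φ'(v)`; this does not depend on `v` and is visibly smooth.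

**The Higgs field.** Near a simple zero a Higgs field `φ dz` with determinant `-z dz²` has
`φ(0) ≠ 0` nilpotent, so in a suitable unitary frame its upper right entry has positive real part and
can be deformed to `1` while the determinant is kept (`normalize`). Hence some Higgs field on the
whole surface has determinant `q` and equals `(0, 1; z, 0) dz` near every zero
(`HiggsField.exists_adapted`). The pointwise normalization `polarMat` of `φ - (det φ / |det φ|) φᴴ`
makes it normal without changing the determinant, and turns `(0, 1; z, 0)` into the limiting fiducial
Higgs field.

**The connection.** Let `Φ` be normal with determinant `q = -λ²`. Adding
`traceFree (Φ ∇Φ) / (2 λ²)` to any unitary connection gives a unitary connection for which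
`∇Φ = (dλ² / 2λ²) Φ` (`exists_balanced_connection`). This implies `∂̄Φ = 0`, and that the trace-free
curvature commutes with `Φ`, hence is `4 κ Φ` for a form `κ` of type (0,1). If the initial connection
is central near the zeros, the result is the limiting fiducial connection there, and `κ` has compact
support off the zeros. Adding `i (u Φ + (u Φ)*)` for a function `u` keeps all of this and makes the
connection projectively flat exactly if `Im ((∂̄u - κ) λ) = 0` for both square roots `λ`
(`IsBalanced.exists_flat`).

**The equation for `u`.** This equation is solved with `u = 0` near the zeros, without elliptic theory
(`solvable_of_supported`): `κ` only matters modulo forms that pair with `λ` to real numbers, and the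
equation for one real function is so underdetermined that supports can be moved. Translating `κ` along a
coordinate changes it by a solvable form, so solvability of all forms supported near a point is an open
and closed condition on the point. Near a zero, where `λ` changes sign along a loop, rotating `κ` once
around the zero turns it into its negative, which makes `κ` itself solvable. A zero exists as the
genus is at least two: otherwise holomorphic one-forms would be constant multiples of each other.
-/

noncomputable section

namespace HiggsSurface

universe u v

set_option linter.unusedSectionVars false

/-! ### Calculus of matrix-valued functions -/

/-- The matrix-valued function `M` has smooth entries at `z`. -/
def SmoothMatAt (M : ℂ → Matrix (Fin 2) (Fin 2) ℂ) (z : ℂ) : Prop :=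
  ∀ a b, ContDiffAt ℝ ∞ (fun ζ => M ζ a b) z

section MatrixCalculus

variable {M N : ℂ → Matrix (Fin 2) (Fin 2) ℂ} {z : ℂ}

lemma differentiableAt_of_smooth {E F : Type*} [NormedAddCommGroup E] [NormedSpace ℝ E]
    [NormedAddCommGroup F] [NormedSpace ℝ F] {f : E → F} {x : E}
    (h : ContDiffAt ℝ ∞ f x) : DifferentiableAt ℝ f x :=
  h.differentiableAt (by simp)

lemma SmoothMatAt.diff (h : SmoothMatAt M z) (a b : Fin 2) :
    DifferentiableAt ℝ (fun ζ => M ζ a b) z :=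
  differentiableAt_of_smooth (h a b)

lemma SmoothMatAt.const (C : Matrix (Fin 2) (Fin 2) ℂ) : SmoothMatAt (fun _ => C) z :=
  fun _ _ => contDiffAt_const

lemma SmoothMatAt.add (hM : SmoothMatAt M z) (hN : SmoothMatAt N z) :
    SmoothMatAt (fun ζ => M ζ + N ζ) z := fun a b => (hM a b).add (hN a b)

lemma SmoothMatAt.sub (hM : SmoothMatAt M z) (hN : SmoothMatAt N z) :
    SmoothMatAt (fun ζ => M ζ - N ζ) z := fun a b => (hM a b).sub (hN a b)

lemma SmoothMatAt.mul (hM : SmoothMatAt M z) (hN : SmoothMatAt N z) :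
    SmoothMatAt (fun ζ => M ζ * N ζ) z := fun a b => by
  simp only [Matrix.mul_apply, Fin.sum_univ_two]
  exact ((hM a 0).mul (hN 0 b)).add ((hM a 1).mul (hN 1 b))

lemma SmoothMatAt.smul {c : ℂ → ℂ} (hc : ContDiffAt ℝ ∞ c z) (hM : SmoothMatAt M z) :
    SmoothMatAt (fun ζ => c ζ • M ζ) z := fun a b => hc.mul (hM a b)

lemma SmoothMatAt.const_smul (c : ℂ) (hM : SmoothMatAt M z) :
    SmoothMatAt (fun ζ => c • M ζ) z := SmoothMatAt.smul contDiffAt_const hM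

lemma SmoothMatAt.lie (hM : SmoothMatAt M z) (hN : SmoothMatAt N z) :
    SmoothMatAt (fun ζ => ⁅M ζ, N ζ⁆) z := (hM.mul hN).sub (hN.mul hM)

lemma contDiffAt_conj {f : ℂ → ℂ} (hf : ContDiffAt ℝ ∞ f z) :
    ContDiffAt ℝ ∞ (fun ζ => starRingEnd ℂ (f ζ)) z :=
  Complex.conjCLE.contDiff.contDiffAt.comp z hf

lemma contDiffAt_div {f g : ℂ → ℂ} (hf : ContDiffAt ℝ ∞ f z) (hg : ContDiffAt ℝ ∞ g z)
    (h0 : g z ≠ 0) : ContDiffAt ℝ ∞ (fun ζ => f ζ / g ζ) z := by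
  simp only [div_eq_mul_inv]
  exact hf.mul (hg.inv h0)

lemma fderiv_conj {f : ℂ → ℂ} (hf : DifferentiableAt ℝ f z) (w : ℂ) :
    fderiv ℝ (fun ζ => starRingEnd ℂ (f ζ)) z w = starRingEnd ℂ (fderiv ℝ f z w) := by
  have h := (Complex.conjCLE.hasFDerivAt (x := f z)).comp z hf.hasFDerivAt
  rw [show (fun ζ => starRingEnd ℂ (f ζ)) = Complex.conjCLE ∘ f from rfl, h.fderiv]
  rfl

lemma SmoothMatAt.conjTranspose (hM : SmoothMatAt M z) :
    SmoothMatAt (fun ζ => (M ζ)ᴴ) z := fun a b => contDiffAt_conj (hM b a)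

lemma SmoothMatAt.trace (hM : SmoothMatAt M z) :
    ContDiffAt ℝ ∞ (fun ζ => (M ζ).trace) z := by
  simp only [Matrix.trace_fin_two]
  exact (hM 0 0).add (hM 1 1)

lemma SmoothMatAt.traceFree (hM : SmoothMatAt M z) :
    SmoothMatAt (fun ζ => traceFree (M ζ)) z := by
  unfold HiggsSurface.traceFree
  exact hM.sub (SmoothMatAt.smul (hM.trace.div_const 2) (SmoothMatAt.const 1))

lemma SmoothMatAt.congr (hM : SmoothMatAt M z) (h : N =ᶠ[𝓝 z] M) : SmoothMatAt N z :=
  fun a b => (hM a b).congr_of_eventuallyEq (h.mono fun ζ hζ => by simp only [hζ])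

lemma SmoothMatAt.comp {h : ℂ → ℂ} (hM : SmoothMatAt M (h z)) (hh : ContDiffAt ℝ ∞ h z) :
    SmoothMatAt (fun ζ => M (h ζ)) z := fun a b => ContDiffAt.comp z (hM a b) hh

lemma SmoothMatAt.dirDeriv (hM : SmoothMatAt M z) (w : ℂ) :
    SmoothMatAt (fun ζ => dirDeriv M ζ w) z := fun a b =>
  ((hM a b).fderiv_right (m := ∞) (by simp)).clm_apply contDiffAt_const

lemma dirDeriv_congr (h : M =ᶠ[𝓝 z] N) (w : ℂ) : dirDeriv M z w = dirDeriv N z w := by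
  ext a b
  simp only [dirDeriv, Matrix.of_apply]
  rw [Filter.EventuallyEq.fderiv_eq (f₁ := fun ζ => M ζ a b) (f := fun ζ => N ζ a b)
    (h.mono fun ζ hζ => by simp only [hζ])]

lemma dirDeriv_const (C : Matrix (Fin 2) (Fin 2) ℂ) (w : ℂ) :
    dirDeriv (fun _ => C) z w = 0 := by
  ext a b; simp [dirDeriv]

lemma dirDeriv_add (hM : SmoothMatAt M z) (hN : SmoothMatAt N z) (w : ℂ) :
    dirDeriv (fun ζ => M ζ + N ζ) z w = dirDeriv M z w + dirDeriv N z w := by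
  ext a b
  simp only [dirDeriv, Matrix.of_apply, Matrix.add_apply]
  rw [fderiv_fun_add (hM.diff a b) (hN.diff a b)]; rfl

lemma dirDeriv_sub (hM : SmoothMatAt M z) (hN : SmoothMatAt N z) (w : ℂ) :
    dirDeriv (fun ζ => M ζ - N ζ) z w = dirDeriv M z w - dirDeriv N z w := by
  ext a b
  simp only [dirDeriv, Matrix.of_apply, Matrix.sub_apply]
  rw [fderiv_fun_sub (hM.diff a b) (hN.diff a b)]; rfl

lemma dirDeriv_mul (hM : SmoothMatAt M z) (hN : SmoothMatAt N z) (w : ℂ) :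
    dirDeriv (fun ζ => M ζ * N ζ) z w = dirDeriv M z w * N z + M z * dirDeriv N z w := by
  ext a b
  simp only [dirDeriv, Matrix.of_apply, Matrix.add_apply, Matrix.mul_apply, Fin.sum_univ_two]
  rw [fderiv_fun_add ((hM.diff a 0).fun_mul (hN.diff 0 b)) ((hM.diff a 1).fun_mul (hN.diff 1 b)),
    fderiv_fun_mul (hM.diff a 0) (hN.diff 0 b), fderiv_fun_mul (hM.diff a 1) (hN.diff 1 b)]
  simp only [add_apply, smul_apply, smul_eq_mul]
  ring

lemma dirDeriv_smul {c : ℂ → ℂ} (hc : ContDiffAt ℝ ∞ c z) (hM : SmoothMatAt M z) (w : ℂ) :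
    dirDeriv (fun ζ => c ζ • M ζ) z w = fderiv ℝ c z w • M z + c z • dirDeriv M z w := by
  ext a b
  simp only [dirDeriv, Matrix.of_apply, Matrix.add_apply, Matrix.smul_apply, smul_eq_mul]
  rw [fderiv_fun_mul (differentiableAt_of_smooth hc) (hM.diff a b)]
  simp only [add_apply, smul_apply, smul_eq_mul]
  ring

lemma dirDeriv_const_smul (c : ℂ) (hM : SmoothMatAt M z) (w : ℂ) :
    dirDeriv (fun ζ => c • M ζ) z w = c • dirDeriv M z w := by
  rw [dirDeriv_smul contDiffAt_const hM]; simp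

lemma dirDeriv_lie (hM : SmoothMatAt M z) (hN : SmoothMatAt N z) (w : ℂ) :
    dirDeriv (fun ζ => ⁅M ζ, N ζ⁆) z w = ⁅dirDeriv M z w, N z⁆ + ⁅M z, dirDeriv N z w⁆ := by
  simp only [Ring.lie_def]
  rw [dirDeriv_sub (hM.mul hN) (hN.mul hM), dirDeriv_mul hM hN, dirDeriv_mul hN hM]
  abel

lemma dirDeriv_conjTranspose (hM : SmoothMatAt M z) (w : ℂ) :
    dirDeriv (fun ζ => (M ζ)ᴴ) z w = (dirDeriv M z w)ᴴ := by
  ext a b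
  simp only [dirDeriv, Matrix.of_apply, Matrix.conjTranspose_apply]
  exact fderiv_conj (hM.diff b a) w

lemma trace_dirDeriv (hM : SmoothMatAt M z) (w : ℂ) :
    (dirDeriv M z w).trace = fderiv ℝ (fun ζ => (M ζ).trace) z w := by
  simp only [Matrix.trace_fin_two]
  rw [fderiv_fun_add (hM.diff 0 0) (hM.diff 1 1)]
  simp [dirDeriv]

/-- Chain rule for a change of variables in the plane. -/
lemma dirDeriv_comp {h : ℂ → ℂ} (hM : SmoothMatAt M (h z)) (hh : DifferentiableAt ℝ h z) (w : ℂ) :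
    dirDeriv (fun ζ => M (h ζ)) z w = dirDeriv M (h z) (fderiv ℝ h z w) := by
  ext a b
  simp only [dirDeriv, Matrix.of_apply]
  have := fderiv_comp z (hM.diff a b) hh
  rw [show (fun ζ => M (h ζ) a b) = (fun ζ => M ζ a b) ∘ h from rfl, this]
  rfl

lemma dirDeriv_add_right (M : ℂ → Matrix (Fin 2) (Fin 2) ℂ) (z v w : ℂ) :
    dirDeriv M z (v + w) = dirDeriv M z v + dirDeriv M z w := by
  ext a b; simp [dirDeriv]

lemma dirDeriv_smul_right (M : ℂ → Matrix (Fin 2) (Fin 2) ℂ) (z : ℂ) (r : ℝ) (w : ℂ) :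
    dirDeriv M z (r • w) = r • dirDeriv M z w := by
  ext a b
  simp only [dirDeriv, Matrix.of_apply, Matrix.smul_apply, map_smul]

lemma dirDeriv_comm (hM : SmoothMatAt M z) (v w : ℂ) :
    dirDeriv (fun ζ => dirDeriv M ζ v) z w = dirDeriv (fun ζ => dirDeriv M ζ w) z v := by
  ext a b
  simp only [dirDeriv, Matrix.of_apply]
  have hs : IsSymmSndFDerivAt ℝ (fun ζ => M ζ a b) z := (hM a b).isSymmSndFDerivAt (by simpa using WithTop.coe_le_coe.2 (le_top : (2 : ℕ∞) ≤ ⊤))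
  have hd : DifferentiableAt ℝ (fderiv ℝ (fun ζ => M ζ a b)) z :=
    differentiableAt_of_smooth ((hM a b).fderiv_right (m := ∞) (by simp))
  rw [fderiv_clm_apply hd (differentiableAt_const _), fderiv_clm_apply hd (differentiableAt_const _)]
  simpa using hs w v

end MatrixCalculus

/-! ### Integrals depending smoothly on parameters -/

lemma hasFDerivAt_intervalIntegral_param {F : Type*} [NormedAddCommGroup F] [NormedSpace ℝ F]
    [CompleteSpace F] {H : ℂ × ℝ → F} (hH : ContDiff ℝ 1 H) (a b : ℝ) (z : ℂ) :
    HasFDerivAt (fun x => ∫ t in a..b, H (x, t))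
      (∫ t in a..b, (fderiv ℝ H (z, t)).comp (ContinuousLinearMap.inl ℝ ℂ ℝ)) z := by
  have hc : Continuous fun p : ℂ × ℝ => (fderiv ℝ H p).comp (ContinuousLinearMap.inl ℝ ℂ ℝ) :=
    (hH.continuous_fderiv (by simp)).clm_comp continuous_const
  obtain ⟨C, hC⟩ := ((isCompact_closedBall z 1).prod (isCompact_uIcc (a := a) (b := b))).exists_bound_of_continuousOn
    hc.continuousOn
  refine (intervalIntegral.hasFDerivAt_integral_of_dominated_of_fderiv_le (𝕜 := ℝ) (bound := fun _ => C)
    (F' := fun x t => (fderiv ℝ H (x, t)).comp (ContinuousLinearMap.inl ℝ ℂ ℝ))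
    (Metric.ball_mem_nhds z one_pos) ?_ ?_ ?_ ?_ ?_ ?_)
  · exact Filter.Eventually.of_forall fun x =>
      (hH.continuous.comp (by fun_prop : Continuous fun t : ℝ => (x, t))).aestronglyMeasurable
  · exact (hH.continuous.comp (by fun_prop : Continuous fun t : ℝ => (z, t))).intervalIntegrable _ _
  · exact (hc.comp (by fun_prop : Continuous fun t : ℝ => (z, t))).aestronglyMeasurable
  · refine Filter.Eventually.of_forall fun t ht x hx => hC (x, t) ⟨Metric.ball_subset_closedBall hx, ?_⟩
    exact Set.uIoc_subset_uIcc ht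
  · exact intervalIntegrable_const
  · refine Filter.Eventually.of_forall fun t _ x _ => ?_
    have h1 : HasFDerivAt H (fderiv ℝ H (x, t)) (x, t) :=
      (hH.differentiable (by simp) _).hasFDerivAt
    have h2 : HasFDerivAt (fun y : ℂ => (y, t)) (ContinuousLinearMap.inl ℝ ℂ ℝ) x :=
      hasFDerivAt_prodMk_left x t
    exact h1.comp x h2

lemma contDiff_intervalIntegral_nat (n : ℕ) : ∀ {F : Type} [NormedAddCommGroup F]
    [NormedSpace ℝ F] [CompleteSpace F] {H : ℂ × ℝ → F}, ContDiff ℝ ∞ H → ∀ a b : ℝ,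
    ContDiff ℝ n (fun x => ∫ t in a..b, H (x, t)) := by
  induction n with
  | zero =>
    intro F _ _ _ H hH a b
    refine contDiff_zero.2 ?_
    exact intervalIntegral.continuous_parametric_intervalIntegral_of_continuous' (f := fun x t => H (x, t)) hH.continuous a b
  | succ n ih =>
    intro F _ _ _ H hH a b
    rw [show ((n + 1 : ℕ) : WithTop ℕ∞) = (n : WithTop ℕ∞) + 1 by norm_cast,
      contDiff_succ_iff_hasFDerivAt]
    refine ⟨_, ?_, fun x => hasFDerivAt_intervalIntegral_param (hH.of_le (by simp)) a b x⟩
    exact ih (H := fun p => (fderiv ℝ H p).comp (ContinuousLinearMap.inl ℝ ℂ ℝ))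
      ((hH.fderiv_right (by simp)).clm_comp contDiff_const) a b

lemma contDiff_intervalIntegral {F : Type} [NormedAddCommGroup F] [NormedSpace ℝ F]
    [CompleteSpace F] {H : ℂ × ℝ → F} (hH : ContDiff ℝ ∞ H) (a b : ℝ) :
    ContDiff ℝ ∞ (fun x => ∫ t in a..b, H (x, t)) :=
  contDiff_infty.2 fun n => contDiff_intervalIntegral_nat n hH a b

/-! ### Holomorphic coordinates -/

section Charts

variable {X : Type u} [TopologicalSpace X] [ChartedSpace ℂ X]

variable (X) in
/-- The local holomorphic coordinates of `X`. -/
abbrev holAtlas : Set (OpenPartialHomeomorph X ℂ) := IsManifold.maximalAtlas 𝓘(ℂ) ω X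

variable {e e' : OpenPartialHomeomorph X ℂ}

/-- A function of a point and a tangent vector there may be evaluated at an equal point and a
tangent vector with the same underlying complex number. -/
lemma eval_congr {β : Sort*} (F : ∀ x : X, Tangent x → β) {x y : X} (h : x = y) {v : Tangent x}
    {w : Tangent y} (hv : @Eq ℂ v w) : F x v = F y w := by
  subst h; exact congrArg (F x) hv

lemma push_smul (e : OpenPartialHomeomorph X ℂ) (z c w : ℂ) :
    push e z (c * w) = c • push e z w :=
  (mfderiv 𝓘(ℂ) 𝓘(ℂ) e.symm z).map_smul c w

lemma push_eq_smul (e : OpenPartialHomeomorph X ℂ) (z w : ℂ) : push e z w = w • push e z 1 := by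
  rw [← push_smul, mul_one]

lemma push_add (e : OpenPartialHomeomorph X ℂ) (z v w : ℂ) :
    push e z (v + w) = push e z v + push e z w :=
  (mfderiv 𝓘(ℂ) 𝓘(ℂ) e.symm z).map_add v w

variable [IsManifold 𝓘(ℂ) ω X]

lemma atlas_subset_holAtlas : atlas ℂ X ⊆ holAtlas X := IsManifold.subset_maximalAtlas

lemma chartAt_mem_holAtlas (x : X) : chartAt ℂ x ∈ holAtlas X :=
  atlas_subset_holAtlas (chart_mem_atlas ℂ x)

lemma contDiffOn_coordChange (he : e ∈ holAtlas X) (he' : e' ∈ holAtlas X) :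
    ContDiffOn ℂ ω (e ∘ e'.symm) (e'.target ∩ e'.symm ⁻¹' e.source) := by
  have h := StructureGroupoid.compatible_of_mem_maximalAtlas he' he
  have h2 := (contDiffGroupoid ω 𝓘(ℂ)).mem_iff_of_eqOnSource
    (OpenPartialHomeomorph.eqOnSource_refl (e'.symm.trans e)) |>.1 h
  rw [contDiffGroupoid, mem_groupoid_of_pregroupoid] at h2
  have := h2.1
  simpa [contDiffPregroupoid, OpenPartialHomeomorph.trans_source] using this

lemma isOpen_overlap (e e' : OpenPartialHomeomorph X ℂ) :
    IsOpen (e'.target ∩ e'.symm ⁻¹' e.source) :=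
  e'.isOpen_inter_preimage_symm e.open_source

lemma contDiffAt_coordChange (he : e ∈ holAtlas X) (he' : e' ∈ holAtlas X) {ζ : ℂ}
    (hζ : ζ ∈ e'.target) (hs : e'.symm ζ ∈ e.source) : ContDiffAt ℂ ω (e ∘ e'.symm) ζ :=
  (contDiffOn_coordChange he he').contDiffAt ((isOpen_overlap e e').mem_nhds ⟨hζ, hs⟩)

lemma mdifferentiableAt_symm (he : e ∈ holAtlas X) {z : ℂ} (hz : z ∈ e.target) :
    MDifferentiableAt 𝓘(ℂ) 𝓘(ℂ) e.symm z :=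
  (contMDiffAt_symm_of_mem_maximalAtlas he hz).mdifferentiableAt (by simp)

/-- The coordinate vector fields of two coordinates differ by the derivative of the change of
coordinates. -/
lemma push_change (he : e ∈ holAtlas X) (he' : e' ∈ holAtlas X) {ζ : ℂ}
    (hζ : ζ ∈ e'.target) (hs : e'.symm ζ ∈ e.source) (w : ℂ) :
    @Eq ℂ (push e' ζ w) (push e (e (e'.symm ζ)) (deriv (e ∘ e'.symm) ζ * w)) := by
  have h1 : e'.symm =ᶠ[𝓝 ζ] e.symm ∘ (e ∘ e'.symm) := by
    filter_upwards [(isOpen_overlap e e').mem_nhds ⟨hζ, hs⟩] with y hy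
    exact (e.left_inv hy.2).symm
  have hd : DifferentiableAt ℂ (e ∘ e'.symm) ζ :=
    (contDiffAt_coordChange he he' hζ hs).differentiableAt (by simp)
  have h2 := h1.mfderiv_eq (I := 𝓘(ℂ)) (I' := 𝓘(ℂ))
  have h3 := mfderiv_comp ζ (I := 𝓘(ℂ)) (I' := 𝓘(ℂ)) (I'' := 𝓘(ℂ)) (g := e.symm)
    (f := e ∘ e'.symm) (mdifferentiableAt_symm he (e.map_source hs)) hd.mdifferentiableAt
  have h4 : mfderiv 𝓘(ℂ) 𝓘(ℂ) (e ∘ e'.symm) ζ w = deriv (e ∘ e'.symm) ζ * w := by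
    rw [mfderiv_eq_fderiv, mul_comm, ← smul_eq_mul, ← fderiv_eq_smul_deriv]
    rfl
  have h5 : @Eq (ℂ →L[ℂ] ℂ) (mfderiv 𝓘(ℂ) 𝓘(ℂ) e'.symm ζ)
    (mfderiv 𝓘(ℂ) 𝓘(ℂ) (e.symm ∘ (e ∘ e'.symm)) ζ) := h2
  unfold push
  rw [← h4]
  exact (congrArg (fun L : ℂ →L[ℂ] ℂ => L w) h5).trans (congrArg (fun L : ℂ →L[ℂ] ℂ => L w) h3)

lemma push_one_ne_zero (he : e ∈ holAtlas X) {z : ℂ} (hz : z ∈ e.target) :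
    @Ne ℂ (push e z 1) 0 := by
  intro h0
  have h1 : e ∘ e.symm =ᶠ[𝓝 z] id := by
    filter_upwards [e.open_target.mem_nhds hz] with y hy
    exact e.right_inv hy
  have h2 := h1.mfderiv_eq (I := 𝓘(ℂ)) (I' := 𝓘(ℂ))
  have h3 := mfderiv_comp z (I := 𝓘(ℂ)) (I' := 𝓘(ℂ)) (I'' := 𝓘(ℂ)) (g := e)
    (f := e.symm) ((contMDiffAt_of_mem_maximalAtlas he (e.map_target hz)).mdifferentiableAt
      (by simp)) (mdifferentiableAt_symm he hz)
  have h5 : @Eq (ℂ →L[ℂ] ℂ) (mfderiv 𝓘(ℂ) 𝓘(ℂ) (e ∘ e.symm) z) (mfderiv 𝓘(ℂ) 𝓘(ℂ) id z) := h2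
  have h6 : ∀ L : ℂ →L[ℂ] ℂ, L = mfderiv 𝓘(ℂ) 𝓘(ℂ) (id : ℂ → ℂ) z → L 1 = 1 := by
    rintro L rfl
    rw [mfderiv_id]; rfl
  have h7 : ∀ L : ℂ →L[ℂ] ℂ, L = mfderiv 𝓘(ℂ) 𝓘(ℂ) (e ∘ e.symm) z → L 1 = 0 := by
    rintro L rfl
    rw [h3]
    have : push e z 1 = 0 := h0
    change mfderiv 𝓘(ℂ) 𝓘(ℂ) e (e.symm z) (push e z 1) = 0
    rw [this]; exact map_zero _
  exact one_ne_zero ((h6 _ rfl).symm.trans (h7 _ h5.symm))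

lemma coordChange_eventually (e : OpenPartialHomeomorph X ℂ) {ζ : ℂ}
    (hζ : ζ ∈ e'.target) (hs : e'.symm ζ ∈ e.source) :
    ∀ᶠ y in 𝓝 ζ, y ∈ e'.target ∧ e'.symm y ∈ e.source :=
  (isOpen_overlap e e').mem_nhds ⟨hζ, hs⟩

/-! ### The underlying real surface -/

instance isManifold_real : IsManifold 𝓘(ℝ, ℂ) ∞ X := by
  refine isManifold_of_contDiffOn _ _ _ fun e e' he he' => ?_
  have h := contDiffOn_coordChange (atlas_subset_holAtlas he') (atlas_subset_holAtlas he)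
  have h2 : ContDiffOn ℝ ∞ (e' ∘ e.symm) (e.target ∩ e.symm ⁻¹' e'.source) :=
    (h.restrict_scalars ℝ).of_le le_top
  simpa [OpenPartialHomeomorph.trans_source] using h2

lemma mem_realAtlas (he : e ∈ holAtlas X) : e ∈ IsManifold.maximalAtlas 𝓘(ℝ, ℂ) ∞ X := by
  rw [IsManifold.maximalAtlas, mem_maximalAtlas_iff]
  have key : ∀ e₁ ∈ holAtlas X, ∀ e₂ ∈ holAtlas X, e₁.symm.trans e₂ ∈ contDiffGroupoid ∞ 𝓘(ℝ, ℂ) := by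
    intro e₁ h₁ e₂ h₂
    rw [contDiffGroupoid, mem_groupoid_of_pregroupoid]
    have a := ((contDiffOn_coordChange h₂ h₁).restrict_scalars ℝ).of_le (n := ω) (m := ∞) le_top
    have b := ((contDiffOn_coordChange h₁ h₂).restrict_scalars ℝ).of_le (n := ω) (m := ∞) le_top
    constructor
    · simpa [contDiffPregroupoid, OpenPartialHomeomorph.trans_source] using a
    · simpa [contDiffPregroupoid, OpenPartialHomeomorph.trans_target,
        OpenPartialHomeomorph.symm_symm] using b
  exact fun e₂ h₂ => ⟨key _ he _ (atlas_subset_holAtlas h₂), key _ (atlas_subset_holAtlas h₂) _ he⟩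

/-- Smoothness of a function at a point, read off in any holomorphic coordinate. -/
lemma contMDiffAt_iff_coord {F : Type*} [NormedAddCommGroup F] [NormedSpace ℝ F]
    (he : e ∈ holAtlas X) {x : X} (hx : x ∈ e.source) {u : X → F} :
    ContMDiffAt 𝓘(ℝ, ℂ) 𝓘(ℝ, F) ∞ u x ↔ ContDiffAt ℝ ∞ (fun z => u (e.symm z)) (e x) := by
  have he' := mem_realAtlas he
  constructor
  · intro h
    rw [← contMDiffAt_iff_contDiffAt]
    refine ContMDiffAt.comp (e x) (I' := 𝓘(ℝ, ℂ)) ?_ (contMDiffAt_symm_of_mem_maximalAtlas he' (e.map_source hx))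
    rwa [e.left_inv hx]
  · intro h
    rw [← contMDiffAt_iff_contDiffAt] at h
    have := ContMDiffAt.comp x (I' := 𝓘(ℝ, ℂ)) h (contMDiffAt_of_mem_maximalAtlas he' hx)
    refine this.congr_of_eventuallyEq ?_
    filter_upwards [e.open_source.mem_nhds hx] with y hy
    simp [e.left_inv hy]

end Charts

/-! ### Quadratic differentials -/

section Quadratic

variable {X : Type u} [TopologicalSpace X] [ChartedSpace ℂ X] [IsManifold 𝓘(ℂ) ω X]
  {e e' : OpenPartialHomeomorph X ℂ} {q : QuadraticDifferential X}

lemma QuadraticDifferential.coeff_change (q : QuadraticDifferential X)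
    (he : e ∈ holAtlas X) (he' : e' ∈ holAtlas X) {ζ : ℂ}
    (hζ : ζ ∈ e'.target) (hs : e'.symm ζ ∈ e.source) :
    q.coeff e' ζ = deriv (e ∘ e'.symm) ζ ^ 2 * q.coeff e (e (e'.symm ζ)) := by
  have h := push_change he he' hζ hs 1
  rw [mul_one] at h
  have h2 : q.coeff e' ζ = q (e.symm (e (e'.symm ζ))) (push e (e (e'.symm ζ)) (deriv (e ∘ e'.symm) ζ)) :=
    eval_congr (fun x v => q x v) (e.left_inv hs).symm h
  rw [h2, push_eq_smul, QuadraticMap.map_smul, QuadraticDifferential.coeff, smul_eq_mul]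
  ring

/-- The tangent vector at `x` with coordinate `1` in the preferred chart at `x`. -/
def unitVec (x : X) : Tangent x := (1 : ℂ)

/-- The coordinate of a tangent vector at `x` in the preferred chart at `x`. -/
def vecCoord {x : X} (v : Tangent x) : ℂ := v

lemma unitVec_ne_zero (x : X) : unitVec x ≠ 0 := one_ne_zero (α := ℂ)

lemma eq_vecCoord_smul {x : X} (v : Tangent x) : v = vecCoord v • unitVec x :=
  (mul_one (M := ℂ) v).symm

lemma vecCoord_push_ne_zero (he : e ∈ holAtlas X) {z : ℂ} (hz : z ∈ e.target) :
    vecCoord (push e z 1) ≠ 0 := push_one_ne_zero he hz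

/-- A quadratic form on a complex line is determined by its value at a nonzero vector. -/
lemma quadratic_eq_zero_iff {x : X} {v : Tangent x} (hv : v ≠ 0) (Q : QuadraticForm ℂ (Tangent x)) :
    Q v = 0 ↔ Q = 0 := by
  refine ⟨fun h => QuadraticMap.ext fun w => ?_, fun h => by rw [h]; rfl⟩
  have hw : w = (@HDiv.hDiv ℂ ℂ ℂ _ w v) • v := (div_mul_cancel₀ (G₀ := ℂ) w hv).symm
  rw [hw, QuadraticMap.map_smul, h]
  simp

lemma QuadraticDifferential.coeff_eq_zero_iff (q : QuadraticDifferential X)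
    (he : e ∈ holAtlas X) {z : ℂ} (hz : z ∈ e.target) : q.coeff e z = 0 ↔ q (e.symm z) = 0 :=
  quadratic_eq_zero_iff (push_one_ne_zero he hz) _

lemma QuadraticDifferential.coeff_ne_zero (q : QuadraticDifferential X)
    (he : e ∈ holAtlas X) {x : X} (hx : x ∈ e.source) (h : x ∈ q.punctured) :
    q.coeff e (e x) ≠ 0 := by
  rw [Ne, q.coeff_eq_zero_iff he (e.map_source hx), e.left_inv hx]; exact h

lemma QuadraticDifferential.IsHolomorphic.differentiableAt (hq : q.IsHolomorphic)
    (he : e ∈ holAtlas X) {z : ℂ} (hz : z ∈ e.target) : DifferentiableAt ℂ (q.coeff e) z := by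
  set e₀ := chartAt ℂ (e.symm z)
  have he₀ : e₀ ∈ holAtlas X := chartAt_mem_holAtlas _
  have hs : e.symm z ∈ e₀.source := mem_chart_source ℂ _
  have h1 : q.coeff e =ᶠ[𝓝 z] fun ζ => deriv (e₀ ∘ e.symm) ζ ^ 2 * q.coeff e₀ ((e₀ ∘ e.symm) ζ) := by
    filter_upwards [coordChange_eventually e₀ hz hs] with ζ hζ
    exact q.coeff_change he₀ he hζ.1 hζ.2
  have h2 := contDiffAt_coordChange he₀ he hz hs
  have h3 : DifferentiableAt ℂ (q.coeff e₀) ((e₀ ∘ e.symm) z) :=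
    (hq e₀ (chart_mem_atlas ℂ _)).differentiableAt (e₀.open_target.mem_nhds (e₀.map_source hs))
  have h4 : DifferentiableAt ℂ (deriv (e₀ ∘ e.symm)) z :=
    ((h2.analyticAt).deriv).differentiableAt
  exact ((h4.pow 2).mul (h3.comp z (h2.differentiableAt (by simp)))).congr_of_eventuallyEq h1

lemma QuadraticDifferential.IsHolomorphic.analyticAt (hq : q.IsHolomorphic)
    (he : e ∈ holAtlas X) {z : ℂ} (hz : z ∈ e.target) : AnalyticAt ℂ (q.coeff e) z :=
  DifferentiableOn.analyticAt (s := e.target)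
    (fun _ hy => (hq.differentiableAt he hy).differentiableWithinAt) (e.open_target.mem_nhds hz)

lemma QuadraticDifferential.IsHolomorphic.contDiffAt (hq : q.IsHolomorphic)
    (he : e ∈ holAtlas X) {z : ℂ} (hz : z ∈ e.target) : ContDiffAt ℝ ∞ (q.coeff e) z :=
  ((hq.analyticAt he hz).contDiffAt.restrict_scalars ℝ).of_le (n := ω) le_top

lemma QuadraticDifferential.IsHolomorphic.isOpen_punctured (hq : q.IsHolomorphic) :
    IsOpen q.punctured := by
  rw [isOpen_iff_mem_nhds]
  intro x hx
  set e := chartAt ℂ x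
  have he : e ∈ holAtlas X := chartAt_mem_holAtlas _
  have hs : x ∈ e.source := mem_chart_source ℂ _
  have h1 : ContinuousAt (q.coeff e ∘ e) x :=
    (hq.differentiableAt he (e.map_source hs)).continuousAt.comp (e.continuousAt hs)
  filter_upwards [h1.eventually_ne (q.coeff_ne_zero he hs hx), e.open_source.mem_nhds hs] with y hy hys
  intro h
  rw [← e.left_inv hys, ← q.coeff_eq_zero_iff he (e.map_source hys)] at h
  exact hy h

/-- Simple zeros are isolated. -/
lemma QuadraticDifferential.eventually_punctured (q : QuadraticDifferential X)
    (hq : q.IsHolomorphic) (hs : q.HasSimpleZeros) (p : X) : ∀ᶠ x in 𝓝[≠] p, x ∈ q.punctured := by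
  by_cases hp : q p = 0
  swap
  · exact nhdsWithin_le_nhds (hq.isOpen_punctured.mem_nhds hp)
  set e := chartAt ℂ p
  have he : e ∈ holAtlas X := chartAt_mem_holAtlas _
  have hps : p ∈ e.source := mem_chart_source ℂ _
  have h0 : q.coeff e (e p) = 0 := by
    rw [q.coeff_eq_zero_iff he (e.map_source hps), e.left_inv hps]; exact hp
  have hd := hs e (chart_mem_atlas ℂ _) _ (e.map_source hps) h0
  have h1 := (hq.differentiableAt he (e.map_source hps)).hasDerivAt.eventually_ne (c := 0) hd
  have h2 : Filter.Tendsto e (𝓝[≠] p) (𝓝[≠] (e p)) := by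
    refine tendsto_nhdsWithin_iff.2 ⟨(e.continuousAt hps).mono_left nhdsWithin_le_nhds, ?_⟩
    filter_upwards [nhdsWithin_le_nhds (e.open_source.mem_nhds hps), self_mem_nhdsWithin] with y hy hne
    exact fun h => hne (e.injOn hy hps h)
  filter_upwards [h2.eventually h1, nhdsWithin_le_nhds (e.open_source.mem_nhds hps)] with y hy hys h
  rw [← e.left_inv hys, ← q.coeff_eq_zero_iff he (e.map_source hys)] at h
  exact hy h

lemma QuadraticDifferential.finite_zeros [CompactSpace X] (hq : q.IsHolomorphic)
    (hs : q.HasSimpleZeros) : {p : X | q p = 0}.Finite := by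
  have hc : IsClosed {p : X | q p = 0} := by
    have := hq.isOpen_punctured.isClosed_compl
    simpa [QuadraticDifferential.punctured, Set.compl_ofPred] using this
  by_contra hinf
  obtain ⟨p, hp⟩ := Set.Infinite.exists_accPt_principal hinf
  rw [accPt_iff_frequently_nhdsNE] at hp
  exact hp ((q.eventually_punctured hq hs p).mono fun x hx h => hx h)

/-- The ratio of two functions of a tangent vector of the same homogeneity is a holomorphic
function on the surface, hence constant if the surface is closed. -/
lemma exists_eq_const_of_local [CompactSpace X] [ConnectedSpace X] {f : X → ℂ}
    (h : ∀ x, ∃ g : ℂ → ℂ, DifferentiableAt ℂ g (chartAt ℂ x x) ∧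
      f =ᶠ[𝓝 x] g ∘ chartAt ℂ x) : ∃ c, ∀ x, f x = c := by
  have hf : MDifferentiable 𝓘(ℂ) 𝓘(ℂ) f := by
    intro x
    obtain ⟨g, hg, hfg⟩ := h x
    refine MDifferentiableAt.congr_of_eventuallyEq ?_ hfg
    exact hg.mdifferentiableAt.comp x ((contMDiffAt_of_mem_maximalAtlas (chartAt_mem_holAtlas x)
      (mem_chart_source ℂ x)).mdifferentiableAt (by simp))
  obtain ⟨c, hc⟩ := hf.exists_eq_const_of_compactSpace
  exact ⟨c, fun x => by rw [hc]; rfl⟩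

/-- On a closed surface of genus at least two every holomorphic quadratic differential has a zero:
otherwise `α² / q` would be constant for every holomorphic one-form `α`, so that nonzero
holomorphic one-forms would vanish nowhere and their ratios would be constant. -/
lemma exists_zero_of_two_le_genus [CompactSpace X] [ConnectedSpace X] (hX : 2 ≤ genus X)
    (hq : q.IsHolomorphic) : ∃ p, q p = 0 := by
  by_contra! hne
  have hq1 : ∀ x : X, q x (unitVec x) ≠ 0 := fun x h =>
    hne x ((quadratic_eq_zero_iff (unitVec_ne_zero x) _).1 h)
  have hscale : ∀ (α : ∀ x : X, Tangent x →ₗ[ℂ] ℂ) (x : X) (v : Tangent x),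
      α x v = vecCoord v * α x (unitVec x) := by
    intro α x v
    conv_lhs => rw [eq_vecCoord_smul v, map_smul, smul_eq_mul]
  have hqscale : ∀ (x : X) (v : Tangent x),
      q x v = vecCoord v * vecCoord v * q x (unitVec x) := by
    intro x v
    conv_lhs => rw [eq_vecCoord_smul v, QuadraticMap.map_smul, smul_eq_mul]
  -- `α² / q` is constant
  have h1 : ∀ α : holomorphicForms X, ∃ c : ℂ, ∀ x, (α.1 x (unitVec x)) ^ 2 / q x (unitVec x) = c := by
    intro α
    refine exists_eq_const_of_local fun x => ?_
    set e := chartAt ℂ x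
    have he : e ∈ holAtlas X := chartAt_mem_holAtlas _
    have hx : x ∈ e.source := mem_chart_source ℂ x
    refine ⟨fun z => (α.1 (e.symm z) (push e z 1)) ^ 2 / q.coeff e z, ?_, ?_⟩
    · refine DifferentiableAt.div (DifferentiableAt.pow ?_ 2) (hq.differentiableAt he (e.map_source hx))
        (q.coeff_ne_zero he hx (hne x))
      exact (α.2 e (chart_mem_atlas ℂ x)).differentiableAt (e.open_target.mem_nhds (e.map_source hx))
    · filter_upwards [e.open_source.mem_nhds hx] with y hy
      have hp := vecCoord_push_ne_zero he (e.map_source hy)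
      simp only [Function.comp, QuadraticDifferential.coeff]
      rw [hscale α.1 _ (push e (e y) 1), hqscale _ (push e (e y) 1)]
      generalize vecCoord (push e (e y) 1) = t at hp ⊢
      rw [e.left_inv hy]
      have := hq1 y
      field_simp
  have h2 : ∀ α : holomorphicForms X, α ≠ 0 → ∀ x, α.1 x (unitVec x) ≠ 0 := by
    intro α hα
    obtain ⟨c, hc⟩ := h1 α
    intro x hx
    have hc0 : c = 0 := by rw [← hc x, hx]; simp
    apply hα
    refine Subtype.ext (funext fun y => LinearMap.ext fun v => ?_)
    rw [hscale α.1 y v]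
    have := hc y
    rw [hc0, div_eq_zero_iff, or_iff_left (hq1 y)] at this
    rw [pow_eq_zero_iff (by norm_num)] at this
    rw [this]; simp
  have h3 : genus X ≤ 1 := by
    by_cases hz : ∀ α : holomorphicForms X, α = 0
    · have : Subsingleton (holomorphicForms X) := ⟨fun a b => by rw [hz a, hz b]⟩
      rw [genus, Module.finrank_zero_of_subsingleton]
      norm_num
    · push Not at hz
      obtain ⟨α, hα⟩ := hz
      refine finrank_le_one α fun β => ?_
      obtain ⟨c, hc⟩ : ∃ c : ℂ, ∀ x, β.1 x (unitVec x) / α.1 x (unitVec x) = c := by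
        refine exists_eq_const_of_local fun x => ?_
        set e := chartAt ℂ x
        have he : e ∈ holAtlas X := chartAt_mem_holAtlas _
        have hx : x ∈ e.source := mem_chart_source ℂ x
        refine ⟨fun z => β.1 (e.symm z) (push e z 1) / α.1 (e.symm z) (push e z 1), ?_, ?_⟩
        · refine DifferentiableAt.div ?_ ?_ ?_
          · exact (β.2 e (chart_mem_atlas ℂ x)).differentiableAt
              (e.open_target.mem_nhds (e.map_source hx))
          · exact (α.2 e (chart_mem_atlas ℂ x)).differentiableAt
              (e.open_target.mem_nhds (e.map_source hx))
          · rw [hscale]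
            exact mul_ne_zero (vecCoord_push_ne_zero he (e.map_source hx)) (h2 α hα _)
        · filter_upwards [e.open_source.mem_nhds hx] with y hy
          have hp := vecCoord_push_ne_zero he (e.map_source hy)
          simp only [Function.comp]
          rw [hscale α.1 _ (push e (e y) 1), hscale β.1 _ (push e (e y) 1)]
          generalize vecCoord (push e (e y) 1) = t at hp ⊢
          rw [e.left_inv hy]
          have := h2 α hα y
          field_simp
      refine ⟨c, ?_⟩
      refine Subtype.ext (funext fun x => LinearMap.ext fun v => ?_)
      have := hc x
      rw [div_eq_iff (h2 α hα x)] at this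
      rw [hscale β.1 x v, this]
      change c * α.1 x v = _
      rw [hscale α.1 x v]
      ring
  omega

end Quadratic

/-! ### The operator `∂/∂z̄` -/

/-- The Wirtinger derivative `∂f/∂z̄`. -/
def wirt (f : ℂ → ℂ) (z : ℂ) : ℂ :=
  (1 / 2 : ℂ) * (fderiv ℝ f z 1 + Complex.I * fderiv ℝ f z Complex.I)

section Wirtinger

variable {f g h : ℂ → ℂ} {z : ℂ}

lemma wirt_congr (hfg : f =ᶠ[𝓝 z] g) : wirt f z = wirt g z := by
  rw [wirt, wirt, hfg.fderiv_eq]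

lemma wirt_add (hf : DifferentiableAt ℝ f z) (hg : DifferentiableAt ℝ g z) :
    wirt (fun ζ => f ζ + g ζ) z = wirt f z + wirt g z := by
  rw [wirt, wirt, wirt, fderiv_fun_add hf hg]
  simp only [add_apply]
  ring

lemma fderiv_real_of_complex (hg : DifferentiableAt ℂ g z) (w : ℂ) :
    fderiv ℝ g z w = deriv g z * w := by
  rw [(hg.hasFDerivAt.restrictScalars ℝ).fderiv]
  simp [mul_comm]

lemma wirt_mul_holomorphic (hf : DifferentiableAt ℝ f z) (hg : DifferentiableAt ℂ g z) :
    wirt (fun ζ => f ζ * g ζ) z = wirt f z * g z := by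
  rw [wirt, wirt, fderiv_fun_mul hf (hg.restrictScalars ℝ)]
  simp only [add_apply, smul_apply, smul_eq_mul, fderiv_real_of_complex hg]
  linear_combination (1 / 2 : ℂ) * f z * deriv g z * Complex.I_sq

lemma fderiv_re_im (L : ℂ →L[ℝ] ℂ) (w : ℂ) : L w = w.re * L 1 + w.im * L Complex.I := by
  have : w = (w.re : ℝ) • (1 : ℂ) + (w.im : ℝ) • Complex.I := by
    simp [Complex.re_add_im]
  conv_lhs => rw [this, map_add, map_smul, map_smul]
  simp

lemma wirt_comp_holomorphic (hf : DifferentiableAt ℝ f (h z)) (hh : DifferentiableAt ℂ h z) :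
    wirt (fun ζ => f (h ζ)) z = starRingEnd ℂ (deriv h z) * wirt f (h z) := by
  have hc := fderiv_comp z hf (hh.restrictScalars ℝ)
  rw [wirt, wirt, show (fun ζ => f (h ζ)) = f ∘ h from rfl, hc]
  simp only [ContinuousLinearMap.comp_apply, fderiv_real_of_complex hh, mul_one]
  generalize deriv h z = d
  rw [fderiv_re_im _ d, fderiv_re_im _ (d * Complex.I)]
  have h1 : (d * Complex.I).re = - d.im := by simp
  have h2 : (d * Complex.I).im = d.re := by simp
  have h3 : starRingEnd ℂ d = d.re - d.im * Complex.I := by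
    apply Complex.ext <;> simp
  rw [h1, h2, h3]
  push_cast
  linear_combination (1 / 2 : ℂ) * d.im * (fderiv ℝ f (h z) Complex.I) * Complex.I_sq

/-- `∂K/∂z̄` of a real function `K`, paired with a tangent vector. -/
lemma re_conj_mul_wirt {K : ℂ → ℝ} (hK : DifferentiableAt ℝ K z) (s : ℂ) :
    2 * (starRingEnd ℂ s * wirt (fun ζ => (K ζ : ℂ)) z).re = fderiv ℝ K z s := by
  have h1 : ∀ w, fderiv ℝ (fun ζ => (K ζ : ℂ)) z w = (fderiv ℝ K z w : ℝ) := by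
    intro w
    have := (Complex.ofRealCLM.hasFDerivAt (x := K z)).comp z hK.hasFDerivAt
    rw [show (fun ζ => (K ζ : ℂ)) = Complex.ofRealCLM ∘ K from rfl, this.fderiv]
    rfl
  have h2 : fderiv ℝ K z s = s.re * fderiv ℝ K z 1 + s.im * fderiv ℝ K z Complex.I := by
    have : s = (s.re : ℝ) • (1 : ℂ) + (s.im : ℝ) • Complex.I := by simp [Complex.re_add_im]
    conv_lhs => rw [this, map_add, map_smul, map_smul]
    simp
  rw [h2, wirt, h1, h1]
  simp
  ring

end Wirtinger

/-! ### Forms of type (0,1) -/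

section AntiForms

variable {X : Type u} [TopologicalSpace X] [ChartedSpace ℂ X]

variable (X) in
/-- A smooth form of type (0,1). -/
structure AntiForm where
  toFun : ∀ x : X, Tangent x → ℂ
  map_smul : ∀ x (c : ℂ) (v : Tangent x), toFun x (c • v) = starRingEnd ℂ c * toFun x v
  smooth : ∀ e ∈ holAtlas X, ∀ z ∈ e.target,
    ContDiffAt ℝ ∞ (fun ζ => toFun (e.symm ζ) (push e ζ 1)) z

/-- The coefficient `k(z)` of `κ = k dz̄` in the coordinate `e`. -/
def AntiForm.coeff (κ : AntiForm X) (e : OpenPartialHomeomorph X ℂ) (z : ℂ) : ℂ :=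
  κ.toFun (e.symm z) (push e z 1)

/-- The form `κ` vanishes outside the set `C`. -/
def AntiForm.SupportedIn (κ : AntiForm X) (C : Set X) : Prop :=
  ∀ x, x ∉ C → ∀ v, κ.toFun x v = 0

instance : Zero (AntiForm X) where
  zero := ⟨fun _ _ => 0, by simp, fun _ _ _ _ => contDiffAt_const⟩

instance : Add (AntiForm X) where
  add κ κ' := ⟨fun x v => κ.toFun x v + κ'.toFun x v, fun x c v => by
    rw [κ.map_smul, κ'.map_smul]; ring, fun e he z hz => (κ.smooth e he z hz).add (κ'.smooth e he z hz)⟩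

instance : Neg (AntiForm X) where
  neg κ := ⟨fun x v => - κ.toFun x v, fun x c v => by
    rw [κ.map_smul]; ring, fun e he z hz => (κ.smooth e he z hz).neg⟩

variable [IsManifold 𝓘(ℂ) ω X] {e e' : OpenPartialHomeomorph X ℂ}

/-- Multiplication of a form by a smooth real function. -/
def AntiForm.mulFun (κ : AntiForm X) (ρ : X → ℝ) (hρ : ∀ x, ContMDiffAt 𝓘(ℝ, ℂ) 𝓘(ℝ) ∞ ρ x) :
    AntiForm X where
  toFun x v := ρ x * κ.toFun x v
  map_smul x c v := by rw [κ.map_smul]; ring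
  smooth e he z hz := by
    have h := (contMDiffAt_iff_coord he (e.map_target hz)).1 (hρ (e.symm z))
    rw [e.right_inv hz] at h
    exact (Complex.ofRealCLM.contDiff.contDiffAt.comp z h).mul (κ.smooth e he z hz)

lemma AntiForm.coeff_change (κ : AntiForm X) (he : e ∈ holAtlas X) (he' : e' ∈ holAtlas X) {ζ : ℂ}
    (hζ : ζ ∈ e'.target) (hs : e'.symm ζ ∈ e.source) :
    κ.coeff e' ζ = starRingEnd ℂ (deriv (e ∘ e'.symm) ζ) * κ.coeff e (e (e'.symm ζ)) := by
  have h := push_change he he' hζ hs 1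
  rw [mul_one] at h
  have h2 : κ.coeff e' ζ = κ.toFun (e.symm (e (e'.symm ζ)))
      (push e (e (e'.symm ζ)) (deriv (e ∘ e'.symm) ζ)) :=
    eval_congr κ.toFun (e.left_inv hs).symm h
  rw [h2, push_eq_smul, κ.map_smul]
  rfl

/-- At the point `x`, the form `∂̄u - κ` pairs with the square roots of `-q` to real numbers. -/
def SolvesAt (q : QuadraticDifferential X) (u : X → ℂ) (κ : AntiForm X)
    (e : OpenPartialHomeomorph X ℂ) (x : X) : Prop :=
  ∀ l : ℂ, l ^ 2 = - q.coeff e (e x) →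
    ((wirt (fun z => u (e.symm z)) (e x) - κ.coeff e (e x)) * l).im = 0

variable {q : QuadraticDifferential X}

lemma wirt_change {u : X → ℂ} {x : X} (hu : ContMDiffAt 𝓘(ℝ, ℂ) 𝓘(ℝ, ℂ) ∞ u x)
    (he : e ∈ holAtlas X) (he' : e' ∈ holAtlas X) (hx : x ∈ e.source) (hx' : x ∈ e'.source) :
    wirt (fun z => u (e'.symm z)) (e' x) =
      starRingEnd ℂ (deriv (e ∘ e'.symm) (e' x)) * wirt (fun z => u (e.symm z)) (e x) := by
  have ht := e'.map_source hx'
  have hs : e'.symm (e' x) ∈ e.source := by rwa [e'.left_inv hx']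
  have h1 : (fun z => u (e'.symm z)) =ᶠ[𝓝 (e' x)]
      fun z => (fun ζ => u (e.symm ζ)) ((e ∘ e'.symm) z) := by
    filter_upwards [coordChange_eventually e ht hs] with y hy
    simp only [Function.comp, e.left_inv hy.2]
  have h2 := (contDiffAt_coordChange he he' ht hs).differentiableAt (by simp)
  have h3 : (e ∘ e'.symm) (e' x) = e x := by simp [e'.left_inv hx']
  rw [wirt_congr h1, wirt_comp_holomorphic (f := fun ζ => u (e.symm ζ)) (h := e ∘ e'.symm) ?_ h2, h3]
  rw [h3]
  exact differentiableAt_of_smooth ((contMDiffAt_iff_coord he hx).1 hu)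

lemma SolvesAt.change {u : X → ℂ} {κ : AntiForm X} {x : X}
    (hu : ContMDiffAt 𝓘(ℝ, ℂ) 𝓘(ℝ, ℂ) ∞ u x) (he : e ∈ holAtlas X) (he' : e' ∈ holAtlas X)
    (hx : x ∈ e.source) (hx' : x ∈ e'.source) (h : SolvesAt q u κ e x) : SolvesAt q u κ e' x := by
  intro l hl
  have ht := e'.map_source hx'
  have hs : e'.symm (e' x) ∈ e.source := by rwa [e'.left_inv hx']
  rw [q.coeff_change he he' ht hs, e'.left_inv hx'] at hl
  rw [wirt_change hu he he' hx hx', κ.coeff_change he he' ht hs, e'.left_inv hx']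
  set d := deriv (e ∘ e'.symm) (e' x) with hd
  have hd0 : d ≠ 0 := by
    intro h0
    have h1 := push_change he he' ht hs 1
    rw [← hd, h0, zero_mul] at h1
    exact push_one_ne_zero he' ht (h1.trans (map_zero (mfderiv 𝓘(ℂ) 𝓘(ℂ) e.symm _)))
  have h2 : (l / d) ^ 2 = - q.coeff e (e x) := by
    rw [div_pow, hl]; field_simp
  have h3 := h (l / d) h2
  set a := wirt (fun z => u (e.symm z)) (e x) - κ.coeff e (e x)
  have h4 : (starRingEnd ℂ d * wirt (fun z => u (e.symm z)) (e x) -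
      starRingEnd ℂ d * κ.coeff e (e x)) * l = (Complex.normSq d : ℝ) * (a * (l / d)) := by
    rw [Complex.normSq_eq_conj_mul_self]
    simp only [a]; field_simp
  rw [h4, Complex.im_ofReal_mul, h3, mul_zero]

/-- The equation `∂̄u = κ`, modulo forms which pair with the square roots of `-q` to real numbers,
has a solution that vanishes near the zeros of `q`. -/
def Solvable (q : QuadraticDifferential X) (κ : AntiForm X) : Prop :=
  ∃ u : X → ℂ, (∀ x, ContMDiffAt 𝓘(ℝ, ℂ) 𝓘(ℝ, ℂ) ∞ u x) ∧
    (∀ p, q p = 0 → u =ᶠ[𝓝 p] 0) ∧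
    ∀ e ∈ holAtlas X, ∀ x ∈ e.source, x ∈ q.punctured → SolvesAt q u κ e x

lemma Solvable.zero : Solvable q 0 := by
  refine ⟨0, fun x => contMDiffAt_const, fun p _ => Filter.EventuallyEq.rfl, fun e he x hx hq l hl => ?_⟩
  have : wirt (fun z => (0 : X → ℂ) (e.symm z)) (e x) = 0 := by simp [wirt]
  rw [this]
  change ((0 - (0 : ℂ)) * l).im = 0
  simp

lemma Solvable.add {κ κ' : AntiForm X} (h : Solvable q κ) (h' : Solvable q κ') :
    Solvable q (κ + κ') := by
  obtain ⟨u, hu, hz, hs⟩ := h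
  obtain ⟨u', hu', hz', hs'⟩ := h'
  refine ⟨fun x => u x + u' x, fun x => (hu x).add (hu' x), fun p hp => ?_, fun e he x hx hq l hl => ?_⟩
  · filter_upwards [hz p hp, hz' p hp] with x h1 h2
    simp [h1, h2]
  · have h1 := hs e he x hx hq l hl
    have h2 := hs' e he x hx hq l hl
    rw [wirt_add (differentiableAt_of_smooth ((contMDiffAt_iff_coord he hx).1 (hu x)))
      (differentiableAt_of_smooth ((contMDiffAt_iff_coord he hx).1 (hu' x)))]
    change ((_ - (κ.coeff e (e x) + κ'.coeff e (e x))) * l).im = 0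
    rw [add_sub_add_comm, add_mul, Complex.add_im, h1, h2, add_zero]

lemma Solvable.congr {κ κ' : AntiForm X} (h : Solvable q κ)
    (hκ : ∀ x v, κ'.toFun x v = κ.toFun x v) : Solvable q κ' := by
  have : κ' = κ := by
    cases κ; cases κ'
    congr
    funext x v; exact hκ x v
  rwa [this]

/-- The extension by zero of a function of a local coordinate. -/
def extendPlane (e : OpenPartialHomeomorph X ℂ) (f : ℂ → ℂ) (x : X) : ℂ :=
  open Classical in if x ∈ e.source then f (e x) else 0

lemma extendPlane_symm (f : ℂ → ℂ) {z : ℂ} (hz : z ∈ e.target) :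
    extendPlane e f (e.symm z) = f z := by
  simp [extendPlane, e.map_target hz, e.right_inv hz]

lemma isClosed_image_symm [T2Space X] {C : Set ℂ} (hC : IsCompact C) (hCe : C ⊆ e.target) :
    IsClosed (e.symm '' C) :=
  (hC.image_of_continuousOn (e.continuousOn_symm.mono hCe)).isClosed

lemma extendPlane_eq_zero {f : ℂ → ℂ} {C : Set ℂ}
    (hf : ∀ z ∉ C, f z = 0) {x : X} (hx : x ∉ e.symm '' C) : extendPlane e f x = 0 := by
  unfold extendPlane
  split_ifs with h
  · exact hf _ fun h2 => hx ⟨e x, h2, e.left_inv h⟩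
  · rfl

lemma contMDiffAt_extendPlane [T2Space X] (he : e ∈ holAtlas X) {f : ℂ → ℂ} {C : Set ℂ}
    (hC : IsCompact C) (hCe : C ⊆ e.target) (hf : ∀ z ∉ C, f z = 0)
    (hfs : ∀ z ∈ e.target, ContDiffAt ℝ ∞ f z) (x : X) :
    ContMDiffAt 𝓘(ℝ, ℂ) 𝓘(ℝ, ℂ) ∞ (extendPlane e f) x := by
  by_cases hx : x ∈ e.source
  · rw [contMDiffAt_iff_coord he hx]
    refine (hfs _ (e.map_source hx)).congr_of_eventuallyEq ?_
    filter_upwards [e.open_target.mem_nhds (e.map_source hx)] with z hz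
    exact extendPlane_symm f hz
  · have h1 : x ∉ e.symm '' C := by
      rintro ⟨z, hz, rfl⟩; exact hx (e.map_target (hCe hz))
    have h2 : extendPlane e f =ᶠ[𝓝 x] fun _ => 0 := by
      filter_upwards [(isClosed_image_symm hC hCe).isOpen_compl.mem_nhds h1] with y hy
      exact extendPlane_eq_zero hf hy
    exact contMDiffAt_const.congr_of_eventuallyEq h2

/-- The extension by zero of the form `k dz̄` in a local coordinate. -/
def AntiForm.ofPlane [T2Space X] (he : e ∈ holAtlas X) (k : ℂ → ℂ) {C : Set ℂ}
    (hC : IsCompact C) (hCe : C ⊆ e.target) (hk : ∀ z ∉ C, k z = 0)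
    (hks : ∀ z ∈ e.target, ContDiffAt ℝ ∞ k z) : AntiForm X where
  toFun x v := extendPlane e k x * starRingEnd ℂ (vecCoord v / vecCoord (push e (e x) 1))
  map_smul x c v := by
    have : vecCoord (c • v) = c * vecCoord v := rfl
    rw [this, mul_div_assoc, map_mul]; ring
  smooth e' he' z hz := by
    by_cases hx : e'.symm z ∈ e.source
    · have h1 : ContDiffAt ℝ ∞ (fun ζ => k ((e ∘ e'.symm) ζ) *
          starRingEnd ℂ (deriv (e ∘ e'.symm) ζ)) z := by
        have h2 := contDiffAt_coordChange he he' hz hx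
        have h3 : ContDiffAt ℝ ∞ (e ∘ e'.symm) z := (h2.restrict_scalars ℝ).of_le le_top
        have h4 : ContDiffAt ℝ ∞ (deriv (e ∘ e'.symm)) z :=
          (h2.analyticAt.deriv.contDiffAt.restrict_scalars ℝ).of_le (n := ω) le_top
        exact (ContDiffAt.comp z (hks _ (e.map_source hx)) h3).mul (contDiffAt_conj h4)
      refine h1.congr_of_eventuallyEq ?_
      filter_upwards [coordChange_eventually e hz hx] with ζ hζ
      have h5 : vecCoord (push e' ζ 1) = vecCoord (push e (e (e'.symm ζ)) (deriv (e ∘ e'.symm) ζ * 1)) :=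
        push_change he he' hζ.1 hζ.2 1
      have h6 : vecCoord (push e (e (e'.symm ζ)) (deriv (e ∘ e'.symm) ζ * 1)) =
          deriv (e ∘ e'.symm) ζ * vecCoord (push e (e (e'.symm ζ)) 1) := by
        rw [push_smul]; rfl
      rw [h5, h6, mul_div_cancel_right₀ _ (vecCoord_push_ne_zero he (e.map_source hζ.2))]
      simp [extendPlane, hζ.2]
    · have h1 : e'.symm z ∉ e.symm '' C := by
        rintro ⟨y, hy, h⟩; exact hx (h ▸ e.map_target (hCe hy))
      have h2 : ∀ᶠ ζ in 𝓝 z, e'.symm ζ ∉ e.symm '' C :=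
        (e'.continuousAt_symm hz).eventually
          ((isClosed_image_symm hC hCe).isOpen_compl.mem_nhds h1)
      refine (contDiffAt_const (c := (0 : ℂ))).congr_of_eventuallyEq ?_
      filter_upwards [h2] with ζ hζ
      rw [extendPlane_eq_zero hk hζ, zero_mul]

lemma AntiForm.ofPlane_coeff [T2Space X] (he : e ∈ holAtlas X) (k : ℂ → ℂ) {C : Set ℂ}
    (hC : IsCompact C) (hCe : C ⊆ e.target) (hk : ∀ z ∉ C, k z = 0)
    (hks : ∀ z ∈ e.target, ContDiffAt ℝ ∞ k z) {z : ℂ} (hz : z ∈ e.target) :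
    (AntiForm.ofPlane he k hC hCe hk hks).coeff e z = k z := by
  change extendPlane e k (e.symm z) * starRingEnd ℂ (vecCoord (push e z 1) /
    vecCoord (push e (e (e.symm z)) 1)) = _
  rw [extendPlane_symm k hz, e.right_inv hz, div_self (vecCoord_push_ne_zero he hz)]
  simp

lemma AntiForm.ofPlane_supported [T2Space X] (he : e ∈ holAtlas X) (k : ℂ → ℂ) {C : Set ℂ}
    (hC : IsCompact C) (hCe : C ⊆ e.target) (hk : ∀ z ∉ C, k z = 0)
    (hks : ∀ z ∈ e.target, ContDiffAt ℝ ∞ k z) :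
    (AntiForm.ofPlane he k hC hCe hk hks).SupportedIn (e.symm '' C) := by
  intro x hx v
  change extendPlane e k x * _ = 0
  rw [extendPlane_eq_zero hk hx, zero_mul]

/-- A compactly supported solution in a coordinate domain without zeros of `q` is a global one. -/
lemma Solvable.of_plane [T2Space X] (he : e ∈ holAtlas X) {κ : AntiForm X} {C : Set ℂ}
    (hC : IsCompact C) (hCe : C ⊆ e.target) (hCq : e.symm '' C ⊆ q.punctured)
    (hκ : κ.SupportedIn (e.symm '' C))
    {f : ℂ → ℂ} (hf : ∀ z ∉ C, f z = 0) (hfs : ∀ z ∈ C, ContDiffAt ℝ ∞ f z)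
    (hsol : ∀ z ∈ C, ∀ l : ℂ, l ^ 2 = - q.coeff e z → ((wirt f z - κ.coeff e z) * l).im = 0) :
    Solvable q κ := by
  have hfs' : ∀ z ∈ e.target, ContDiffAt ℝ ∞ f z := by
    intro z _
    by_cases hz : z ∈ C
    · exact hfs z hz
    · refine (contDiffAt_const (c := (0 : ℂ))).congr_of_eventuallyEq ?_
      filter_upwards [hC.isClosed.isOpen_compl.mem_nhds hz] with y hy using hf y hy
  have hsm := contMDiffAt_extendPlane he hC hCe hf hfs'
  have hzero : ∀ x, x ∉ e.symm '' C → extendPlane e f =ᶠ[𝓝 x] 0 := by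
    intro x hx
    filter_upwards [(isClosed_image_symm hC hCe).isOpen_compl.mem_nhds hx] with y hy
    exact extendPlane_eq_zero hf hy
  refine ⟨extendPlane e f, hsm, fun p hp => hzero p fun h => hCq h hp, fun e' he' x hx hxq => ?_⟩
  by_cases hxC : x ∈ e.symm '' C
  · obtain ⟨z, hz, rfl⟩ := hxC
    have hze := hCe hz
    refine SolvesAt.change (hsm _) he he' (e.map_target hze) hx fun l hl => ?_
    rw [e.right_inv hze] at hl ⊢
    rw [wirt_congr (g := f)]
    · exact hsol z hz l hl
    · filter_upwards [e.open_target.mem_nhds hze] with y hy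
      exact extendPlane_symm f hy
  · intro l hl
    have h1 : (fun z => extendPlane e f (e'.symm z)) =ᶠ[𝓝 (e' x)] fun _ => 0 := by
      have : Filter.Tendsto e'.symm (𝓝 (e' x)) (𝓝 x) := by
        have := e'.continuousAt_symm (e'.map_source hx)
        rwa [ContinuousAt, e'.left_inv hx] at this
      exact this.eventually (hzero x hxC)
    have h2 : κ.coeff e' (e' x) = 0 := by
      unfold AntiForm.coeff
      exact hκ _ (by rwa [e'.left_inv hx]) _
    rw [wirt_congr h1, h2]
    simp [wirt]

end AntiForms

/-! ### Solving the twisted `∂̄`-equation with compact supports -/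

section Core

lemma contDiffAt_of_zero_off {F : Type*} [NormedAddCommGroup F] [NormedSpace ℝ F] {f : ℂ → F}
    {C : Set ℂ} (hC : IsClosed C) (hf : ∀ z ∉ C, f z = 0) {z : ℂ} (hz : z ∉ C) :
    ContDiffAt ℝ ∞ f z := by
  refine (contDiffAt_const (c := (0 : F))).congr_of_eventuallyEq ?_
  filter_upwards [hC.isOpen_compl.mem_nhds hz] with y hy using hf y hy

/-- Sliding the window of integration. -/
lemma hasDerivAt_integral_sub {F : Type*} [NormedAddCommGroup F] [NormedSpace ℝ F]
    [CompleteSpace F] {φ : ℝ → F} (hφ : Continuous φ) (a b : ℝ) :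
    HasDerivAt (fun τ : ℝ => ∫ t in a..b, φ (t - τ)) (φ a - φ b) 0 := by
  have h1 : (fun τ : ℝ => ∫ t in a..b, φ (t - τ)) =
      fun τ => (∫ t in (0 : ℝ)..(b - τ), φ t) - ∫ t in (0 : ℝ)..(a - τ), φ t := by
    funext τ
    rw [intervalIntegral.integral_comp_sub_right, intervalIntegral.integral_interval_sub_left
      (hφ.intervalIntegrable _ _) (hφ.intervalIntegrable _ _)]
  rw [h1]
  have h2 : ∀ c : ℝ, HasDerivAt (fun τ : ℝ => ∫ t in (0 : ℝ)..(c - τ), φ t) (-φ c) 0 := by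
    intro c
    have h3 : HasDerivAt (fun x : ℝ => ∫ t in (0 : ℝ)..x, φ t) (φ (c - 0)) (c - 0) :=
      intervalIntegral.integral_hasDerivAt_right (hφ.intervalIntegrable _ _)
        hφ.stronglyMeasurable.stronglyMeasurableAtFilter hφ.continuousAt
    have h4 : HasDerivAt (fun τ : ℝ => c - τ) (-1) 0 := by
      simpa using (hasDerivAt_id (0 : ℝ)).const_sub c
    have h5 := HasDerivAt.scomp (0 : ℝ) h3 h4
    simpa [Function.comp_def] using h5
  have := (h2 b).sub (h2 a)
  refine this.congr_deriv ?_
  abel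

/-- A holomorphic function has holomorphic roots near a point where it does not vanish. -/
lemma exists_local_root (n : ℕ) (hn : n ≠ 0) {a : ℂ → ℂ} {z₀ : ℂ} (ha : AnalyticAt ℂ a z₀)
    (h0 : a z₀ ≠ 0) :
    ∃ l : ℂ → ℂ, AnalyticAt ℂ l z₀ ∧ l z₀ ≠ 0 ∧ ∀ᶠ z in 𝓝 z₀, l z ^ n = a z := by
  obtain ⟨c, hc⟩ := IsAlgClosed.exists_pow_nat_eq (a z₀) (n := n) (Nat.pos_of_ne_zero hn)
  have hc0 : c ≠ 0 := by rintro rfl; exact h0 (by simpa [hn] using hc.symm)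
  have h1 : AnalyticAt ℂ (fun z => a z / a z₀) z₀ := ha.div analyticAt_const h0
  have hn' : (n : ℂ) ≠ 0 := by exact_mod_cast hn
  refine ⟨fun z => c * Complex.exp (Complex.log (a z / a z₀) / n), ?_, ?_, ?_⟩
  · refine analyticAt_const.mul (AnalyticAt.cexp ((AnalyticAt.clog h1 ?_).div analyticAt_const hn'))
    simp [div_self h0]
  · exact mul_ne_zero hc0 (Complex.exp_ne_zero _)
  · filter_upwards [ha.continuousAt.eventually_ne h0] with z hz
    rw [mul_pow, ← Complex.exp_nat_mul, mul_div_cancel₀ _ hn',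
      Complex.exp_log (div_ne_zero hz h0), hc]
    field_simp

variable {X : Type u} [TopologicalSpace X] [ChartedSpace ℂ X] [IsManifold 𝓘(ℂ) ω X]
  {e e' : OpenPartialHomeomorph X ℂ} {q : QuadraticDifferential X}

/-- All forms supported in some neighbourhood of `p`, away from the zeros of `q`, are solvable. -/
def GoodAt (q : QuadraticDifferential X) (p : X) : Prop :=
  ∃ U : Set X, IsOpen U ∧ p ∈ U ∧ ∀ (κ : AntiForm X) (C : Set X), IsClosed C → C ⊆ U →
    C ⊆ q.punctured → κ.SupportedIn C → Solvable q κ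

lemma AntiForm.exists_planar [T2Space X] [CompactSpace X] (he : e ∈ holAtlas X) (κ : AntiForm X)
    {C : Set X} (hC : IsClosed C) (hCe : C ⊆ e.source) (hκ : κ.SupportedIn C) :
    IsCompact (e '' C) ∧ e '' C ⊆ e.target ∧ e.symm '' (e '' C) = C ∧
    ∃ k : ℂ → ℂ, ContDiff ℝ ∞ k ∧ (∀ z ∉ e '' C, k z = 0) ∧ ∀ z ∈ e.target, κ.coeff e z = k z := by
  have h1 : IsCompact (e '' C) := hC.isCompact.image_of_continuousOn (e.continuousOn.mono hCe)
  have h2 : e '' C ⊆ e.target := by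
    rintro _ ⟨x, hx, rfl⟩; exact e.map_source (hCe hx)
  have h3 : e.symm '' (e '' C) = C := by
    ext x
    constructor
    · rintro ⟨_, ⟨y, hy, rfl⟩, rfl⟩; rwa [e.left_inv (hCe hy)]
    · intro hx; exact ⟨e x, ⟨x, hx, rfl⟩, e.left_inv (hCe hx)⟩
  refine ⟨h1, h2, h3, ?_⟩
  classical
  set k : ℂ → ℂ := fun z => if z ∈ e '' C then κ.coeff e z else 0 with hk
  have h4 : ∀ z ∈ e.target, κ.coeff e z = k z := by
    intro z hz
    by_cases hzC : z ∈ e '' C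
    · simp only [hk, if_pos hzC]
    · simp only [hk, if_neg hzC]
      refine hκ _ (fun h => hzC ⟨_, h, e.right_inv hz⟩) _
  have h5 : ∀ z ∉ e '' C, k z = 0 := fun z hz => by simp only [hk, if_neg hz]
  refine ⟨k, contDiff_iff_contDiffAt.2 fun z => ?_, h5, h4⟩
  by_cases hz : z ∈ e.target
  · refine ContDiffAt.congr_of_eventuallyEq (κ.smooth e he z hz) ?_
    filter_upwards [e.open_target.mem_nhds hz] with y hy using (h4 y hy).symm
  · exact contDiffAt_of_zero_off h1.isClosed h5 fun h => hz (h2 h)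

/-- Forms near a point can be moved to nearby points by translation in a coordinate. -/
lemma GoodAt.translate [T2Space X] [CompactSpace X] (he : e ∈ holAtlas X) {x₀ y : X} {R : ℝ}
    (hx₀ : x₀ ∈ e.source) (hR : Metric.ball (e x₀) R ⊆ e.target) {l : ℂ → ℂ}
    (hl : ∀ z ∈ Metric.ball (e x₀) R, AnalyticAt ℂ l z ∧ l z ≠ 0 ∧ l z ^ 2 = - q.coeff e z)
    (hy : y ∈ e.source) (hyR : e y ∈ Metric.ball (e x₀) (R / 2)) (hgood : GoodAt q y) :
    GoodAt q x₀ := by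
  obtain ⟨Uy, hUy, hyU, hsolve⟩ := hgood
  have hRpos : 0 < R := by
    have := (dist_nonneg).trans_lt (Metric.mem_ball.1 hyR); linarith
  -- a radius for which the translated ball lies in the good neighbourhood of `y`
  obtain ⟨δ, hδ, hδR, hδU⟩ : ∃ δ > 0, δ ≤ R / 2 ∧ ∀ z ∈ Metric.ball (e y) δ, e.symm z ∈ Uy := by
    have h1 : ∀ᶠ z in 𝓝 (e y), e.symm z ∈ Uy := by
      have := e.continuousAt_symm (e.map_source hy)
      refine this.eventually (hUy.mem_nhds ?_)
      rwa [e.left_inv hy]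
    obtain ⟨δ, hδ, h⟩ := Metric.eventually_nhds_iff_ball.1 h1
    refine ⟨min δ (R / 2), lt_min hδ (by linarith), min_le_right _ _, fun z hz => h z ?_⟩
    exact Metric.ball_subset_ball (min_le_left _ _) hz
  refine ⟨e.source ∩ e ⁻¹' Metric.ball (e x₀) δ, e.isOpen_inter_preimage Metric.isOpen_ball,
    ⟨hx₀, Metric.mem_ball_self hδ⟩, fun κ C hC hCU hCq hκ => ?_⟩
  obtain ⟨hc1, hc2, hc3, k, hk, hk0, hkc⟩ :=
    κ.exists_planar he hC (fun x hx => (hCU hx).1) hκ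
  set D := e '' C with hD
  have hDball : D ⊆ Metric.ball (e x₀) δ := by
    rintro _ ⟨x, hx, rfl⟩; exact (hCU hx).2
  set s : ℂ := e y - e x₀ with hs
  have hsn : ‖s‖ < R / 2 := by rwa [hs, ← dist_eq_norm]
  set h : ℂ → ℝ := fun z => (k z * l z).im with hh
  have hh0 : ∀ z ∉ D, h z = 0 := fun z hz => by simp [hh, hk0 z hz]
  have hball : Metric.ball (e x₀) δ ⊆ Metric.ball (e x₀) R :=
    Metric.ball_subset_ball (by linarith)
  have hls : ∀ z ∈ Metric.ball (e x₀) R, ContDiffAt ℝ ∞ l z := fun z hz =>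
    ((hl z hz).1.contDiffAt.restrict_scalars ℝ).of_le (n := ω) le_top
  have hhs : ContDiff ℝ ∞ h := by
    refine contDiff_iff_contDiffAt.2 fun z => ?_
    by_cases hz : z ∈ D
    · exact Complex.imCLM.contDiff.contDiffAt.comp z
        (hk.contDiffAt.mul (hls z (hball (hDball hz))))
    · exact contDiffAt_of_zero_off hc1.isClosed hh0 hz
  set K : ℂ → ℝ := fun z => ∫ t in (0 : ℝ)..1, h (z - t * s) with hK
  have hKs : ContDiff ℝ ∞ K := by
    refine contDiff_intervalIntegral (H := fun p : ℂ × ℝ => h (p.1 - p.2 * s)) (hhs.comp ?_) 0 1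
    exact contDiff_fst.sub ((Complex.ofRealCLM.contDiff.comp contDiff_snd).mul contDiff_const)
  -- the set swept out by the support during the translation
  set D' : Set ℂ := (fun p : ℝ × ℂ => p.2 + p.1 * s) '' (Set.Icc 0 1 ×ˢ D) with hD'
  have hD'c : IsCompact D' := (isCompact_Icc.prod hc1).image (by fun_prop)
  have hD'ball : D' ⊆ Metric.ball (e x₀) R := by
    rintro _ ⟨⟨t, z⟩, ⟨ht, hz⟩, rfl⟩
    have h1 := Metric.mem_ball.1 (hDball hz)
    rw [Metric.mem_ball, dist_eq_norm] at *
    have h2 : ‖(t : ℂ) * s‖ ≤ ‖s‖ := by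
      rw [norm_mul, Complex.norm_real, Real.norm_eq_abs, abs_of_nonneg ht.1]
      exact mul_le_of_le_one_left (norm_nonneg _) ht.2
    calc ‖z + t * s - e x₀‖ = ‖(z - e x₀) + t * s‖ := by ring_nf
      _ ≤ ‖z - e x₀‖ + ‖(t : ℂ) * s‖ := norm_add_le _ _
      _ < R := by linarith
  have hK0 : ∀ z ∉ D', K z = 0 := by
    intro z hz
    have : ∀ t ∈ Set.uIcc (0 : ℝ) 1, h (z - t * s) = (fun _ => (0 : ℝ)) t := by
      intro t ht
      rw [Set.uIcc_of_le zero_le_one] at ht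
      exact hh0 _ fun hzD => hz ⟨(t, z - t * s), ⟨ht, hzD⟩, by ring⟩
    simp only [hK]
    rw [intervalIntegral.integral_congr this]
    simp
  have hKd : ∀ z, fderiv ℝ K z s = h z - h (z - s) := by
    intro z
    have h1 : HasDerivAt (fun τ : ℝ => K (z + τ * s)) (fderiv ℝ K z s) 0 := by
      have h2 : HasDerivAt (fun τ : ℝ => z + τ * s) s 0 := by
        have := ((Complex.ofRealCLM.hasDerivAt (x := (0 : ℝ))).mul_const s).const_add z
        simpa using this
      have h3 : HasFDerivAt K (fderiv ℝ K z) (z + (0 : ℝ) * s) := by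
        simpa using (hKs.differentiable (by simp) z).hasFDerivAt
      exact h3.comp_hasDerivAt (0 : ℝ) h2
    have h4 : HasDerivAt (fun τ : ℝ => K (z + τ * s)) (h (z - (0 : ℝ) * s) - h (z - (1 : ℝ) * s)) 0 := by
      have := hasDerivAt_integral_sub (φ := fun t : ℝ => h (z - t * s))
        (hhs.continuous.comp (by fun_prop)) 0 1
      refine this.congr_of_eventuallyEq (Filter.Eventually.of_forall fun τ => ?_)
      simp only [hK]
      congr 1
      funext t
      congr 1
      push_cast
      ring
    simpa using h1.unique h4
  -- the translated form
  set D'' : Set ℂ := (fun z => z + s) '' D with hD''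
  have hD''c : IsCompact D'' := hc1.image (by fun_prop)
  have hD''sub : D'' ⊆ D' := by
    rintro _ ⟨z, hz, rfl⟩
    exact ⟨(1, z), ⟨by simp, hz⟩, by simp⟩
  have hDsub : D ⊆ D' := fun z hz => ⟨(0, z), ⟨by simp, hz⟩, by simp⟩
  set k' : ℂ → ℂ := fun z => Complex.I * h (z - s) / l z with hk'
  have hk'0 : ∀ z ∉ D'', k' z = 0 := by
    intro z hz
    have : h (z - s) = 0 := hh0 _ fun hzD => hz ⟨z - s, hzD, by ring⟩
    simp [hk', this]
  have hk's : ∀ z ∈ e.target, ContDiffAt ℝ ∞ k' z := by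
    intro z _
    by_cases hz : z ∈ D''
    · have hzb := hD'ball (hD''sub hz)
      refine contDiffAt_div (contDiffAt_const.mul ?_) (hls z hzb) (hl z hzb).2.1
      exact (Complex.ofRealCLM.contDiff.comp (hhs.comp (contDiff_id.sub contDiff_const))).contDiffAt
    · exact contDiffAt_of_zero_off hD''c.isClosed hk'0 hz
  have hq' : e.symm '' D' ⊆ q.punctured := by
    rintro _ ⟨z, hz, rfl⟩ h0
    have hzb := hD'ball hz
    have := (q.coeff_eq_zero_iff he (hR hzb)).2 h0
    have h2 := (hl z hzb).2.2
    rw [this, neg_zero, pow_eq_zero_iff (by norm_num)] at h2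
    exact (hl z hzb).2.1 h2
  have hD''t : D'' ⊆ e.target := fun z hz => hR (hD'ball (hD''sub hz))
  set κ' := AntiForm.ofPlane he k' hD''c hD''t hk'0 hk's with hκ'
  have hsup := AntiForm.ofPlane_supported he k' hD''c hD''t hk'0 hk's
  have hsolve' : Solvable q κ' := by
    refine hsolve κ' (e.symm '' D'') (isClosed_image_symm hD''c hD''t) ?_
      ((Set.image_mono hD''sub).trans hq') hsup
    rintro _ ⟨_, ⟨z, hz, rfl⟩, rfl⟩
    refine hδU _ ?_
    have := hDball hz
    rw [Metric.mem_ball, dist_eq_norm] at *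
    rw [show z + s - e y = z - e x₀ by rw [hs]; ring]
    exact this
  have hdiff : Solvable q (κ + -κ') := by
    refine Solvable.of_plane he (C := D') (f := fun z => 2 * Complex.I * starRingEnd ℂ s * K z / l z)
      hD'c (fun z hz => hR (hD'ball hz)) hq' ?_ ?_ ?_ ?_
    · intro x hx v
      have h1 : κ.toFun x v = 0 := hκ x (fun h => hx (by
        rw [← hc3] at h; exact Set.image_mono hDsub h)) v
      have h2 : κ'.toFun x v = 0 := hsup x (fun h => hx (Set.image_mono hD''sub h)) v
      change κ.toFun x v + -κ'.toFun x v = 0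
      rw [h1, h2]; simp
    · intro z hz; simp [hK0 z hz]
    · intro z hz
      refine contDiffAt_div (contDiffAt_const.mul ?_) (hls z (hD'ball hz)) (hl z (hD'ball hz)).2.1
      exact (Complex.ofRealCLM.contDiff.comp hKs).contDiffAt
    · intro z hz l' hl'
      have hzb := hD'ball hz
      obtain ⟨hla, hl0, hl2⟩ := hl z hzb
      have hKc : DifferentiableAt ℝ (fun z => (K z : ℂ)) z :=
        differentiableAt_of_smooth (Complex.ofRealCLM.contDiff.comp hKs).contDiffAt
      have hw : wirt (fun z => 2 * Complex.I * starRingEnd ℂ s * K z / l z) z * l z =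
          wirt (fun z => (K z : ℂ)) z * (2 * Complex.I * starRingEnd ℂ s) := by
        rw [← wirt_mul_holomorphic _ hla.differentiableAt, ← wirt_mul_holomorphic hKc
          (differentiableAt_const _)]
        · refine wirt_congr ?_
          filter_upwards [hla.continuousAt.eventually_ne hl0] with y hy
          field_simp
        · exact differentiableAt_of_smooth (contDiffAt_div (contDiffAt_const.mul
            (Complex.ofRealCLM.contDiff.comp hKs).contDiffAt) (hls z hzb) hl0)
      have hco : (κ + -κ').coeff e z = k z - k' z := by
        change κ.coeff e z + -κ'.coeff e z = _
        rw [hkc z (hR hzb), hκ', AntiForm.ofPlane_coeff he k' hD''c hD''t hk'0 hk's (hR hzb)]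
        ring
      have hmain : ((wirt (fun z => 2 * Complex.I * starRingEnd ℂ s * K z / l z) z -
          (κ + -κ').coeff e z) * l z).im = 0 := by
        rw [hco, sub_mul, hw, sub_mul]
        have h1 : k' z * l z = Complex.I * h (z - s) := by
          simp only [hk']; field_simp
        have h2 := re_conj_mul_wirt (hKs.differentiable (by simp) z) s
        rw [hKd z] at h2
        have h3 : (wirt (fun z => (K z : ℂ)) z * (2 * Complex.I * starRingEnd ℂ s)).im =
            2 * (starRingEnd ℂ s * wirt (fun ζ => (K ζ : ℂ)) z).re := by
          simp; ring
        rw [h1, Complex.sub_im, Complex.sub_im, h3, h2]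
        simp [hh]
      rcases sq_eq_sq_iff_eq_or_eq_neg.1 (hl'.trans hl2.symm) with rfl | rfl
      · exact hmain
      · rw [mul_neg, Complex.neg_im, hmain, neg_zero]
  refine (hdiff.add hsolve').congr fun x v => ?_
  change κ.toFun x v = κ.toFun x v + -κ'.toFun x v + κ'.toFun x v
  ring

end Core

section Core

lemma wirt_mul {f g : ℂ → ℂ} {z : ℂ} (hf : DifferentiableAt ℝ f z) (hg : DifferentiableAt ℝ g z) :
    wirt (fun ζ => f ζ * g ζ) z = wirt f z * g z + f z * wirt g z := by
  rw [wirt, wirt, wirt, fderiv_fun_mul hf hg]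
  simp only [add_apply, smul_apply, smul_eq_mul]
  ring

lemma wirt_conj (z : ℂ) : wirt (fun ζ => starRingEnd ℂ ζ) z = 1 := by
  have h : ∀ w, fderiv ℝ (fun ζ => starRingEnd ℂ ζ) z w = starRingEnd ℂ w := fun w => by
    rw [fderiv_conj (f := fun ζ => ζ) differentiableAt_id]; simp
  rw [wirt, h, h]
  simp
  norm_num

variable {X : Type u} [TopologicalSpace X] [ChartedSpace ℂ X] [IsManifold 𝓘(ℂ) ω X]
  {e e' : OpenPartialHomeomorph X ℂ} {q : QuadraticDifferential X}

/-- Near a simple zero of `q` all forms are solvable: a full turn around the zero changes the sign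
of `√-q`, so that transporting a form around the zero gives its negative. -/
lemma goodAt_zero [T2Space X] [CompactSpace X] (he : e ∈ holAtlas X) {p : X} {R : ℝ}
    (hp : p ∈ e.source) (hp0 : e p = 0) (hRpos : 0 < R) (hR : Metric.ball 0 R ⊆ e.target)
    (hl : ∀ z ∈ Metric.ball (0 : ℂ) R, q.coeff e z = -z) :
    GoodAt q p := by
  refine ⟨e.source ∩ e ⁻¹' Metric.ball 0 R, e.isOpen_inter_preimage Metric.isOpen_ball,
    ⟨hp, by simpa [hp0] using hRpos⟩, fun κ C hC hCU hCq hκ => ?_⟩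
  obtain ⟨hc1, hc2, hc3, k, hk, hk0, hkc⟩ :=
    κ.exists_planar he hC (fun x hx => (hCU hx).1) hκ
  set D := e '' C with hD
  have hDball : ∀ z ∈ D, z ∈ Metric.ball (0 : ℂ) R ∧ z ≠ 0 := by
    rintro _ ⟨x, hx, rfl⟩
    refine ⟨(hCU hx).2, fun h0 => ?_⟩
    have h1 := q.coeff_ne_zero he (hCU hx).1 (hCq hx)
    rw [hl _ (hCU hx).2, h0] at h1
    simp at h1
  set φ : ℂ → ℝ → ℂ := fun z t =>
    Complex.exp (-(t / 2) * Complex.I) * k (Complex.exp (-t * Complex.I) * z) with hφ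
  set J : ℂ → ℂ := fun z => ∫ t in (0 : ℝ)..(2 * Real.pi), φ z t with hJ
  have hφs : ContDiff ℝ ∞ fun p : ℂ × ℝ => φ p.1 p.2 := by
    have h0 : ContDiff ℝ ∞ fun p : ℂ × ℝ => (p.2 : ℂ) := Complex.ofRealCLM.contDiff.comp contDiff_snd
    refine ContDiff.mul (ContDiff.cexp (((h0.div_const 2).neg).mul contDiff_const))
      (hk.comp (ContDiff.mul (ContDiff.cexp ((h0.neg).mul contDiff_const)) contDiff_fst))
  have hJs : ContDiff ℝ ∞ J :=
    contDiff_intervalIntegral (H := fun p : ℂ × ℝ => φ p.1 p.2) hφs 0 (2 * Real.pi)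
  -- the set swept out by the support during a full turn
  set D' : Set ℂ := (fun p : ℝ × ℂ => Complex.exp (p.1 * Complex.I) * p.2) ''
    (Set.Icc 0 (2 * Real.pi) ×ˢ D) with hD'
  have hD'c : IsCompact D' := (isCompact_Icc.prod hc1).image (by fun_prop)
  have hD'ball : ∀ z ∈ D', z ∈ Metric.ball (0 : ℂ) R ∧ z ≠ 0 := by
    rintro _ ⟨⟨t, z⟩, ⟨ht, hz⟩, rfl⟩
    have h1 := hDball z hz
    refine ⟨?_, mul_ne_zero (Complex.exp_ne_zero _) h1.2⟩
    rw [mem_ball_zero_iff, norm_mul, Complex.norm_exp_ofReal_mul_I, one_mul]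
    exact mem_ball_zero_iff.1 h1.1
  have hDsub : D ⊆ D' := fun z hz => ⟨(0, z), ⟨by simp [Real.pi_nonneg], hz⟩, by simp⟩
  have hJ0 : ∀ z ∉ D', J z = 0 := by
    intro z hz
    have : ∀ t ∈ Set.uIcc (0 : ℝ) (2 * Real.pi), φ z t = (fun _ => (0 : ℂ)) t := by
      intro t ht
      rw [Set.uIcc_of_le (by positivity)] at ht
      have : k (Complex.exp (-t * Complex.I) * z) = 0 := hk0 _ fun hzD =>
        hz ⟨(t, Complex.exp (-t * Complex.I) * z), ⟨ht, hzD⟩, by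
          simp only []
          rw [← mul_assoc, ← Complex.exp_add]
          simp⟩
      simp only [hφ, this, mul_zero]
    simp only [hJ]
    rw [intervalIntegral.integral_congr this]
    simp
  -- the derivative of `J` along the rotation
  have hJd : ∀ z, Complex.I / 2 * J z + fderiv ℝ J z (Complex.I * z) = 2 * k z := by
    intro z
    have h1 : HasDerivAt (fun τ : ℝ => Complex.exp ((τ / 2 : ℂ) * Complex.I) *
        J (Complex.exp (τ * Complex.I) * z))
        (Complex.I / 2 * J z + fderiv ℝ J z (Complex.I * z)) 0 := by
      have h2 : HasDerivAt (fun τ : ℝ => Complex.exp (τ * Complex.I) * z) (Complex.I * z) 0 := by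
        have := (((Complex.ofRealCLM.hasDerivAt (x := (0 : ℝ))).mul_const Complex.I).cexp).mul_const z
        simpa using this
      have h2' : HasDerivAt (fun τ : ℝ => Complex.exp ((τ / 2 : ℂ) * Complex.I)) (Complex.I / 2) 0 := by
        have := ((((Complex.ofRealCLM.hasDerivAt (x := (0 : ℝ))).div_const 2).mul_const Complex.I).cexp)
        refine HasDerivAt.congr_deriv this ?_
        simp; ring
      have h3 : HasFDerivAt J (fderiv ℝ J z) (Complex.exp ((0 : ℝ) * Complex.I) * z) := by
        simpa using (hJs.differentiable (by simp) z).hasFDerivAt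
      have h4 := h2'.mul (h3.comp_hasDerivAt (0 : ℝ) h2)
      refine HasDerivAt.congr_deriv h4 ?_
      simp
    have h4 : HasDerivAt (fun τ : ℝ => Complex.exp ((τ / 2 : ℂ) * Complex.I) *
        J (Complex.exp (τ * Complex.I) * z)) (φ z 0 - φ z (2 * Real.pi)) 0 := by
      have := hasDerivAt_integral_sub (φ := φ z)
        (hφs.continuous.comp (by fun_prop : Continuous fun t : ℝ => (z, t))) 0 (2 * Real.pi)
      refine this.congr_of_eventuallyEq (Filter.Eventually.of_forall fun τ => ?_)
      simp only [hJ]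
      rw [← intervalIntegral.integral_const_mul]
      congr 1
      funext t
      simp only [hφ]
      rw [← mul_assoc, ← mul_assoc, ← Complex.exp_add, ← Complex.exp_add]
      push_cast
      congr 2
      · ring
      · congr 2; ring
    have h5 := h1.unique h4
    rw [h5]
    simp only [hφ]
    push_cast
    rw [show (-(2 * (Real.pi : ℂ) / 2) * Complex.I) = -(Real.pi * Complex.I) by ring,
      show (-(2 * (Real.pi : ℂ)) * Complex.I) = -(2 * Real.pi * Complex.I) by ring,
      Complex.exp_neg, Complex.exp_neg, Complex.exp_pi_mul_I, Complex.exp_two_pi_mul_I]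
    simp
    ring
  have hfs : ∀ z, z ≠ 0 → ContDiffAt ℝ ∞ (fun z => starRingEnd ℂ z *
      (J z - starRingEnd ℂ (J z) * starRingEnd ℂ z / (‖z‖ : ℂ)) / (2 * Complex.I)) z := by
    intro z hz
    have h1 : ContDiffAt ℝ ∞ (fun z : ℂ => starRingEnd ℂ z) z := contDiffAt_conj contDiffAt_id
    refine (h1.mul (hJs.contDiffAt.sub (contDiffAt_div ((contDiffAt_conj hJs.contDiffAt).mul h1) ?_ ?_))).div_const _
    · exact Complex.ofRealCLM.contDiff.contDiffAt.comp z (contDiffAt_norm ℝ hz)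
    · simpa using hz
  refine Solvable.of_plane he (C := D') hD'c (fun z hz => hR (hD'ball z hz).1) ?_ ?_
    (f := fun z => starRingEnd ℂ z *
      (J z - starRingEnd ℂ (J z) * starRingEnd ℂ z / (‖z‖ : ℂ)) / (2 * Complex.I))
    (fun z hz => by simp [hJ0 z hz]) (fun z hz => hfs z (hD'ball z hz).2) ?_
  · rintro _ ⟨z, hz, rfl⟩ h0
    have h1 := (q.coeff_eq_zero_iff he (hR (hD'ball z hz).1)).2 h0
    rw [hl _ (hD'ball z hz).1, neg_eq_zero] at h1
    exact (hD'ball z hz).2 h1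
  · intro x hx v
    exact hκ x (fun h => hx (by rw [← hc3] at h; exact Set.image_mono hDsub h)) v
  · intro z hz l' hl'
    obtain ⟨hzb, hz0⟩ := hD'ball z hz
    obtain ⟨l, hla, hl0, hl2⟩ := exists_local_root 2 two_ne_zero (a := fun z => z) (z₀ := z) analyticAt_id hz0
    have hld : DifferentiableAt ℂ l z := hla.differentiableAt
    have hls : ContDiffAt ℝ ∞ l z := (hla.contDiffAt.restrict_scalars ℝ).of_le (n := ω) le_top
    have hlz : l z ^ 2 = z := hl2.self_of_nhds
    have hlderiv : deriv l z * z = l z / 2 := by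
      have h1 : HasDerivAt (fun z => l z ^ 2) (2 * l z * deriv l z) z := by
        simpa using hld.hasDerivAt.fun_pow 2
      have h2 : HasDerivAt (fun z => l z ^ 2) 1 z := (hasDerivAt_id z).congr_of_eventuallyEq hl2
      have h3 := h1.unique h2
      linear_combination (l z / 2) * h3 - deriv l z * hlz
    set K : ℂ → ℝ := fun ζ => (l ζ * J ζ).im with hK
    have hKs : ContDiffAt ℝ ∞ K z := Complex.imCLM.contDiff.contDiffAt.comp z (hls.mul hJs.contDiffAt)
    have hKc : DifferentiableAt ℝ (fun z => (K z : ℂ)) z :=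
      differentiableAt_of_smooth (Complex.ofRealCLM.contDiff.contDiffAt.comp z hKs)
    have hKd : fderiv ℝ K z (Complex.I * z) = 2 * (l z * k z).im := by
      have h1 := (Complex.imCLM.hasFDerivAt (x := l z * J z)).comp z
        ((hld.restrictScalars ℝ).hasFDerivAt.mul (differentiableAt_of_smooth hJs.contDiffAt).hasFDerivAt)
      have h2 : HasFDerivAt K _ z := h1
      rw [h2.fderiv]
      simp only [ContinuousLinearMap.comp_apply, add_apply, smul_apply, smul_eq_mul,
        fderiv_real_of_complex hld, Complex.imCLM_apply]
      have h3 : l z * fderiv ℝ J z (Complex.I * z) + J z * (deriv l z * (Complex.I * z)) =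
          2 * (l z * k z) := by
        linear_combination (l z) * hJd z + (J z * Complex.I) * hlderiv
      rw [h3]
      simp
    have hmain : ((wirt (fun z => starRingEnd ℂ z *
        (J z - starRingEnd ℂ (J z) * starRingEnd ℂ z / (‖z‖ : ℂ)) / (2 * Complex.I)) z -
          κ.coeff e z) * l z).im = 0 := by
      have hw : wirt (fun z => starRingEnd ℂ z *
          (J z - starRingEnd ℂ (J z) * starRingEnd ℂ z / (‖z‖ : ℂ)) / (2 * Complex.I)) z * l z =
          K z + starRingEnd ℂ z * wirt (fun z => (K z : ℂ)) z := by
        rw [← wirt_mul_holomorphic (differentiableAt_of_smooth (hfs z hz0)) hld]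
        have h1 := wirt_mul (f := fun z => starRingEnd ℂ z) (g := fun z => (K z : ℂ)) (z := z)
          (differentiableAt_of_smooth (contDiffAt_conj contDiffAt_id)) hKc
        rw [wirt_conj, one_mul] at h1
        rw [← h1]
        refine wirt_congr ?_
        filter_upwards [hl2, isOpen_ne.mem_nhds hz0] with y hy hy0
        have hn : (‖y‖ : ℂ) = l y * starRingEnd ℂ (l y) := by
          rw [Complex.mul_conj, Complex.normSq_eq_norm_sq]
          conv_lhs => rw [← hy, norm_pow]
        have hly : l y ≠ 0 := by rintro h0; rw [h0] at hy; exact hy0 (by rw [← hy]; simp)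
        have hly' : starRingEnd ℂ (l y) ≠ 0 := by simpa using hly
        have h2 : starRingEnd ℂ y = starRingEnd ℂ (l y) ^ 2 := by rw [← map_pow, hy]
        have h3 : starRingEnd ℂ y * l y / (‖y‖ : ℂ) = starRingEnd ℂ (l y) := by
          rw [hn, h2]; field_simp
        have h4 : ((K y : ℝ) : ℂ) = (l y * J y - starRingEnd ℂ (l y * J y)) / (2 * Complex.I) := by
          rw [Complex.sub_conj]
          simp only [hK]
          push_cast
          field_simp
        rw [h4, map_mul, ← h3]
        ring
      rw [sub_mul, hw, Complex.sub_im, Complex.add_im, Complex.ofReal_im, zero_add,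
        hkc z (hR hzb)]
      have h2 := re_conj_mul_wirt (differentiableAt_of_smooth hKs) (Complex.I * z)
      rw [hKd] at h2
      have h3 : (starRingEnd ℂ (Complex.I * z) * wirt (fun ζ => (K ζ : ℂ)) z).re =
          (starRingEnd ℂ z * wirt (fun ζ => (K ζ : ℂ)) z).im := by
        simp
        ring
      rw [h3] at h2
      rw [mul_comm (k z)]
      linarith
    rw [hl z hzb, neg_neg] at hl'
    rcases sq_eq_sq_iff_eq_or_eq_neg.1 (hl'.trans hlz.symm) with rfl | rfl
    · exact hmain
    · rw [mul_neg, Complex.neg_im, hmain, neg_zero]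

/-- If every zero of `q` has a coordinate with `q = -z dz²` and there is at least one zero, then
all forms supported away from the zeros are solvable. -/
lemma solvable_of_supported [T2Space X] [CompactSpace X] [ConnectedSpace X]
    (hq : q.IsHolomorphic) (hz : ∃ p, q p = 0)
    (hcoord : ∀ p, q p = 0 → ∃ e ∈ holAtlas X, ∃ R > 0, p ∈ e.source ∧ e p = 0 ∧
      Metric.ball 0 R ⊆ e.target ∧ ∀ z ∈ Metric.ball (0 : ℂ) R, q.coeff e z = -z)
    (κ : AntiForm X) {C : Set X} (hC : IsClosed C) (hCq : C ⊆ q.punctured)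
    (hκ : κ.SupportedIn C) : Solvable q κ := by
  have hgz : ∀ p, q p = 0 → GoodAt q p := by
    intro p hp
    obtain ⟨e, he, R, hR, h1, h2, h3, h4⟩ := hcoord p hp
    exact goodAt_zero he h1 h2 hR h3 h4
  have hall : ∀ p, GoodAt q p := by
    have hopen : IsOpen {p | GoodAt q p} := by
      rw [isOpen_iff_mem_nhds]
      rintro p ⟨U, hU, hpU, h⟩
      filter_upwards [hU.mem_nhds hpU] with y hy using ⟨U, hU, hy, h⟩
    have hclosed : IsClosed {p | GoodAt q p} := by
      rw [← closure_subset_iff_isClosed]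
      intro x hx
      by_cases hxq : q x = 0
      · exact hgz x hxq
      set e := chartAt ℂ x
      have he : e ∈ holAtlas X := chartAt_mem_holAtlas _
      have hxs : x ∈ e.source := mem_chart_source ℂ x
      have ha : AnalyticAt ℂ (fun z => - q.coeff e z) (e x) := (hq.analyticAt he (e.map_source hxs)).neg
      obtain ⟨l, hla, hl0, hl2⟩ := exists_local_root 2 two_ne_zero ha (neg_ne_zero.2 (q.coeff_ne_zero he hxs hxq))
      obtain ⟨R, hR, hball⟩ := Metric.eventually_nhds_iff_ball.1
        ((hla.eventually_analyticAt.and ((hla.continuousAt.eventually_ne hl0).and hl2)).and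
          (e.open_target.mem_nhds (e.map_source hxs)))
      obtain ⟨y, hy, hyg⟩ := mem_closure_iff_nhds.1 hx (e.source ∩ e ⁻¹' Metric.ball (e x) (R / 2))
        ((e.isOpen_inter_preimage Metric.isOpen_ball).mem_nhds
          ⟨hxs, Metric.mem_ball_self (by linarith)⟩)
      exact hyg.translate he hxs (fun z hz => (hball z hz).2) (fun z hz => (hball z hz).1)
        hy.1 hy.2
    obtain ⟨p, hp⟩ := hz
    have := IsClopen.eq_univ ⟨hclosed, hopen⟩ ⟨p, hgz p hp⟩
    intro x
    have hx : x ∈ {p | GoodAt q p} := this ▸ Set.mem_univ x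
    exact hx
  choose U hU hpU hsol using hall
  obtain ⟨ρ, hρ⟩ := SmoothPartitionOfUnity.exists_isSubordinate 𝓘(ℝ, ℂ) (s := (Set.univ : Set X))
    isClosed_univ U hU (fun x _ => Set.mem_iUnion.2 ⟨x, hpU x⟩)
  have hρs : ∀ i x, ContMDiffAt 𝓘(ℝ, ℂ) 𝓘(ℝ) ∞ (ρ i) x := fun i x => (ρ i).contMDiff x
  have hpart : ∀ i, Solvable q (κ.mulFun (ρ i) (hρs i)) := by
    intro i
    refine hsol i _ (tsupport (ρ i) ∩ C) ((isClosed_tsupport _).inter hC)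
      (fun x hx => hρ i hx.1) (fun x hx => hCq hx.2) fun x hx v => ?_
    change (ρ i x : ℂ) * κ.toFun x v = 0
    by_cases hxC : x ∈ C
    · have : ρ i x = 0 := image_eq_zero_of_notMem_tsupport fun h => hx ⟨h, hxC⟩
      rw [this]; simp
    · rw [hκ x hxC, mul_zero]
  -- finitely many members of the partition suffice
  have hlf : {i | (Function.support (ρ i) ∩ Set.univ).Nonempty}.Finite :=
    ρ.locallyFinite.finite_nonempty_inter_compact isCompact_univ
  set I := hlf.toFinset with hI
  have hsum : ∀ T : Finset X, ∃ κ' : AntiForm X, Solvable q κ' ∧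
      ∀ x v, κ'.toFun x v = (∑ i ∈ T, ρ i x : ℝ) * κ.toFun x v := by
    intro T
    classical
    induction T using Finset.induction_on with
    | empty => exact ⟨0, Solvable.zero, fun x v => by simp; rfl⟩
    | insert i T hi ih =>
      obtain ⟨κ', h1, h2⟩ := ih
      refine ⟨κ.mulFun (ρ i) (hρs i) + κ', (hpart i).add h1, fun x v => ?_⟩
      rw [Finset.sum_insert hi]
      change (ρ i x : ℂ) * κ.toFun x v + κ'.toFun x v = _
      rw [h2]
      push_cast
      ring
  obtain ⟨κ', h1, h2⟩ := hsum I
  refine h1.congr fun x v => ?_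
  have h3 : ∑ i ∈ I, ρ i x = 1 := by
    rw [← ρ.sum_eq_one (Set.mem_univ x)]
    refine (finsum_eq_sum_of_support_subset _ fun i hi => ?_).symm
    rw [hI, Set.Finite.coe_toFinset]
    exact ⟨x, hi, Set.mem_univ x⟩
  rw [h2, h3]
  simp

end Core

/-! ### Normal form of a quadratic differential at a simple zero -/

section NormalForm

/-- The equation `k + (2/3) z k' = s` has a holomorphic solution near `0`. -/
lemma exists_euler_solution {s : ℂ → ℂ} (hs : AnalyticAt ℂ s 0) (hs0 : s 0 ≠ 0) :
    ∃ k : ℂ → ℂ, AnalyticAt ℂ k 0 ∧ k 0 ≠ 0 ∧ ∀ᶠ z in 𝓝 0, k z + 2 / 3 * z * deriv k z = s z := by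
  obtain ⟨R, hR, hball⟩ := Metric.eventually_nhds_iff_ball.1 hs.eventually_analyticAt
  set r := R / 2 with hr
  have hrpos : 0 < r := by positivity
  have hsub : Metric.closedBall (0 : ℂ) r ⊆ Metric.ball 0 R :=
    Metric.closedBall_subset_ball (by linarith)
  have hd : ∀ z ∈ Metric.closedBall (0 : ℂ) r, AnalyticAt ℂ (deriv s) z :=
    fun z hz => (hball z (hsub hz)).deriv
  obtain ⟨C, hC⟩ := (isCompact_closedBall (0 : ℂ) r).exists_bound_of_continuousOn
    (f := deriv s) fun z hz => (hd z hz).continuousAt.continuousWithinAt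
  have hmem : ∀ z ∈ Metric.closedBall (0 : ℂ) r, ∀ t ∈ Set.Icc (0 : ℝ) 1,
      (t : ℂ) ^ 2 * z ∈ Metric.closedBall (0 : ℂ) r := by
    intro z hz t ht
    rw [mem_closedBall_zero_iff] at *
    rw [norm_mul, norm_pow, Complex.norm_real, Real.norm_eq_abs, abs_of_nonneg ht.1]
    exact (mul_le_of_le_one_left (norm_nonneg _) (pow_le_one₀ ht.1 ht.2)).trans hz
  have hcont : ∀ f : ℂ → ℂ, (∀ z ∈ Metric.closedBall (0 : ℂ) r, ContinuousAt f z) →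
      ∀ z ∈ Metric.closedBall (0 : ℂ) r,
      ContinuousOn (fun t : ℝ => f ((t : ℂ) ^ 2 * z)) (Set.Icc 0 1) := by
    intro f hf z hz t ht
    exact (ContinuousAt.comp (f := fun t : ℝ => (t : ℂ) ^ 2 * z) (hf _ (hmem z hz t ht))
      (by fun_prop)).continuousWithinAt
  set F : ℂ → ℝ → ℂ := fun z t => 3 * (t : ℂ) ^ 2 * s ((t : ℂ) ^ 2 * z) with hF
  set F' : ℂ → ℝ → ℂ := fun z t => 3 * (t : ℂ) ^ 4 * deriv s ((t : ℂ) ^ 2 * z) with hF'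
  have hsc : ∀ z ∈ Metric.closedBall (0 : ℂ) r, ContinuousAt s z := fun z hz =>
    (hball z (hsub hz)).continuousAt
  have hFc : ∀ z ∈ Metric.closedBall (0 : ℂ) r, ContinuousOn (F z) (Set.uIcc 0 1) := by
    intro z hz
    rw [Set.uIcc_of_le zero_le_one]
    exact ContinuousOn.mul (by fun_prop) (hcont s hsc z hz)
  have hF'c : ∀ z ∈ Metric.closedBall (0 : ℂ) r, ContinuousOn (F' z) (Set.uIcc 0 1) := by
    intro z hz
    rw [Set.uIcc_of_le zero_le_one]
    exact ContinuousOn.mul (by fun_prop) (hcont _ (fun z hz => (hd z hz).continuousAt) z hz)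
  set k : ℂ → ℂ := fun z => ∫ t in (0 : ℝ)..1, F z t with hk
  have hkd : ∀ z ∈ Metric.ball (0 : ℂ) r, HasDerivAt k (∫ t in (0 : ℝ)..1, F' z t) z := by
    intro z hz
    have hnhds : Metric.ball (0 : ℂ) r ∈ 𝓝 z := Metric.isOpen_ball.mem_nhds hz
    have hzc := Metric.ball_subset_closedBall hz
    refine (intervalIntegral.hasDerivAt_integral_of_dominated_loc_of_deriv_le (μ := MeasureTheory.volume)
      (F := F) (F' := F') (bound := fun _ => 3 * C) hnhds ?_ ?_ ?_ ?_ ?_ ?_).2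
    · filter_upwards [hnhds] with y hy
      exact ((hFc y (Metric.ball_subset_closedBall hy)).mono Set.uIoc_subset_uIcc).aestronglyMeasurable
        measurableSet_uIoc
    · exact (hFc z hzc).intervalIntegrable
    · exact ((hF'c z hzc).mono Set.uIoc_subset_uIcc).aestronglyMeasurable measurableSet_uIoc
    · refine Filter.Eventually.of_forall fun t ht y hy => ?_
      rw [Set.uIoc_of_le zero_le_one] at ht
      have ht' : t ∈ Set.Icc (0 : ℝ) 1 := ⟨ht.1.le, ht.2⟩
      have h1 := hC _ (hmem y (Metric.ball_subset_closedBall hy) t ht')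
      simp only [hF', norm_mul, norm_pow, Complex.norm_real, Real.norm_eq_abs, abs_of_nonneg ht'.1]
      have h2 : t ^ 4 ≤ 1 := pow_le_one₀ ht'.1 ht'.2
      have h3 : (0 : ℝ) ≤ t ^ 4 := by positivity
      have h4 := norm_nonneg (deriv s ((t : ℂ) ^ 2 * y))
      norm_num
      nlinarith
    · exact intervalIntegrable_const
    · refine Filter.Eventually.of_forall fun t ht y hy => ?_
      rw [Set.uIoc_of_le zero_le_one] at ht
      have ht' : t ∈ Set.Icc (0 : ℝ) 1 := ⟨ht.1.le, ht.2⟩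
      have h1 := (hball _ (hsub (hmem y (Metric.ball_subset_closedBall hy) t ht'))).differentiableAt.hasDerivAt
      have h2 : HasDerivAt (fun y : ℂ => (t : ℂ) ^ 2 * y) ((t : ℂ) ^ 2) y := by
        simpa using (hasDerivAt_id y).const_mul ((t : ℂ) ^ 2)
      refine ((HasDerivAt.comp y h1 h2).const_mul (3 * (t : ℂ) ^ 2)).congr_deriv ?_
      simp only [hF']
      ring
  refine ⟨k, ?_, ?_, ?_⟩
  · exact DifferentiableOn.analyticAt (s := Metric.ball 0 r)
      (fun z hz => (hkd z hz).differentiableAt.differentiableWithinAt) (Metric.ball_mem_nhds _ hrpos)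
  · have : k 0 = s 0 := by
      simp only [hk, hF, mul_zero]
      rw [intervalIntegral.integral_mul_const]
      have h1 : ∫ t in (0 : ℝ)..1, (3 : ℂ) * (t : ℂ) ^ 2 = ((∫ t in (0 : ℝ)..1, 3 * t ^ 2 : ℝ) : ℂ) := by
        rw [← intervalIntegral.integral_ofReal]
        push_cast
        rfl
      rw [h1]
      simp
      norm_num
    rwa [this]
  · filter_upwards [Metric.ball_mem_nhds (0 : ℂ) hrpos] with z hz
    have hzc := Metric.ball_subset_closedBall hz
    rw [(hkd z hz).deriv]
    have h1 : ∀ t ∈ Set.uIcc (0 : ℝ) 1, HasDerivAt (fun t : ℝ => (t : ℂ) ^ 3 * s ((t : ℂ) ^ 2 * z))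
        (F z t + 2 / 3 * z * F' z t) t := by
      intro t ht
      rw [Set.uIcc_of_le zero_le_one] at ht
      have h2 := (hball _ (hsub (hmem z hzc t ht))).differentiableAt.hasDerivAt
      have h3 : HasDerivAt (fun t : ℝ => (t : ℂ) ^ 2 * z) (2 * t * z) t := by
        simpa using ((Complex.ofRealCLM.hasDerivAt (x := t)).fun_pow 2).mul_const z
      have h4 : HasDerivAt (fun t : ℝ => (t : ℂ) ^ 3) (3 * (t : ℂ) ^ 2) t := by
        simpa using (Complex.ofRealCLM.hasDerivAt (x := t)).fun_pow 3
      refine (h4.mul (HasDerivAt.comp t h2 h3)).congr_deriv ?_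
      simp only [hF, hF', Function.comp]
      ring
    have h2 : IntervalIntegrable (F z) MeasureTheory.volume 0 1 := (hFc z hzc).intervalIntegrable
    have h3 : IntervalIntegrable (F' z) MeasureTheory.volume 0 1 := (hF'c z hzc).intervalIntegrable
    have h4 := intervalIntegral.integral_eq_sub_of_hasDerivAt h1 (h2.add (h3.const_mul _))
    rw [intervalIntegral.integral_add h2 (h3.const_mul _), intervalIntegral.integral_const_mul] at h4
    rw [h4]
    simp

/-- A holomorphic function with a simple zero is `ζ ζ'²` for a local coordinate `ζ`. -/
lemma exists_planar_normal_form {a : ℂ → ℂ} (ha : AnalyticAt ℂ a 0) (h0 : a 0 = 0)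
    (hd : deriv a 0 ≠ 0) : ∃ ζ : ℂ → ℂ, AnalyticAt ℂ ζ 0 ∧ ζ 0 = 0 ∧ deriv ζ 0 ≠ 0 ∧
      ∀ᶠ z in 𝓝 0, ζ z * deriv ζ z ^ 2 = a z := by
  obtain ⟨p, hp⟩ := ha
  have hu : AnalyticAt ℂ (dslope a 0) 0 := ⟨_, hp.has_fpower_series_dslope_fslope⟩
  have hu0 : dslope a 0 0 ≠ 0 := by rwa [dslope_same]
  have hau : ∀ z, a z = z * dslope a 0 z := by
    intro z
    have := sub_smul_dslope a 0 z
    simp [h0] at this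
    exact this.symm
  obtain ⟨s, hs, hs0, hs2⟩ := exists_local_root 2 two_ne_zero hu hu0
  obtain ⟨k, hk, hk0, hks⟩ := exists_euler_solution hs hs0
  obtain ⟨h, hh, hh0, hh3⟩ := exists_local_root 3 three_ne_zero (hk.pow 2) (pow_ne_zero 2 hk0)
  have hder : ∀ z, AnalyticAt ℂ h z → HasDerivAt (fun z => z * h z) (h z + z * deriv h z) z := by
    intro z hz
    have := (hasDerivAt_id z).fun_mul hz.differentiableAt.hasDerivAt
    simpa using this
  refine ⟨fun z => z * h z, analyticAt_id.mul hh, by simp, ?_, ?_⟩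
  · rw [(hder 0 hh).deriv]; simpa using hh0
  · filter_upwards [hh.eventually_analyticAt, hk.eventually_analyticAt, hs2, hks, hh3,
      hh3.eventually_nhds, hh.continuousAt.eventually_ne hh0] with z z1 z2 z3 z4 z5 z6 z7
    rw [(hder z z1).deriv, hau, ← z3]
    have e1 : HasDerivAt (fun z => h z ^ 3) (3 * h z ^ 2 * deriv h z) z := by
      simpa using z1.differentiableAt.hasDerivAt.fun_pow 3
    have e2 : HasDerivAt (fun z => k z ^ 2) (2 * k z * deriv k z) z := by
      simpa using z2.differentiableAt.hasDerivAt.fun_pow 2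
    have e3 := e1.unique (e2.congr_of_eventuallyEq z6)
    simp only [Pi.pow_apply] at z5
    have e4 : h z ^ 3 * (z * h z * (h z + z * deriv h z) ^ 2) = h z ^ 3 * (z * s z ^ 2) := by
      rw [← z4]
      have : h z ^ 3 * (z * h z * (h z + z * deriv h z) ^ 2) =
        z * (h z ^ 3 + z / 3 * (3 * h z ^ 2 * deriv h z)) ^ 2 := by ring
      rw [this, e3, z5]
      ring
    exact mul_left_cancel₀ (pow_ne_zero 3 z7) e4

variable {X : Type u} [TopologicalSpace X] [ChartedSpace ℂ X] [IsManifold 𝓘(ℂ) ω X]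
  {q : QuadraticDifferential X}

/-- Near a simple zero there is a coordinate `z` with `q = -z dz²`. -/
lemma exists_normal_coord (hq : q.IsHolomorphic) (hs : q.HasSimpleZeros) {p : X} (hp : q p = 0) :
    ∃ e ∈ holAtlas X, ∃ R > 0, p ∈ e.source ∧ e p = 0 ∧
      Metric.ball 0 R ⊆ e.target ∧ ∀ z ∈ Metric.ball (0 : ℂ) R, q.coeff e z = -z := by
  set e₀ := chartAt ℂ p with he₀d
  have he₀ : e₀ ∈ holAtlas X := chartAt_mem_holAtlas _
  have hps : p ∈ e₀.source := mem_chart_source ℂ p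
  set z₀ := e₀ p with hz₀
  have ht : z₀ ∈ e₀.target := e₀.map_source hps
  have hc0 : q.coeff e₀ z₀ = 0 := by
    rw [q.coeff_eq_zero_iff he₀ ht, e₀.left_inv hps]; exact hp
  have hd0 := hs e₀ (chart_mem_atlas ℂ p) z₀ ht hc0
  have hqa := hq.analyticAt he₀ ht
  have hsh : AnalyticAt ℂ (fun z : ℂ => z₀ + z) 0 := analyticAt_const.add analyticAt_id
  have ha : AnalyticAt ℂ (fun z => - q.coeff e₀ (z₀ + z)) 0 := by
    refine (AnalyticAt.comp (g := q.coeff e₀) (f := fun z : ℂ => z₀ + z) ?_ hsh).neg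
    simpa using hqa
  obtain ⟨ζ, h1, h2, h3, h4⟩ := exists_planar_normal_form ha (by simp [hc0]) (by
    have : deriv (fun z => - q.coeff e₀ (z₀ + z)) 0 = - deriv (q.coeff e₀) z₀ := by
      rw [deriv.fun_neg, deriv_comp_const_add]; simp
    rw [this]; exact neg_ne_zero.2 hd0)
  -- the new coordinate as a function of the old one
  set g : ℂ → ℂ := fun z => ζ (z - z₀) with hg
  have hev : ∀ᶠ z in 𝓝 z₀, AnalyticAt ℂ g z ∧ deriv g z ≠ 0 ∧ g z * deriv g z ^ 2 = - q.coeff e₀ z := by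
    have h5 : Filter.Tendsto (fun z => z - z₀) (𝓝 z₀) (𝓝 0) := by
      have : ContinuousAt (fun z : ℂ => z - z₀) z₀ := by fun_prop
      simpa [ContinuousAt] using this
    have h6 := h5.eventually ((h1.eventually_analyticAt.and h4).and
      (h1.deriv.continuousAt.eventually_ne h3))
    filter_upwards [h6] with z hz
    have h7 : deriv g z = deriv ζ (z - z₀) := by
      rw [hg, deriv_comp_sub_const]
    refine ⟨?_, ?_, ?_⟩
    · exact AnalyticAt.comp (g := ζ) (f := fun z : ℂ => z - z₀) hz.1.1 (analyticAt_id.sub analyticAt_const)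
    · rw [h7]; exact hz.2
    · rw [h7]
      have := hz.1.2
      simpa [hg] using this
  obtain ⟨W, hW, hWo, hzW⟩ := eventually_nhds_iff.1 hev
  have hg0 := hW z₀ hzW
  have hstrict : HasStrictFDerivAt g (ContinuousLinearEquiv.unitsEquivAut ℂ (Units.mk0 _ hg0.2.1) :
      ℂ →L[ℂ] ℂ) z₀ := by
    have := (hg0.1.contDiffAt (n := 1)).hasStrictDerivAt (by simp)
    exact this.hasStrictFDerivAt_equiv hg0.2.1
  set ψ := (hstrict.toOpenPartialHomeomorph g).restrOpen W hWo with hψ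
  have hψc : ∀ z, ψ z = g z := fun z => rfl
  have hψs : ∀ z ∈ ψ.source, z ∈ W := fun z hz => hz.2
  have hzψ : z₀ ∈ ψ.source := ⟨hstrict.mem_toOpenPartialHomeomorph_source, hzW⟩
  set e := e₀.trans ψ with he
  have hes : ∀ x ∈ e.source, x ∈ e₀.source ∧ e₀ x ∈ ψ.source := fun x hx => by
    simpa [he, OpenPartialHomeomorph.trans_source] using hx
  have hemem : e ∈ holAtlas X := by
    refine OpenPartialHomeomorph.mem_maximalAtlas_of_contMDiffOn e ?_ ?_
    · intro x hx
      obtain ⟨a1, a2⟩ := hes x hx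
      have a3 : ContMDiffAt 𝓘(ℂ) 𝓘(ℂ) ω ψ (e₀ x) :=
        ((hW _ (hψs _ a2)).1.contDiffAt).contMDiffAt
      exact (a3.comp x (contMDiffAt_of_mem_maximalAtlas he₀ a1)).contMDiffWithinAt
    · intro w hw
      have hw' : w ∈ ψ.target ∧ ψ.symm w ∈ e₀.target := by
        simpa [he, OpenPartialHomeomorph.trans_target] using hw
      have a1 := hW _ (hψs _ (ψ.map_target hw'.1))
      have a2 : ContDiffAt ℂ ω ψ.symm w :=
        ψ.contDiffAt_symm_deriv (f₀' := deriv g (ψ.symm w)) a1.2.1 hw'.1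
          a1.1.differentiableAt.hasDerivAt a1.1.contDiffAt
      exact ((contMDiffAt_symm_of_mem_maximalAtlas he₀ hw'.2).comp w a2.contMDiffAt).contMDiffWithinAt
  have hpe : p ∈ e.source := by
    simp only [he, OpenPartialHomeomorph.trans_source]
    exact ⟨hps, hzψ⟩
  have hep : e p = 0 := by
    change g (e₀ p) = 0
    simp [hg, ← hz₀, h2]
  have hball : e.target ∈ 𝓝 (0 : ℂ) := e.open_target.mem_nhds (hep ▸ e.map_source hpe)
  obtain ⟨R, hR, hRb⟩ := Metric.mem_nhds_iff.1 hball
  refine ⟨e, hemem, R, hR, hpe, hep, hRb, fun w hw => ?_⟩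
  have hwt := hRb hw
  have hx := e.map_target hwt
  set x := e.symm w with hxd
  obtain ⟨a1, a2⟩ := hes x hx
  have hxt := e₀.map_source a1
  have hxe : e₀.symm (e₀ x) ∈ e.source := by rwa [e₀.left_inv a1]
  have b1 := q.coeff_change hemem he₀ hxt hxe
  have b2 : deriv (e ∘ e₀.symm) (e₀ x) = deriv g (e₀ x) := by
    refine Filter.EventuallyEq.deriv_eq ?_
    filter_upwards [e₀.open_target.mem_nhds hxt] with y hy
    change g (e₀ (e₀.symm y)) = g y
    rw [e₀.right_inv hy]
  rw [b2, e₀.left_inv a1, e.right_inv hwt] at b1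
  have b3 := hW _ (hψs _ a2)
  have b4 : g (e₀ x) = w := e.right_inv hwt
  rw [b4, b1] at b3
  have b5 := b3.2.2
  have b6 : deriv g (e₀ x) ^ 2 * (w + q.coeff e w) = 0 := by linear_combination b5
  have b7 := (mul_eq_zero.1 b6).resolve_left (pow_ne_zero 2 b3.2.1)
  linear_combination b7

end NormalForm

/-! ### Unitary frames -/

section Frames

variable {X : Type u} [TopologicalSpace X] [ChartedSpace ℂ X] [IsManifold 𝓘(ℂ) ω X]
  {E : HermitianBundle.{u, v} X} {e e' : OpenPartialHomeomorph X ℂ}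

/-- The endomorphism of the fibre with a given matrix in a unitary frame. -/
def UnitaryFrame.toEnd (f : UnitaryFrame E) (x : X) (M : Matrix (Fin 2) (Fin 2) ℂ) : E.EndAt x :=
  Matrix.toLin (f.vec x).toBasis (f.vec x).toBasis M

lemma UnitaryFrame.matrix_toEnd (f : UnitaryFrame E) (x : X) (M : Matrix (Fin 2) (Fin 2) ℂ) :
    f.matrix x (f.toEnd x M) = M := LinearMap.toMatrix_toLin _ _ _

lemma UnitaryFrame.matrix_injective (f : UnitaryFrame E) (x : X) :
    Function.Injective (f.matrix x) := (LinearMap.toMatrix _ _).injective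

lemma UnitaryFrame.matrix_add (f : UnitaryFrame E) (x : X) (γ γ' : E.EndAt x) :
    f.matrix x (γ + γ') = f.matrix x γ + f.matrix x γ' := map_add _ _ _

lemma UnitaryFrame.matrix_sub (f : UnitaryFrame E) (x : X) (γ γ' : E.EndAt x) :
    f.matrix x (γ - γ') = f.matrix x γ - f.matrix x γ' := map_sub _ _ _

lemma UnitaryFrame.matrix_zero (f : UnitaryFrame E) (x : X) : f.matrix x 0 = 0 := map_zero _

lemma UnitaryFrame.matrix_smul (f : UnitaryFrame E) (x : X) (c : ℂ) (γ : E.EndAt x) :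
    f.matrix x (c • γ) = c • f.matrix x γ := map_smul (LinearMap.toMatrix _ _) _ _

lemma UnitaryFrame.matrix_mul (f : UnitaryFrame E) (x : X) (γ γ' : E.EndAt x) :
    f.matrix x (γ * γ') = f.matrix x γ * f.matrix x γ' := LinearMap.toMatrix_mul _ _ _

lemma UnitaryFrame.matrix_one (f : UnitaryFrame E) (x : X) : f.matrix x 1 = 1 :=
  LinearMap.toMatrix_one _

lemma UnitaryFrame.matrix_lie (f : UnitaryFrame E) (x : X) (γ γ' : E.EndAt x) :
    f.matrix x ⁅γ, γ'⁆ = ⁅f.matrix x γ, f.matrix x γ'⁆ := by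
  rw [Ring.lie_def, Ring.lie_def, f.matrix_sub, f.matrix_mul, f.matrix_mul]

lemma UnitaryFrame.matrix_adjoint (f : UnitaryFrame E) (x : X) (γ : E.EndAt x) :
    f.matrix x (LinearMap.adjoint γ) = (f.matrix x γ)ᴴ := by
  ext a b
  simp only [UnitaryFrame.matrix, LinearMap.toMatrix_apply, Matrix.conjTranspose_apply,
    OrthonormalBasis.coe_toBasis_repr_apply, OrthonormalBasis.coe_toBasis,
    OrthonormalBasis.repr_apply_apply]
  rw [LinearMap.adjoint_inner_right]
  exact (inner_conj_symm _ _).symm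

lemma UnitaryFrame.trace_matrix (f : UnitaryFrame E) (x : X) (γ : E.EndAt x) :
    (f.matrix x γ).trace = LinearMap.trace ℂ (E.fiber x) γ :=
  (LinearMap.trace_eq_matrix_trace ℂ (f.vec x).toBasis γ).symm

lemma UnitaryFrame.det_matrix (f : UnitaryFrame E) (x : X) (γ : E.EndAt x) :
    (f.matrix x γ).det = LinearMap.det γ := LinearMap.det_toMatrix _ _

lemma UnitaryFrame.transition_eq (f f' : UnitaryFrame E) (x : X) :
    f.transition f' x = (f.vec x).toBasis.toMatrix (f'.vec x) := by
  ext a b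
  simp [UnitaryFrame.transition, Module.Basis.toMatrix_apply, OrthonormalBasis.repr_apply_apply]

lemma UnitaryFrame.transition_conjTranspose_mul (f f' : UnitaryFrame E) (x : X) :
    (f.transition f' x)ᴴ * f.transition f' x = 1 := by
  rw [transition_eq]; exact OrthonormalBasis.toMatrix_orthonormalBasis_conjTranspose_mul_self _ _

lemma UnitaryFrame.transition_mul_conjTranspose (f f' : UnitaryFrame E) (x : X) :
    f.transition f' x * (f.transition f' x)ᴴ = 1 :=
  mul_eq_one_comm.1 (f.transition_conjTranspose_mul f' x)

lemma UnitaryFrame.transition_conjTranspose (f f' : UnitaryFrame E) (x : X) :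
    (f.transition f' x)ᴴ = f'.transition f x := by
  ext a b
  simp [UnitaryFrame.transition]

/-- The change of the matrix of an endomorphism under a change of frame. -/
lemma UnitaryFrame.matrix_change (f f' : UnitaryFrame E) (x : X) (γ : E.EndAt x) :
    f'.matrix x γ = (f.transition f' x)ᴴ * f.matrix x γ * f.transition f' x := by
  rw [transition_conjTranspose, transition_eq, transition_eq]
  exact (basis_toMatrix_mul_linearMap_toMatrix_mul_basis_toMatrix (f'.vec x).toBasis
    (f.vec x).toBasis (f'.vec x).toBasis (f.vec x).toBasis γ).symm

lemma UnitaryFrame.contMDiffAt_transition (f f' : UnitaryFrame E) {x : X} (hx : x ∈ f.dom)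
    (hx' : x ∈ f'.dom) (a b : Fin 2) :
    ContMDiffAt 𝓘(ℝ, ℂ) 𝓘(ℝ, ℂ) ∞ (fun y => f.transition f' y a b) x := by
  obtain ⟨i, hi⟩ := E.cover x
  have h1 : ∀ c, ContMDiffAt 𝓘(ℝ, ℂ) 𝓘(ℝ, ℂ) ∞ (fun y => ⟪E.frame i y c, f.vec y a⟫_ℂ) x := fun c =>
    (f.smooth i c a).contMDiffAt (((E.isOpen_dom i).inter f.isOpen_dom).mem_nhds ⟨hi, hx⟩)
  have h2 : ∀ c, ContMDiffAt 𝓘(ℝ, ℂ) 𝓘(ℝ, ℂ) ∞ (fun y => ⟪E.frame i y c, f'.vec y b⟫_ℂ) x := fun c =>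
    (f'.smooth i c b).contMDiffAt (((E.isOpen_dom i).inter f'.isOpen_dom).mem_nhds ⟨hi, hx'⟩)
  have h3 : (fun y => f.transition f' y a b) = fun y =>
      starRingEnd ℂ ⟪E.frame i y 0, f.vec y a⟫_ℂ * ⟪E.frame i y 0, f'.vec y b⟫_ℂ +
      starRingEnd ℂ ⟪E.frame i y 1, f.vec y a⟫_ℂ * ⟪E.frame i y 1, f'.vec y b⟫_ℂ := by
    funext y
    have := (E.frame i y).sum_inner_mul_inner (f.vec y a) (f'.vec y b)
    rw [Fin.sum_univ_two] at this
    simp only [inner_conj_symm]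
    exact this.symm
  have he : chartAt ℂ x ∈ holAtlas X := chartAt_mem_holAtlas x
  have hs := mem_chart_source ℂ x
  rw [h3, contMDiffAt_iff_coord he hs]
  simp only [contMDiffAt_iff_coord he hs] at h1 h2
  exact ((contDiffAt_conj (h1 0)).mul (h2 0)).add ((contDiffAt_conj (h1 1)).mul (h2 1))

lemma UnitaryFrame.smoothMatAt_transition (f f' : UnitaryFrame E) (he : e ∈ holAtlas X) {x : X}
    (hs : x ∈ e.source) (hx : x ∈ f.dom) (hx' : x ∈ f'.dom) :
    SmoothMatAt (fun z => f.transition f' (e.symm z)) (e x) := fun a b =>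
  (contMDiffAt_iff_coord he hs).1 (f.contMDiffAt_transition f' hx hx' a b)

/-- The frames that define the smooth structure of `E`. -/
def UnitaryFrame.ofBundle (E : HermitianBundle.{u, v} X) (i : E.ι) : UnitaryFrame E where
  dom := E.dom i
  isOpen_dom := E.isOpen_dom i
  vec := E.frame i
  smooth j a b := E.smooth_transition j i a b

lemma exists_frame (E : HermitianBundle.{u, v} X) (x : X) : ∃ f : UnitaryFrame E, x ∈ f.dom := by
  obtain ⟨i, hi⟩ := E.cover x
  exact ⟨UnitaryFrame.ofBundle E i, hi⟩

lemma orthonormal_rotate {V : Type*} [NormedAddCommGroup V] [InnerProductSpace ℂ V]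
    (b : OrthonormalBasis (Fin 2) ℂ V) {g : Matrix (Fin 2) (Fin 2) ℂ} (hg : gᴴ * g = 1) :
    Orthonormal ℂ fun j => ∑ i, g i j • b i := by
  rw [orthonormal_iff_ite]
  intro j k
  rw [b.orthonormal.inner_sum]
  have h1 := congrFun (congrFun hg j) k
  simpa [Matrix.mul_apply, Matrix.one_apply] using h1

/-- The frame with constant transition matrix `g` from `f`. -/
def UnitaryFrame.rotate (f : UnitaryFrame E) (g : Matrix (Fin 2) (Fin 2) ℂ) (hg : gᴴ * g = 1) :
    UnitaryFrame E where
  dom := f.dom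
  isOpen_dom := f.isOpen_dom
  vec x := OrthonormalBasis.mk (orthonormal_rotate (f.vec x) hg) (by
    rw [(orthonormal_rotate (f.vec x) hg).linearIndependent.span_eq_top_of_card_eq_finrank
      (by rw [Module.finrank_eq_card_basis (f.vec x).toBasis])])
  smooth i a b := by
    have h : (fun x => ⟪E.frame i x a, OrthonormalBasis.mk (orthonormal_rotate (f.vec x) hg) (by
        rw [(orthonormal_rotate (f.vec x) hg).linearIndependent.span_eq_top_of_card_eq_finrank
        (by rw [Module.finrank_eq_card_basis (f.vec x).toBasis])]) b⟫_ℂ) =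
        fun x => g 0 b * ⟪E.frame i x a, f.vec x 0⟫_ℂ + g 1 b * ⟪E.frame i x a, f.vec x 1⟫_ℂ := by
      funext x
      rw [OrthonormalBasis.coe_mk, Fin.sum_univ_two, inner_add_right, inner_smul_right,
        inner_smul_right]
    rw [h]
    have h2 : ∀ c : ℂ, ContMDiff 𝓘(ℝ, ℂ) 𝓘(ℝ, ℂ) ∞ (fun z : ℂ => c * z) := fun c =>
      (contDiff_const.mul contDiff_id).contMDiff
    exact ((h2 _).comp_contMDiffOn (f.smooth i a 0)).add ((h2 _).comp_contMDiffOn (f.smooth i a 1))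

lemma UnitaryFrame.transition_rotate (f : UnitaryFrame E) (g : Matrix (Fin 2) (Fin 2) ℂ)
    (hg : gᴴ * g = 1) (x : X) : f.transition (f.rotate g hg) x = g := by
  ext a b
  simp only [UnitaryFrame.transition, UnitaryFrame.rotate, Matrix.of_apply, OrthonormalBasis.coe_mk]
  rw [inner_sum]
  simp only [inner_smul_right, orthonormal_iff_ite.1 (f.vec x).orthonormal]
  simp

/-! ### Matrix-valued one-forms in coordinates -/

/-- The coefficient at `z` of a matrix-valued one-form, in the direction `w` of a coordinate. -/
def formCoeff (α : ∀ x : X, Tangent x →ₗ[ℝ] Matrix (Fin 2) (Fin 2) ℂ)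
    (e : OpenPartialHomeomorph X ℂ) (w z : ℂ) : Matrix (Fin 2) (Fin 2) ℂ :=
  α (e.symm z) (push e z w)

lemma push_real_smul (e : OpenPartialHomeomorph X ℂ) (z : ℂ) (r : ℝ) (w : ℂ) :
    push e z (r • w) = r • push e z w := by
  rw [Complex.real_smul, push_smul]; rfl

lemma formCoeff_re_im (α : ∀ x : X, Tangent x →ₗ[ℝ] Matrix (Fin 2) (Fin 2) ℂ)
    (e : OpenPartialHomeomorph X ℂ) (w z : ℂ) :
    formCoeff α e w z = w.re • formCoeff α e 1 z + w.im • formCoeff α e Complex.I z := by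
  have : w = (w.re : ℝ) • (1 : ℂ) + (w.im : ℝ) • Complex.I := by simp [Complex.re_add_im]
  conv_lhs => rw [this]
  rw [formCoeff, push_add, push_real_smul, push_real_smul, map_add, map_smul, map_smul]
  rfl

lemma formCoeff_change (α : ∀ x : X, Tangent x →ₗ[ℝ] Matrix (Fin 2) (Fin 2) ℂ)
    (he : e ∈ holAtlas X) (he' : e' ∈ holAtlas X) {ζ : ℂ}
    (hζ : ζ ∈ e'.target) (hs : e'.symm ζ ∈ e.source) (w : ℂ) :
    formCoeff α e' w ζ = formCoeff α e (deriv (e ∘ e'.symm) ζ * w) (e (e'.symm ζ)) :=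
  eval_congr (fun x v => α x v) (e.left_inv hs).symm (push_change he he' hζ hs w)

lemma smoothMatAt_formCoeff_change (α : ∀ x : X, Tangent x →ₗ[ℝ] Matrix (Fin 2) (Fin 2) ℂ)
    (he : e ∈ holAtlas X) (he' : e' ∈ holAtlas X) {x : X} (hx : x ∈ e.source) (hx' : x ∈ e'.source)
    (h : ∀ w, SmoothMatAt (formCoeff α e w) (e x)) (w : ℂ) :
    SmoothMatAt (formCoeff α e' w) (e' x) := by
  have ht := e'.map_source hx'
  have hs : e'.symm (e' x) ∈ e.source := by rwa [e'.left_inv hx']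
  have h2 := contDiffAt_coordChange he he' ht hs
  have h3 : ContDiffAt ℝ ∞ (e ∘ e'.symm) (e' x) := (h2.restrict_scalars ℝ).of_le le_top
  have h4 : ContDiffAt ℝ ∞ (fun ζ => deriv (e ∘ e'.symm) ζ * w) (e' x) :=
    ((h2.analyticAt.deriv.contDiffAt.restrict_scalars ℝ).of_le (n := ω) le_top).mul contDiffAt_const
  have h5 : (e ∘ e'.symm) (e' x) = e x := by simp [e'.left_inv hx']
  have h6 : ∀ w, SmoothMatAt (fun ζ => formCoeff α e w ((e ∘ e'.symm) ζ)) (e' x) := fun w =>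
    SmoothMatAt.comp (by rw [h5]; exact h w) h3
  have h7 : SmoothMatAt (fun ζ =>
      (((deriv (e ∘ e'.symm) ζ * w).re : ℝ) : ℂ) • formCoeff α e 1 ((e ∘ e'.symm) ζ) +
      (((deriv (e ∘ e'.symm) ζ * w).im : ℝ) : ℂ) • formCoeff α e Complex.I ((e ∘ e'.symm) ζ)) (e' x) := by
    refine SmoothMatAt.add (SmoothMatAt.smul ?_ (h6 1)) (SmoothMatAt.smul ?_ (h6 Complex.I))
    · exact (Complex.ofRealCLM.contDiff.comp Complex.reCLM.contDiff).contDiffAt.comp _ h4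
    · exact (Complex.ofRealCLM.contDiff.comp Complex.imCLM.contDiff).contDiffAt.comp _ h4
  refine h7.congr ?_
  filter_upwards [coordChange_eventually e ht hs] with ζ hζ
  rw [formCoeff_change α he he' hζ.1 hζ.2, formCoeff_re_im]
  rfl

/-- The matrix-valued one-form of an `End(E)`-valued one-form in a unitary frame. -/
def UnitaryFrame.formMatrix (f : UnitaryFrame E) (B : ∀ x : X, Tangent x →ₗ[ℝ] E.EndAt x) (x : X) :
    Tangent x →ₗ[ℝ] Matrix (Fin 2) (Fin 2) ℂ where
  toFun v := f.matrix x (B x v)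
  map_add' v w := by rw [map_add, f.matrix_add]
  map_smul' r v := by
    rw [map_smul, ← Complex.coe_smul, f.matrix_smul, Complex.coe_smul]; rfl

/-- The `End(E)`-valued one-form `B` is smooth at the point `x`. -/
def SmoothFormAt (B : ∀ x : X, Tangent x →ₗ[ℝ] E.EndAt x) (x : X) : Prop :=
  ∀ f : UnitaryFrame E, x ∈ f.dom → ∀ e ∈ holAtlas X, x ∈ e.source → ∀ w,
    SmoothMatAt (formCoeff (f.formMatrix B) e w) (e x)

/-- Smoothness of an `End(E)`-valued one-form may be checked in a single frame and coordinate. -/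
lemma SmoothFormAt.of_frame {B : ∀ x : X, Tangent x →ₗ[ℝ] E.EndAt x} {x : X} (f : UnitaryFrame E)
    (hf : x ∈ f.dom) (he : e ∈ holAtlas X) (hx : x ∈ e.source)
    (h : ∀ w, SmoothMatAt (formCoeff (f.formMatrix B) e w) (e x)) : SmoothFormAt B x := by
  intro f' hf' e' he' hx' w
  have h1 := smoothMatAt_formCoeff_change _ he he' hx hx' h w
  have hg := f.smoothMatAt_transition f' he' hx' hf hf'
  refine ((hg.conjTranspose.mul h1).mul hg).congr (Filter.Eventually.of_forall fun z => ?_)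
  exact f.matrix_change f' _ _

/-! ### Connections -/

variable {W : Set X}

lemma eventually_mem_of_isOpen {U : Set X} (hU : IsOpen U) {x : X} (hx : x ∈ e.source) (hxU : x ∈ U) :
    ∀ᶠ z in 𝓝 (e x), z ∈ e.target ∧ e.symm z ∈ U := by
  refine (e.isOpen_inter_preimage_symm hU).mem_nhds ⟨e.map_source hx, ?_⟩
  simpa [e.left_inv hx] using hxU

lemma UnitaryConnection.smoothMatAt (A : UnitaryConnection E W) (hW : IsOpen W) (f : UnitaryFrame E)
    (he : e ∈ holAtlas X) {x : X} (hx : x ∈ e.source) (hf : x ∈ f.dom) (hxW : x ∈ W) (w : ℂ) :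
    SmoothMatAt (A.matrix f e w) (e x) := by
  refine smoothMatAt_formCoeff_change (A.form f) (chartAt_mem_holAtlas x) he (mem_chart_source ℂ x) hx
    (fun w a b => ?_) w
  refine (A.smooth f _ (chart_mem_atlas ℂ x) w a b).contDiffAt ?_
  exact eventually_mem_of_isOpen (f.isOpen_dom.inter hW) (mem_chart_source ℂ x) ⟨hf, hxW⟩

lemma UnitaryConnection.matrix_change (A : UnitaryConnection E W) (f f' : UnitaryFrame E)
    (he : e ∈ holAtlas X) {z : ℂ} (hz : z ∈ e.target) (hf : e.symm z ∈ f.dom)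
    (hf' : e.symm z ∈ f'.dom) (hW : e.symm z ∈ W) (w : ℂ) :
    A.matrix f' e w z = (f.transition f' (e.symm z))ᴴ * A.matrix f e w z * f.transition f' (e.symm z) +
      (f.transition f' (e.symm z))ᴴ * dirDeriv (fun ζ => f.transition f' (e.symm ζ)) z w := by
  set e₀ := chartAt ℂ (e.symm z)
  have he₀ : e₀ ∈ holAtlas X := chartAt_mem_holAtlas _
  have hs : e.symm z ∈ e₀.source := mem_chart_source ℂ _
  have hd := (contDiffAt_coordChange he₀ he hz hs).differentiableAt (by simp)
  have h1 := formCoeff_change (A.form f) he₀ he hz hs w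
  have h1' := formCoeff_change (A.form f') he₀ he hz hs w
  have h2 := A.change_frame f f' e₀ (chart_mem_atlas ℂ _) (e₀ (e.symm z))
    ⟨e₀.map_source hs, by simpa [e₀.left_inv hs] using ⟨⟨hf, hf'⟩, hW⟩⟩ (deriv (e₀ ∘ e.symm) z * w)
  have h3 : dirDeriv (fun ζ => f.transition f' (e.symm ζ)) z w =
      dirDeriv (fun ζ => f.transition f' (e₀.symm ζ)) (e₀ (e.symm z)) (deriv (e₀ ∘ e.symm) z * w) := by
    rw [← fderiv_real_of_complex hd]
    have := dirDeriv_comp (M := fun ζ => f.transition f' (e₀.symm ζ)) (h := e₀ ∘ e.symm) (z := z)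
      (f.smoothMatAt_transition f' he₀ hs hf hf') (hd.restrictScalars ℝ) w
    rw [← show (e₀ ∘ e.symm) z = e₀ (e.symm z) from rfl, ← this]
    refine dirDeriv_congr ?_ w
    filter_upwards [coordChange_eventually e₀ hz hs] with y hy
    simp [e₀.left_inv hy.2]
  have h4 : f.transition f' (e₀.symm (e₀ (e.symm z))) = f.transition f' (e.symm z) :=
    congrArg _ (e₀.left_inv hs)
  rw [h4] at h2
  change formCoeff (A.form f') e w z = _ * formCoeff (A.form f) e w z * _ + _
  rw [h1', h1, h3]
  exact h2

end Frames

/-! ### Curvature and covariant derivatives in the plane -/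

/-- The curvature of the connection form `a dx + b dy`. -/
def curv (a b : ℂ → Matrix (Fin 2) (Fin 2) ℂ) (z : ℂ) : Matrix (Fin 2) (Fin 2) ℂ :=
  dirDeriv b z 1 - dirDeriv a z Complex.I + ⁅a z, b z⁆

section Planar

variable {a b g φ : ℂ → Matrix (Fin 2) (Fin 2) ℂ} {z : ℂ}

/-- The derivative of a unitary matrix. -/
lemma conjTranspose_dirDeriv_unitary (hg : SmoothMatAt g z) (h1 : ∀ᶠ ζ in 𝓝 z, (g ζ)ᴴ * g ζ = 1)
    (w : ℂ) : (dirDeriv g z w)ᴴ = -((g z)ᴴ * dirDeriv g z w * (g z)ᴴ) := by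
  have h2 : dirDeriv (fun ζ => (g ζ)ᴴ * g ζ) z w = 0 := by
    rw [dirDeriv_congr (N := fun _ => 1) h1, dirDeriv_const]
  rw [dirDeriv_mul hg.conjTranspose hg, dirDeriv_conjTranspose hg] at h2
  have h3 : g z * (g z)ᴴ = 1 := mul_eq_one_comm.1 h1.self_of_nhds
  have h4 := congrArg (· * (g z)ᴴ) h2
  simp only [add_mul, zero_mul, mul_assoc, h3, mul_one] at h4
  rw [mul_assoc]
  exact eq_neg_of_add_eq_zero_left h4

/-- The curvature transforms by conjugation under a unitary change of frame. -/
lemma curv_gauge {a' b' : ℂ → Matrix (Fin 2) (Fin 2) ℂ} (ha : SmoothMatAt a z) (hb : SmoothMatAt b z)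
    (hg : SmoothMatAt g z) (h1 : ∀ᶠ ζ in 𝓝 z, (g ζ)ᴴ * g ζ = 1)
    (ha' : ∀ᶠ ζ in 𝓝 z, a' ζ = (g ζ)ᴴ * a ζ * g ζ + (g ζ)ᴴ * dirDeriv g ζ 1)
    (hb' : ∀ᶠ ζ in 𝓝 z, b' ζ = (g ζ)ᴴ * b ζ * g ζ + (g ζ)ᴴ * dirDeriv g ζ Complex.I) :
    curv a' b' z = (g z)ᴴ * curv a b z * g z := by
  have hgh := hg.conjTranspose
  have hX := hg.dirDeriv 1
  have hY := hg.dirDeriv Complex.I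
  rw [curv, curv, dirDeriv_congr hb', dirDeriv_congr ha', ha'.self_of_nhds, hb'.self_of_nhds,
    dirDeriv_add ((hgh.mul hb).mul hg) (hgh.mul hY), dirDeriv_add ((hgh.mul ha).mul hg) (hgh.mul hX),
    dirDeriv_mul (hgh.mul hb) hg, dirDeriv_mul (hgh.mul ha) hg, dirDeriv_mul hgh hb,
    dirDeriv_mul hgh ha, dirDeriv_mul hgh hY, dirDeriv_mul hgh hX, dirDeriv_conjTranspose hg,
    dirDeriv_conjTranspose hg, conjTranspose_dirDeriv_unitary hg h1,
    conjTranspose_dirDeriv_unitary hg h1, dirDeriv_comm hg 1 Complex.I]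
  have h3 : g z * (g z)ᴴ = 1 := mul_eq_one_comm.1 h1.self_of_nhds
  have h4 : ∀ m, g z * ((g z)ᴴ * m) = m := fun m => by rw [← mul_assoc, h3, one_mul]
  simp only [Ring.lie_def, mul_add, add_mul, mul_sub, sub_mul, mul_assoc, h4, neg_mul]
  abel

/-- The covariant derivative transforms by conjugation under a unitary change of frame. -/
lemma covariant_gauge (hφ : SmoothMatAt φ z) (hg : SmoothMatAt g z)
    (h1 : ∀ᶠ ζ in 𝓝 z, (g ζ)ᴴ * g ζ = 1) (A : Matrix (Fin 2) (Fin 2) ℂ) (w : ℂ) :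
    dirDeriv (fun ζ => (g ζ)ᴴ * φ ζ * g ζ) z w +
      ⁅(g z)ᴴ * A * g z + (g z)ᴴ * dirDeriv g z w, (g z)ᴴ * φ z * g z⁆ =
    (g z)ᴴ * (dirDeriv φ z w + ⁅A, φ z⁆) * g z := by
  have hgh := hg.conjTranspose
  rw [dirDeriv_mul (hgh.mul hφ) hg, dirDeriv_mul hgh hφ, dirDeriv_conjTranspose hg,
    conjTranspose_dirDeriv_unitary hg h1]
  have h3 : g z * (g z)ᴴ = 1 := mul_eq_one_comm.1 h1.self_of_nhds
  have h4 : ∀ m, g z * ((g z)ᴴ * m) = m := fun m => by rw [← mul_assoc, h3, one_mul]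
  simp only [Ring.lie_def, mul_add, add_mul, mul_sub, sub_mul, mul_assoc, h4, neg_mul]
  abel

/-- The curvature is multiplied by the Jacobian under a holomorphic change of coordinate. -/
lemma curv_chart {h : ℂ → ℂ} {a' b' : ℂ → Matrix (Fin 2) (Fin 2) ℂ} (hh : AnalyticAt ℂ h z)
    (ha : SmoothMatAt a (h z)) (hb : SmoothMatAt b (h z))
    (ha' : ∀ᶠ ζ in 𝓝 z, a' ζ = (deriv h ζ).re • a (h ζ) + (deriv h ζ).im • b (h ζ))
    (hb' : ∀ᶠ ζ in 𝓝 z, b' ζ = (deriv h ζ * Complex.I).re • a (h ζ) +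
      (deriv h ζ * Complex.I).im • b (h ζ)) :
    curv a' b' z = (Complex.normSq (deriv h z) : ℂ) • curv a b (h z) := by
  have hhd : DifferentiableAt ℝ h z := hh.differentiableAt.restrictScalars ℝ
  have hhs : ContDiffAt ℝ ∞ h z := (hh.contDiffAt.restrict_scalars ℝ).of_le (n := ω) le_top
  have hda : AnalyticAt ℂ (deriv h) z := hh.deriv
  have hds : ContDiffAt ℝ ∞ (deriv h) z := (hda.contDiffAt.restrict_scalars ℝ).of_le (n := ω) le_top
  have hre : ContDiffAt ℝ ∞ (fun ζ => ((deriv h ζ).re : ℂ)) z :=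
    (Complex.ofRealCLM.contDiff.comp Complex.reCLM.contDiff).contDiffAt.comp _ hds
  have him : ContDiffAt ℝ ∞ (fun ζ => ((deriv h ζ).im : ℂ)) z :=
    (Complex.ofRealCLM.contDiff.comp Complex.imCLM.contDiff).contDiffAt.comp _ hds
  have dre : ∀ w, fderiv ℝ (fun ζ => ((deriv h ζ).re : ℂ)) z w = (deriv (deriv h) z * w).re := fun w => by
    have := ((Complex.ofRealCLM.comp Complex.reCLM).hasFDerivAt (x := deriv h z)).comp z
      (differentiableAt_of_smooth hds).hasFDerivAt
    rw [show (fun ζ => ((deriv h ζ).re : ℂ)) = (Complex.ofRealCLM.comp Complex.reCLM) ∘ deriv h from rfl,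
      this.fderiv]
    simp [fderiv_real_of_complex hda.differentiableAt]
  have dim : ∀ w, fderiv ℝ (fun ζ => ((deriv h ζ).im : ℂ)) z w = (deriv (deriv h) z * w).im := fun w => by
    have := ((Complex.ofRealCLM.comp Complex.imCLM).hasFDerivAt (x := deriv h z)).comp z
      (differentiableAt_of_smooth hds).hasFDerivAt
    rw [show (fun ζ => ((deriv h ζ).im : ℂ)) = (Complex.ofRealCLM.comp Complex.imCLM) ∘ deriv h from rfl,
      this.fderiv]
    simp [fderiv_real_of_complex hda.differentiableAt]
  have ha2 : a' =ᶠ[𝓝 z] fun ζ => ((deriv h ζ).re : ℂ) • a (h ζ) + ((deriv h ζ).im : ℂ) • b (h ζ) :=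
    ha'.mono fun ζ hζ => hζ
  have hb2 : b' =ᶠ[𝓝 z] fun ζ => (-((deriv h ζ).im : ℂ)) • a (h ζ) + ((deriv h ζ).re : ℂ) • b (h ζ) :=
    hb'.mono fun ζ hζ => by rw [hζ]; simp
  have hac := ha.comp hhs
  have hbc := hb.comp hhs
  have hsplit : ∀ (M : ℂ → Matrix (Fin 2) (Fin 2) ℂ) (w : ℂ), dirDeriv M (h z) w =
      (w.re : ℂ) • dirDeriv M (h z) 1 + (w.im : ℂ) • dirDeriv M (h z) Complex.I := fun M w => by
    have : w = (w.re : ℝ) • (1 : ℂ) + (w.im : ℝ) • Complex.I := by simp [Complex.re_add_im]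
    conv_lhs => rw [this, dirDeriv_add_right, dirDeriv_smul_right, dirDeriv_smul_right]
    rfl
  rw [curv, curv, dirDeriv_congr hb2, dirDeriv_congr ha2, ha2.self_of_nhds, hb2.self_of_nhds,
    dirDeriv_add (SmoothMatAt.smul him.neg hac) (SmoothMatAt.smul hre hbc),
    dirDeriv_add (SmoothMatAt.smul hre hac) (SmoothMatAt.smul him hbc),
    dirDeriv_smul him.neg hac, dirDeriv_smul hre hbc, dirDeriv_smul hre hac, dirDeriv_smul him hbc,
    dirDeriv_comp ha hhd, dirDeriv_comp hb hhd, dirDeriv_comp ha hhd, dirDeriv_comp hb hhd]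
  simp only [fderiv_fun_neg, neg_apply, dre, dim,
    fderiv_real_of_complex hh.differentiableAt]
  rw [hsplit a (_ * 1), hsplit b (_ * 1), hsplit a (_ * Complex.I), hsplit b (_ * Complex.I)]
  generalize deriv (deriv h) z = d2
  generalize deriv h z = d
  ext i j
  simp only [Ring.lie_def, Matrix.add_apply, Matrix.sub_apply, Matrix.smul_apply, smul_eq_mul,
    Matrix.mul_apply, Fin.sum_univ_two, Complex.normSq_apply]
  simp
  ring

/-- The covariant derivative of a matrix-valued (1,0)-form under a holomorphic change of
coordinate. -/
lemma covariant_chart {h : ℂ → ℂ} {φ' : ℂ → Matrix (Fin 2) (Fin 2) ℂ} (hh : AnalyticAt ℂ h z)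
    (hφ : SmoothMatAt φ (h z)) (hφ' : ∀ᶠ ζ in 𝓝 z, φ' ζ = deriv h ζ • φ (h ζ))
    (A : Matrix (Fin 2) (Fin 2) ℂ) (w : ℂ) :
    dirDeriv φ' z w + ⁅A, φ' z⁆ = (deriv (deriv h) z * w) • φ (h z) +
      deriv h z • (dirDeriv φ (h z) (deriv h z * w) + ⁅A, φ (h z)⁆) := by
  have hhd : DifferentiableAt ℝ h z := hh.differentiableAt.restrictScalars ℝ
  have hhs : ContDiffAt ℝ ∞ h z := (hh.contDiffAt.restrict_scalars ℝ).of_le (n := ω) le_top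
  have hda : AnalyticAt ℂ (deriv h) z := hh.deriv
  have hds : ContDiffAt ℝ ∞ (deriv h) z := (hda.contDiffAt.restrict_scalars ℝ).of_le (n := ω) le_top
  rw [dirDeriv_congr hφ', hφ'.self_of_nhds, dirDeriv_smul hds (hφ.comp hhs), dirDeriv_comp hφ hhd,
    fderiv_real_of_complex hda.differentiableAt, fderiv_real_of_complex hh.differentiableAt,
    Ring.lie_def, Ring.lie_def, mul_smul_comm, smul_mul_assoc]
  module

lemma lie_trace_free_pair (M N : Matrix (Fin 2) (Fin 2) ℂ) : (⁅M, N⁆ * N).trace = 0 := by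
  rw [Ring.lie_def, sub_mul, Matrix.trace_sub, sub_eq_zero, mul_assoc, mul_assoc,
    Matrix.trace_mul_comm N (M * N), mul_assoc]

/-- A trace-free matrix squares to a scalar. -/
lemma mul_self_of_trace_eq_zero {M : Matrix (Fin 2) (Fin 2) ℂ} (h : M.trace = 0) :
    M * M = (-M.det) • (1 : Matrix (Fin 2) (Fin 2) ℂ) := by
  rw [Matrix.trace_fin_two] at h
  have h' : M 1 1 = - M 0 0 := by linear_combination h
  rw [Matrix.det_fin_two, h']
  ext i j
  fin_cases i <;> fin_cases j <;>
    simp [Matrix.mul_apply, Fin.sum_univ_two, h'] <;> ring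

/-- If `φ` is an eigensection of the covariant derivative, then the curvature commutes with it. -/
lemma curv_commutes {m n : ℂ → ℂ} (ha : SmoothMatAt a z) (hb : SmoothMatAt b z)
    (hφ : SmoothMatAt φ z) (hm : ContDiffAt ℝ ∞ m z) (hn : ContDiffAt ℝ ∞ n z)
    (h1 : ∀ᶠ ζ in 𝓝 z, dirDeriv φ ζ 1 + ⁅a ζ, φ ζ⁆ = m ζ • φ ζ)
    (h2 : ∀ᶠ ζ in 𝓝 z, dirDeriv φ ζ Complex.I + ⁅b ζ, φ ζ⁆ = n ζ • φ ζ)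
    (ht : (φ z).trace = 0) (hd : (φ z).det ≠ 0) : ⁅curv a b z, φ z⁆ = 0 := by
  have e1 := dirDeriv_congr h1 Complex.I
  have e2 := dirDeriv_congr h2 1
  rw [dirDeriv_add (hφ.dirDeriv _) (ha.lie hφ), dirDeriv_lie ha hφ, dirDeriv_smul hm hφ] at e1
  rw [dirDeriv_add (hφ.dirDeriv _) (hb.lie hφ), dirDeriv_lie hb hφ, dirDeriv_smul hn hφ] at e2
  rw [dirDeriv_comm hφ 1 Complex.I] at e1
  have f1 := eq_sub_of_add_eq h1.self_of_nhds
  have f2 := eq_sub_of_add_eq h2.self_of_nhds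
  rw [f2] at e1
  rw [f1] at e2
  have key : ⁅curv a b z, φ z⁆ = (fderiv ℝ n z 1 - fderiv ℝ m z Complex.I) • φ z := by
    have e3 := congrArg₂ (· - ·) e2 e1
    simp only [Ring.lie_def] at e3
    rw [curv, Ring.lie_def, Ring.lie_def]
    generalize dirDeriv (fun ζ => dirDeriv φ ζ Complex.I) z 1 = P at e3
    simp only [smul_sub, mul_sub, sub_mul, add_mul, mul_add, mul_smul_comm, smul_mul_assoc, mul_assoc] at e3 ⊢
    linear_combination (norm := module) e3
  have h3 := congrArg (fun M => (M * φ z).trace) key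
  simp only [lie_trace_free_pair] at h3
  rw [smul_mul_assoc, mul_self_of_trace_eq_zero ht, Matrix.trace_smul, Matrix.trace_smul] at h3
  have h4 : fderiv ℝ n z 1 - fderiv ℝ m z Complex.I = 0 := by
    simpa [hd] using h3.symm
  rw [key, h4, zero_smul]

end Planar

/-! ### Higgs fields and connections in frames and coordinates -/

section Local

variable {X : Type u} [TopologicalSpace X] [ChartedSpace ℂ X] [IsManifold 𝓘(ℂ) ω X]
  {E : HermitianBundle.{u, v} X} {e e' : OpenPartialHomeomorph X ℂ} {W : Set X} {z : ℂ}

lemma eventually_symm_mem {U : Set X} (hU : IsOpen U) (hz : z ∈ e.target) (hzU : e.symm z ∈ U) :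
    ∀ᶠ ζ in 𝓝 z, ζ ∈ e.target ∧ e.symm ζ ∈ U :=
  (e.isOpen_inter_preimage_symm hU).mem_nhds ⟨hz, hzU⟩

/-- The real one-form underlying a Higgs field. -/
def realForm (Ψ : ∀ x : X, Tangent x →ₗ[ℂ] E.EndAt x) (x : X) : Tangent x →ₗ[ℝ] E.EndAt x :=
  (Ψ x).restrictScalars ℝ

lemma formCoeff_realForm (Ψ : ∀ x : X, Tangent x →ₗ[ℂ] E.EndAt x) (f : UnitaryFrame E)
    (e : OpenPartialHomeomorph X ℂ) (w z : ℂ) :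
    formCoeff (f.formMatrix (realForm Ψ)) e w z =
      w • f.matrix (e.symm z) (Ψ (e.symm z) (push e z 1)) := by
  change f.matrix _ (Ψ _ (push e z w)) = _
  rw [push_eq_smul, map_smul, f.matrix_smul]

/-- Smoothness of a one-form at a point only depends on its germ. -/
lemma SmoothFormAt.congr {B B' : ∀ x : X, Tangent x →ₗ[ℝ] E.EndAt x} {x : X} (h : SmoothFormAt B x)
    (hB : ∀ᶠ y in 𝓝 x, B' y = B y) : SmoothFormAt B' x := by
  intro f hf e he hx w
  refine (h f hf e he hx w).congr ?_
  have h1 := e.continuousAt_symm (e.map_source hx)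
  rw [ContinuousAt, e.left_inv hx] at h1
  filter_upwards [h1.eventually hB] with z hz
  change f.matrix _ (B' _ _) = f.matrix _ (B _ _)
  rw [hz]

/-- A Higgs field from a family of linear maps that is smooth at every point of an open set. -/
def HiggsField.ofSmooth (Ψ : ∀ x : X, Tangent x →ₗ[ℂ] E.EndAt x)
    (ht : ∀ x ∈ W, ∀ v, LinearMap.trace ℂ (E.fiber x) (Ψ x v) = 0)
    (hs : ∀ x ∈ W, SmoothFormAt (realForm Ψ) x) : HiggsField E W where
  toFun := Ψ
  trace_eq_zero := ht
  smooth f e he a b z hz := by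
    have h := hs _ hz.2.2 f hz.2.1 e (atlas_subset_holAtlas he) (e.map_target hz.1) 1 a b
    rw [e.right_inv hz.1] at h
    refine (h.congr_of_eventuallyEq (Filter.Eventually.of_forall fun ζ => ?_)).contDiffWithinAt
    simp only [formCoeff_realForm, one_smul]

variable (Φ : HiggsField E W) (A : UnitaryConnection E W) (f f' : UnitaryFrame E)

lemma HiggsField.smoothFormAt (hW : IsOpen W) {x : X} (hx : x ∈ W) :
    SmoothFormAt (realForm Φ.toFun) x := by
  obtain ⟨f, hf⟩ := exists_frame E x
  refine SmoothFormAt.of_frame f hf (chartAt_mem_holAtlas x) (mem_chart_source ℂ x) fun w => ?_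
  have h : SmoothMatAt (Φ.matrix f (chartAt ℂ x)) (chartAt ℂ x x) := fun a b => by
    refine (Φ.smooth f _ (chart_mem_atlas ℂ x) a b).contDiffAt ?_
    exact eventually_mem_of_isOpen (f.isOpen_dom.inter hW) (mem_chart_source ℂ x) ⟨hf, hx⟩
  refine (h.const_smul w).congr (Filter.Eventually.of_forall fun ζ => ?_)
  exact formCoeff_realForm Φ.toFun f _ w ζ

lemma HiggsField.smoothMatAt (hW : IsOpen W) (he : e ∈ holAtlas X) (hz : z ∈ e.target)
    (hf : e.symm z ∈ f.dom) (hzW : e.symm z ∈ W) : SmoothMatAt (Φ.matrix f e) z := by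
  have h := Φ.smoothFormAt hW hzW f hf e he (e.map_target hz) 1
  rw [e.right_inv hz] at h
  refine h.congr (Filter.Eventually.of_forall fun ζ => ?_)
  rw [formCoeff_realForm, one_smul]; rfl

lemma UnitaryConnection.smoothMatAt_target (hW : IsOpen W) (he : e ∈ holAtlas X) (hz : z ∈ e.target)
    (hf : e.symm z ∈ f.dom) (hzW : e.symm z ∈ W) (w : ℂ) : SmoothMatAt (A.matrix f e w) z := by
  have h := A.smoothMatAt hW f he (e.map_target hz) hf hzW w
  rwa [e.right_inv hz] at h

lemma UnitaryFrame.smoothMatAt_transition_target (he : e ∈ holAtlas X) (hz : z ∈ e.target)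
    (hf : e.symm z ∈ f.dom) (hf' : e.symm z ∈ f'.dom) :
    SmoothMatAt (fun ζ => f.transition f' (e.symm ζ)) z := by
  have h := f.smoothMatAt_transition f' he (e.map_target hz) hf hf'
  rwa [e.right_inv hz] at h

lemma HiggsField.matrix_change_frame (e : OpenPartialHomeomorph X ℂ) (z : ℂ) :
    Φ.matrix f' e z =
      (f.transition f' (e.symm z))ᴴ * Φ.matrix f e z * f.transition f' (e.symm z) :=
  f.matrix_change f' _ _

lemma HiggsField.matrix_change_chart (he : e ∈ holAtlas X) (he' : e' ∈ holAtlas X)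
    (hz : z ∈ e'.target) (hs : e'.symm z ∈ e.source) :
    Φ.matrix f e' z = deriv (e ∘ e'.symm) z • Φ.matrix f e (e (e'.symm z)) := by
  have h := formCoeff_change (f.formMatrix (realForm Φ.toFun)) he he' hz hs 1
  rw [formCoeff_realForm, formCoeff_realForm, one_smul, mul_one] at h
  exact h

lemma UnitaryConnection.matrix_change_chart (he : e ∈ holAtlas X) (he' : e' ∈ holAtlas X)
    (hz : z ∈ e'.target) (hs : e'.symm z ∈ e.source) (w : ℂ) :
    A.matrix f e' w z = A.matrix f e (deriv (e ∘ e'.symm) z * w) (e (e'.symm z)) :=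
  formCoeff_change (A.form f) he he' hz hs w

lemma UnitaryConnection.matrix_re_im (e : OpenPartialHomeomorph X ℂ) (w z : ℂ) :
    A.matrix f e w z = w.re • A.matrix f e 1 z + w.im • A.matrix f e Complex.I z :=
  formCoeff_re_im (A.form f) e w z

lemma HiggsField.trace_matrix {e : OpenPartialHomeomorph X ℂ} {z : ℂ} (hz : e.symm z ∈ W) :
    (Φ.matrix f e z).trace = 0 := by
  rw [HiggsField.matrix, f.trace_matrix]; exact Φ.trace_eq_zero _ hz _

variable {Φ} in
lemma HiggsField.HasDet.det_matrix {q : QuadraticDifferential X} (h : Φ.HasDet q)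
    {e : OpenPartialHomeomorph X ℂ} {z : ℂ} (hz : e.symm z ∈ W) :
    (Φ.matrix f e z).det = q.coeff e z := by
  rw [HiggsField.matrix, f.det_matrix]; exact h _ hz _

lemma UnitaryFrame.eventually_unitary (e : OpenPartialHomeomorph X ℂ) (z : ℂ) :
    ∀ᶠ ζ in 𝓝 z, (f.transition f' (e.symm ζ))ᴴ * f.transition f' (e.symm ζ) = 1 :=
  Filter.Eventually.of_forall fun _ => f.transition_conjTranspose_mul f' _

/-- The curvature in two frames. -/
lemma UnitaryConnection.curvature_change_frame (hW : IsOpen W) (he : e ∈ holAtlas X)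
    (hz : z ∈ e.target) (hf : e.symm z ∈ f.dom) (hf' : e.symm z ∈ f'.dom) (hzW : e.symm z ∈ W) :
    A.curvature f' e z =
      (f.transition f' (e.symm z))ᴴ * A.curvature f e z * f.transition f' (e.symm z) := by
  have h : ∀ w, ∀ᶠ ζ in 𝓝 z, A.matrix f' e w ζ =
      (f.transition f' (e.symm ζ))ᴴ * A.matrix f e w ζ * f.transition f' (e.symm ζ) +
      (f.transition f' (e.symm ζ))ᴴ * dirDeriv (fun ζ => f.transition f' (e.symm ζ)) ζ w := fun w => by
    filter_upwards [eventually_symm_mem ((f.isOpen_dom.inter f'.isOpen_dom).inter hW) hz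
      ⟨⟨hf, hf'⟩, hzW⟩] with ζ hζ
    exact A.matrix_change f f' he hζ.1 hζ.2.1.1 hζ.2.1.2 hζ.2.2 w
  exact curv_gauge (a := A.matrix f e 1) (b := A.matrix f e Complex.I) (a' := A.matrix f' e 1)
    (b' := A.matrix f' e Complex.I) (g := fun ζ => f.transition f' (e.symm ζ))
    (A.smoothMatAt_target f hW he hz hf hzW 1) (A.smoothMatAt_target f hW he hz hf hzW Complex.I)
    (f.smoothMatAt_transition_target f' he hz hf hf') (f.eventually_unitary f' e z) (h 1) (h _)

/-- The curvature in two coordinates. -/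
lemma UnitaryConnection.curvature_change_chart (hW : IsOpen W) (he : e ∈ holAtlas X)
    (he' : e' ∈ holAtlas X) (hz : z ∈ e'.target) (hs : e'.symm z ∈ e.source)
    (hf : e'.symm z ∈ f.dom) (hzW : e'.symm z ∈ W) :
    A.curvature f e' z =
      (Complex.normSq (deriv (e ∘ e'.symm) z) : ℂ) • A.curvature f e (e (e'.symm z)) := by
  have ht := e.map_source hs
  have hl := e.left_inv hs
  have h : ∀ w, ∀ᶠ ζ in 𝓝 z, A.matrix f e' w ζ =
      (deriv (e ∘ e'.symm) ζ * w).re • A.matrix f e 1 ((e ∘ e'.symm) ζ) +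
      (deriv (e ∘ e'.symm) ζ * w).im • A.matrix f e Complex.I ((e ∘ e'.symm) ζ) := fun w => by
    filter_upwards [coordChange_eventually e hz hs] with ζ hζ
    rw [A.matrix_change_chart f he he' hζ.1 hζ.2, A.matrix_re_im]
    rfl
  refine curv_chart (h := e ∘ e'.symm) (contDiffAt_coordChange he he' hz hs).analyticAt
    (A.smoothMatAt_target f hW he ht ?_ ?_ 1) (A.smoothMatAt_target f hW he ht ?_ ?_ Complex.I)
    ((h 1).mono fun ζ hζ => by simpa using hζ) (h _) <;>
  simpa [hl]

/-! ### The covariant derivative of a Higgs field -/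

/-- The coefficient of `∇_w Φ` in a frame and a coordinate, for the connection that `A` induces on
`End(E)` and the flat connection of the coordinate on the canonical bundle. -/
def covD (f : UnitaryFrame E) (e : OpenPartialHomeomorph X ℂ) (w z : ℂ) :
    Matrix (Fin 2) (Fin 2) ℂ :=
  dirDeriv (Φ.matrix f e) z w + ⁅A.matrix f e w z, Φ.matrix f e z⁆

lemma covD_re_im (e : OpenPartialHomeomorph X ℂ) (w z : ℂ) :
    covD Φ A f e w z = w.re • covD Φ A f e 1 z + w.im • covD Φ A f e Complex.I z := by
  have h : w = (w.re : ℝ) • (1 : ℂ) + (w.im : ℝ) • Complex.I := by simp [Complex.re_add_im]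
  rw [covD, A.matrix_re_im]
  conv_lhs => enter [1]; rw [h, dirDeriv_add_right, dirDeriv_smul_right, dirDeriv_smul_right]
  simp only [covD, Ring.lie_def, add_mul, mul_add, smul_add, smul_sub, smul_mul_assoc, mul_smul_comm]
  abel

lemma covD_change_frame (hW : IsOpen W) (he : e ∈ holAtlas X) (hz : z ∈ e.target)
    (hf : e.symm z ∈ f.dom) (hf' : e.symm z ∈ f'.dom) (hzW : e.symm z ∈ W) (w : ℂ) :
    covD Φ A f' e w z =
      (f.transition f' (e.symm z))ᴴ * covD Φ A f e w z * f.transition f' (e.symm z) := by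
  rw [covD, A.matrix_change f f' he hz hf hf' hzW, Φ.matrix_change_frame f f' e z,
    dirDeriv_congr (Filter.Eventually.of_forall fun ζ => Φ.matrix_change_frame f f' e ζ)]
  exact covariant_gauge (Φ.smoothMatAt f hW he hz hf hzW)
    (f.smoothMatAt_transition_target f' he hz hf hf') (f.eventually_unitary f' e z) _ w

lemma covD_change_chart (hW : IsOpen W) (he : e ∈ holAtlas X) (he' : e' ∈ holAtlas X)
    (hz : z ∈ e'.target) (hs : e'.symm z ∈ e.source) (hf : e'.symm z ∈ f.dom)
    (hzW : e'.symm z ∈ W) (w : ℂ) :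
    covD Φ A f e' w z =
      (deriv (deriv (e ∘ e'.symm)) z * w) • Φ.matrix f e (e (e'.symm z)) +
      deriv (e ∘ e'.symm) z • covD Φ A f e (deriv (e ∘ e'.symm) z * w) (e (e'.symm z)) := by
  rw [covD, A.matrix_change_chart f he he' hz hs]
  refine covariant_chart (h := e ∘ e'.symm) (contDiffAt_coordChange he he' hz hs).analyticAt
    (Φ.smoothMatAt f hW he (e.map_source hs) ?_ ?_) ?_ _ w
  · simpa [e.left_inv hs]
  · simpa [e.left_inv hs]
  · filter_upwards [coordChange_eventually e hz hs] with ζ hζ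
    exact Φ.matrix_change_chart f he he' hζ.1 hζ.2

/-! ### Gluing local expressions -/

/-- Local expressions with the transformation laws of an `End(E)`-valued one-form define one. -/
lemma exists_form_of_local (G : UnitaryFrame E → OpenPartialHomeomorph X ℂ → ℂ → ℂ → Matrix (Fin 2) (Fin 2) ℂ)
    (hlin : ∀ f e w z, G f e w z = w.re • G f e 1 z + w.im • G f e Complex.I z)
    (hframe : ∀ f f' : UnitaryFrame E, ∀ e ∈ holAtlas X, ∀ z ∈ e.target, e.symm z ∈ f.dom →
      e.symm z ∈ f'.dom → e.symm z ∈ W → ∀ w,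
      G f' e w z = (f.transition f' (e.symm z))ᴴ * G f e w z * f.transition f' (e.symm z))
    (hchart : ∀ f : UnitaryFrame E, ∀ e ∈ holAtlas X, ∀ e' ∈ holAtlas X, ∀ z ∈ e'.target,
      e'.symm z ∈ e.source → e'.symm z ∈ f.dom → e'.symm z ∈ W → ∀ w,
      G f e' w z = G f e (deriv (e ∘ e'.symm) z * w) (e (e'.symm z))) :
    ∃ B : ∀ x : X, Tangent x →ₗ[ℝ] E.EndAt x, ∀ f : UnitaryFrame E, ∀ e ∈ holAtlas X,
      ∀ z ∈ e.target, e.symm z ∈ f.dom → e.symm z ∈ W → ∀ w,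
      formCoeff (f.formMatrix B) e w z = G f e w z := by
  choose fr hfr using fun x : X => exists_frame E x
  have hadd : ∀ f e w w' z, G f e (w + w') z = G f e w z + G f e w' z := fun f e w w' z => by
    rw [hlin f e (w + w'), hlin f e w, hlin f e w', Complex.add_re, Complex.add_im]; module
  have hsmul : ∀ f e (r : ℝ) w z, G f e (r • w) z = r • G f e w z := fun f e r w z => by
    rw [hlin f e (r • w), hlin f e w, Complex.smul_re, Complex.smul_im]; module
  let coord : ∀ x : X, Tangent x → ℂ := fun x v =>
    vecCoord v / vecCoord (push (chartAt ℂ x) (chartAt ℂ x x) 1)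
  have hc1 : ∀ x (v w : Tangent x), coord x (v + w) = coord x v + coord x w := fun x v w =>
    add_div (K := ℂ) _ _ _
  have hc2 : ∀ x (r : ℝ) (v : Tangent x), coord x (r • v) = r • coord x v := fun x r v =>
    smul_div_assoc (r : ℝ) (vecCoord v) _
  let B : ∀ x : X, Tangent x →ₗ[ℝ] E.EndAt x := fun x =>
    { toFun := fun v => (fr x).toEnd x (G (fr x) (chartAt ℂ x) (coord x v) (chartAt ℂ x x))
      map_add' := fun v w => by rw [hc1, hadd]; exact map_add (Matrix.toLin _ _) _ _
      map_smul' := fun r v => by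
        rw [hc2, hsmul, ← Complex.coe_smul]; exact map_smul (Matrix.toLin _ _) _ _ }
  refine ⟨B, fun f e he z hz hf hW w => ?_⟩
  have hs := mem_chart_source ℂ (e.symm z)
  have he₀ := chartAt_mem_holAtlas (e.symm z)
  have h1 : coord (e.symm z) (push e z w) = deriv (chartAt ℂ (e.symm z) ∘ e.symm) z * w := by
    have h2 : vecCoord (push e z w) = (deriv (chartAt ℂ (e.symm z) ∘ e.symm) z * w) *
        vecCoord (push (chartAt ℂ (e.symm z)) (chartAt ℂ (e.symm z) (e.symm z)) 1) := by
      refine (push_change he₀ he hz hs w).trans ?_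
      rw [push_eq_smul]; rfl
    simp only [coord]
    rw [h2, mul_div_cancel_right₀ _ (vecCoord_push_ne_zero he₀ (mem_chart_target ℂ _))]
  have h3 : (fr (e.symm z)).matrix (e.symm z) (B (e.symm z) (push e z w)) = G (fr (e.symm z)) e w z := by
    change (fr (e.symm z)).matrix (e.symm z) ((fr (e.symm z)).toEnd (e.symm z) _) = _
    rw [UnitaryFrame.matrix_toEnd, h1]
    exact (hchart _ _ he₀ e he z hz hs (hfr _) hW w).symm
  change f.matrix (e.symm z) (B (e.symm z) (push e z w)) = _
  rw [(fr (e.symm z)).matrix_change f, h3, ← hframe _ _ e he z hz (hfr _) hf hW]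

/-! ### Changing a connection by an endomorphism-valued form -/

/-- The connection `A + B` over `W'`, where `B` is a skew-hermitian `End(E)`-valued one-form. -/
def UnitaryConnection.add {W' : Set X} (hWW : W' ⊆ W)
    (B : ∀ x : X, Tangent x →ₗ[ℝ] E.EndAt x)
    (hskew : ∀ x ∈ W', ∀ v, LinearMap.adjoint (B x v) = - B x v)
    (hB : ∀ x ∈ W', SmoothFormAt B x) : UnitaryConnection E W' where
  form f x := A.form f x + f.formMatrix B x
  skew f x hx v := by
    have h := f.matrix_adjoint x (B x v)
    rw [hskew x hx.2 v] at h
    change (A.form f x v + f.matrix x (B x v))ᴴ = -(A.form f x v + f.matrix x (B x v))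
    rw [Matrix.conjTranspose_add, A.skew f x ⟨hx.1, hWW hx.2⟩, ← h, neg_add]
    congr 1
    exact map_neg (LinearMap.toMatrix _ _) _
  smooth f e he w a b z hz := by
    have h1 := (A.smooth f e he w a b).mono (t := e.target ∩ e.symm ⁻¹' (f.dom ∩ W'))
      (fun y hy => ⟨hy.1, hy.2.1, hWW hy.2.2⟩) z hz
    have h2 := hB _ hz.2.2 f hz.2.1 e (atlas_subset_holAtlas he) (e.map_target hz.1) w a b
    rw [e.right_inv hz.1] at h2
    exact h1.add h2.contDiffWithinAt
  change_frame f f' e he z hz w := by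
    change A.form f' _ _ + f'.matrix _ (B _ _) = _ * (A.form f _ _ + f.matrix _ (B _ _)) * _ + _
    rw [A.change_frame f f' e he z ⟨hz.1, hz.2.1, hWW hz.2.2⟩ w, f.matrix_change f']
    simp only [mul_add, add_mul]
    abel

end Local

/-! ### Trace-free and normal two by two matrices -/

section MatrixAlgebra

variable {M N : Matrix (Fin 2) (Fin 2) ℂ}

lemma anticommutator_of_trace_eq_zero (hM : M.trace = 0) (hN : N.trace = 0) :
    M * N + N * M = (M * N).trace • (1 : Matrix (Fin 2) (Fin 2) ℂ) := by
  rw [Matrix.trace_fin_two] at hM hN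
  have hM' : M 1 1 = - M 0 0 := by linear_combination hM
  have hN' : N 1 1 = - N 0 0 := by linear_combination hN
  ext i j
  fin_cases i <;> fin_cases j <;>
    simp [Matrix.mul_apply, Fin.sum_univ_two, Matrix.trace_fin_two, hM', hN'] <;> ring

lemma trace_traceFree (M : Matrix (Fin 2) (Fin 2) ℂ) : (traceFree M).trace = 0 := by
  simp [traceFree, Matrix.trace_sub, Matrix.trace_smul]

lemma traceFree_add (M N : Matrix (Fin 2) (Fin 2) ℂ) :
    traceFree (M + N) = traceFree M + traceFree N := by
  simp only [traceFree, Matrix.trace_add]; module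

lemma traceFree_sub (M N : Matrix (Fin 2) (Fin 2) ℂ) :
    traceFree (M - N) = traceFree M - traceFree N := by
  simp only [traceFree, Matrix.trace_sub]; module

lemma traceFree_smul (c : ℂ) (M : Matrix (Fin 2) (Fin 2) ℂ) :
    traceFree (c • M) = c • traceFree M := by
  simp only [traceFree, Matrix.trace_smul, smul_eq_mul]; module

lemma traceFree_smul_one (c : ℂ) : traceFree (c • (1 : Matrix (Fin 2) (Fin 2) ℂ)) = 0 := by
  simp [traceFree, Matrix.trace_smul]

lemma traceFree_of_trace_eq_zero (h : M.trace = 0) : traceFree M = M := by simp [traceFree, h]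

lemma traceFree_conjTranspose (M : Matrix (Fin 2) (Fin 2) ℂ) : (traceFree M)ᴴ = traceFree Mᴴ := by
  simp [traceFree, Matrix.conjTranspose_sub, Matrix.trace_conjTranspose, Matrix.conjTranspose_smul]

lemma traceFree_conj {g : Matrix (Fin 2) (Fin 2) ℂ} (hg : gᴴ * g = 1)
    (M : Matrix (Fin 2) (Fin 2) ℂ) : traceFree (gᴴ * M * g) = gᴴ * traceFree M * g := by
  have h : (gᴴ * M * g).trace = M.trace := by
    rw [mul_assoc, Matrix.trace_mul_comm, mul_assoc, mul_eq_one_comm.1 hg, mul_one]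
  rw [traceFree, traceFree, h, mul_sub, sub_mul, mul_smul_comm, smul_mul_assoc, mul_one, hg]

/-- The commutant of a trace-free invertible matrix is spanned by the identity and the matrix. -/
lemma traceFree_eq_of_commute (hM : M.trace = 0) (hd : M.det ≠ 0) (h : ⁅N, M⁆ = 0) :
    traceFree N = ((N * M).trace / (2 * -M.det)) • M := by
  have h1 : ⁅traceFree N, M⁆ = 0 := by
    rw [Ring.lie_def] at h ⊢
    rw [traceFree, sub_mul, mul_sub, smul_mul_assoc, mul_smul_comm, one_mul, mul_one, sub_sub_sub_cancel_right, h]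
  have h2 := anticommutator_of_trace_eq_zero (trace_traceFree N) hM
  rw [Ring.lie_def, sub_eq_zero] at h1
  have h3 : (traceFree N * M).trace = (N * M).trace := by
    rw [traceFree, sub_mul, smul_mul_assoc, one_mul, Matrix.trace_sub, Matrix.trace_smul, hM]
    simp
  rw [← h1, h3] at h2
  have h4 := congrArg (· * M) h2
  simp only [add_mul, mul_assoc, mul_self_of_trace_eq_zero hM, mul_smul_comm, mul_one, smul_mul_assoc, one_mul] at h4
  have h5 : (2 * -M.det) • traceFree N = (N * M).trace • M := by rw [← h4]; module
  rw [div_eq_inv_mul, ← smul_smul, ← h5, smul_smul, inv_mul_cancel₀ (by simpa using hd), one_smul]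

/-- A normal trace-free matrix is proportional to its adjoint. -/
lemma conjTranspose_eq_of_normal (hM : M.trace = 0) (hd : M.det ≠ 0) (h : ⁅M, Mᴴ⁆ = 0) :
    Mᴴ = ((Mᴴ * M).trace / (2 * -M.det)) • M := by
  have h1 : (Mᴴ).trace = 0 := by rw [Matrix.trace_conjTranspose, hM, star_zero]
  rw [← traceFree_eq_of_commute hM hd, traceFree_of_trace_eq_zero h1]
  rw [Ring.lie_def] at h ⊢
  rw [← neg_sub, h, neg_zero]

lemma conj_det_of_conjTranspose_eq {t : ℂ} (h : Mᴴ = t • M) :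
    starRingEnd ℂ M.det = t ^ 2 * M.det := by
  have := congrArg Matrix.det h
  rw [Matrix.det_conjTranspose, Matrix.det_smul] at this
  simpa using this

/-- A normal trace-free matrix with eigenvalues `± l` has real multiples of `l⁻¹` as the factors
that make it hermitian. -/
lemma isHermitian_smul_of_normal (hM : M.trace = 0) (hd : M.det ≠ 0) (h : ⁅M, Mᴴ⁆ = 0) {l c : ℂ}
    (hl : l ^ 2 = -M.det) (hc : (c * l).im = 0) : (c • M)ᴴ = c • M := by
  have h1 := conjTranspose_eq_of_normal hM hd h
  have h2 := conj_det_of_conjTranspose_eq h1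
  have hl0 : l ≠ 0 := by rintro rfl; exact hd (by simpa using hl.symm)
  set r : ℝ := (Complex.normSq (M 0 0) + Complex.normSq (M 0 1) + Complex.normSq (M 1 0) +
    Complex.normSq (M 1 1)) / 2
  have hr : (Mᴴ * M).trace = 2 * (r : ℂ) := by
    simp only [r, Matrix.trace_fin_two, Matrix.mul_apply, Fin.sum_univ_two, Matrix.conjTranspose_apply]
    push_cast
    simp only [Complex.normSq_eq_conj_mul_self, Complex.star_def]
    ring
  have hr0 : 0 ≤ r := by
    have := Complex.normSq_nonneg
    simp only [r]
    linarith [this (M 0 0), this (M 0 1), this (M 1 0), this (M 1 1)]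
  have hdl : M.det = - l ^ 2 := by rw [hl]; ring
  have h3 : r = Complex.normSq l := by
    rw [hr, hdl] at h2
    have h4 : (r : ℂ) ^ 2 = (Complex.normSq l : ℂ) ^ 2 := by
      rw [Complex.normSq_eq_conj_mul_self]
      simp only [map_neg, map_pow] at h2
      field_simp at h2
      linear_combination h2
    have h5 : r ^ 2 = Complex.normSq l ^ 2 := by exact_mod_cast h4
    exact (sq_eq_sq₀ hr0 (Complex.normSq_nonneg _)).1 h5
  have h6 : starRingEnd ℂ (c * l) = c * l := Complex.conj_eq_iff_im.2 hc
  rw [Matrix.conjTranspose_smul, h1, smul_smul, hr, h3, ← hl, Complex.normSq_eq_conj_mul_self]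
  congr 1
  rw [map_mul] at h6
  rw [Complex.star_def]
  field_simp
  linear_combination h6

/-- Adding `traceFree (M N) / (2 λ²)` to a connection makes the derivative `N` of `M` a multiple
of `M`. -/
lemma balance_identity (hM : M.trace = 0) (hd : M.det ≠ 0) (hN : N.trace = 0) :
    N + ⁅(1 / (2 * -M.det)) • traceFree (M * N), M⁆ = ((M * N).trace / (2 * -M.det)) • M := by
  have h1 := anticommutator_of_trace_eq_zero hM hN
  have h2 := mul_self_of_trace_eq_zero hM
  have h3 : M * N * M = (M * N).trace • M - (-M.det) • N := by
    have := congrArg (· * M) h1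
    simp only [add_mul, smul_mul_assoc, one_mul] at this
    rw [mul_assoc N, h2, mul_smul_comm, mul_one] at this
    exact eq_sub_of_add_eq this
  have h4 : M * (M * N) = (-M.det) • N := by rw [← mul_assoc, h2, smul_mul_assoc, one_mul]
  rw [Ring.lie_def, traceFree, smul_mul_assoc, mul_smul_comm, ← smul_sub, sub_mul, mul_sub, h3, h4]
  simp only [smul_mul_assoc, mul_smul_comm, one_mul, mul_one]
  ext i j
  simp only [Matrix.add_apply, Matrix.sub_apply, Matrix.smul_apply, smul_eq_mul]
  field_simp
  ring

end MatrixAlgebra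

/-! ### The connection for which a normal Higgs field is parallel up to scale -/

section Balanced

/-- The form that balances a normal Higgs field is skew-hermitian. -/
lemma balance_skew {φ : ℂ → Matrix (Fin 2) (Fin 2) ℂ} {z : ℂ} {a : Matrix (Fin 2) (Fin 2) ℂ}
    (hφ : SmoothMatAt φ z) (ha : aᴴ = -a)
    (h : ∀ᶠ ζ in 𝓝 z, (φ ζ).trace = 0 ∧ (φ ζ).det ≠ 0 ∧ ⁅φ ζ, (φ ζ)ᴴ⁆ = 0) (w : ℂ) :
    ((1 / (2 * -(φ z).det)) • traceFree (φ z * (dirDeriv φ z w + ⁅a, φ z⁆)))ᴴ =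
      -((1 / (2 * -(φ z).det)) • traceFree (φ z * (dirDeriv φ z w + ⁅a, φ z⁆))) := by
  obtain ⟨h1, h2, h3⟩ := h.self_of_nhds
  set ψ := dirDeriv φ z w + ⁅a, φ z⁆ with hψ
  set t : ℂ → ℂ := fun ζ => ((φ ζ)ᴴ * φ ζ).trace / (2 * -(φ ζ).det) with ht
  have hdet : ContDiffAt ℝ ∞ (fun ζ => (φ ζ).det) z := by
    simp only [Matrix.det_fin_two]
    exact ((hφ 0 0).mul (hφ 1 1)).sub ((hφ 0 1).mul (hφ 1 0))
  have hts : ContDiffAt ℝ ∞ t z :=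
    contDiffAt_div (hφ.conjTranspose.mul hφ).trace (contDiffAt_const.mul hdet.neg) (by simpa using h2)
  have hte : ∀ᶠ ζ in 𝓝 z, (φ ζ)ᴴ = t ζ • φ ζ := by
    filter_upwards [h] with ζ hζ using conjTranspose_eq_of_normal hζ.1 hζ.2.1 hζ.2.2
  have htz := hte.self_of_nhds
  have hd := dirDeriv_congr hte w
  rw [dirDeriv_conjTranspose hφ, dirDeriv_smul hts hφ] at hd
  have htr : ψ.trace = 0 := by
    rw [hψ, Matrix.trace_add, trace_dirDeriv hφ, Ring.lie_def, Matrix.trace_sub,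
      Matrix.trace_mul_comm a, sub_self, add_zero]
    rw [Filter.EventuallyEq.fderiv_eq (f := fun _ => (0 : ℂ)) (h.mono fun ζ hζ => hζ.1)]
    simp
  have hψH : ψᴴ = fderiv ℝ t z w • φ z + t z • ψ := by
    rw [hψ, Matrix.conjTranspose_add, hd, Ring.lie_def, Matrix.conjTranspose_sub,
      Matrix.conjTranspose_mul, Matrix.conjTranspose_mul, ha, htz]
    simp only [smul_mul_assoc, mul_smul_comm, neg_mul, mul_neg]
    module
  have hac := anticommutator_of_trace_eq_zero h1 htr
  have e1 : traceFree (ψ * φ z) = - traceFree (φ z * ψ) := by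
    rw [← add_eq_zero_iff_eq_neg, ← traceFree_add, add_comm, hac, traceFree_smul_one]
  have hc := conj_det_of_conjTranspose_eq htz
  have ht0 : t z ≠ 0 := by
    intro h0
    rw [h0] at hc
    simp [h2] at hc
  rw [Matrix.conjTranspose_smul, traceFree_conjTranspose, Matrix.conjTranspose_mul, htz, hψH,
    mul_smul_comm, add_mul, smul_mul_assoc, smul_mul_assoc, mul_self_of_trace_eq_zero h1, smul_add,
    traceFree_add, smul_smul, smul_smul, traceFree_smul_one, zero_add, smul_smul, traceFree_smul, e1,
    smul_smul, smul_neg, ← neg_smul, ← neg_smul]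
  congr 1
  rw [Complex.star_def, map_div₀, map_mul, map_neg, hc]
  simp only [map_one, map_ofNat]
  field_simp

variable {X : Type u} [TopologicalSpace X] [ChartedSpace ℂ X] [IsManifold 𝓘(ℂ) ω X]
  {E : HermitianBundle.{u, v} X} {e e' : OpenPartialHomeomorph X ℂ} {W : Set X}

/-- A property of tangent vectors at `x` may be checked on coordinate vectors. -/
lemma forall_tangent_of_coord (P : ∀ x : X, Tangent x → Prop) (he : e ∈ holAtlas X) {x : X}
    (hx : x ∈ e.source) (h : ∀ w, P (e.symm (e x)) (push e (e x) w)) (v : Tangent x) : P x v := by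
  have h1 := h (vecCoord v / vecCoord (push e (e x) 1))
  rwa [eval_congr P (e.left_inv hx) (w := v)] at h1
  rw [push_eq_smul]
  exact div_mul_cancel₀ (vecCoord v) (vecCoord_push_ne_zero he (e.map_source hx))

lemma HiggsField.IsNormal.lie_eq_zero {Φ : HiggsField E W} (h : Φ.IsNormal) (f : UnitaryFrame E)
    {z : ℂ} (hz : e.symm z ∈ W) : ⁅Φ.matrix f e z, (Φ.matrix f e z)ᴴ⁆ = 0 := by
  have h1 := h _ hz (push e z 1) (Complex.I • push e z 1)
  have h2 : Φ.wedgeAdjoint (e.symm z) (push e z 1) (Complex.I • push e z 1) =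
      (-2 * Complex.I) • ⁅Φ.toFun (e.symm z) (push e z 1),
        LinearMap.adjoint (Φ.toFun (e.symm z) (push e z 1))⁆ := by
    rw [HiggsField.wedgeAdjoint, map_smul, map_smulₛₗ]
    simp only [Ring.lie_def, mul_smul_comm, smul_mul_assoc, Complex.conj_I]
    module
  rw [h2, smul_eq_zero] at h1
  have h3 := h1.resolve_left (by simp)
  have h4 := congrArg (f.matrix (e.symm z)) h3
  rwa [f.matrix_lie, f.matrix_adjoint, f.matrix_zero] at h4

/-- A connection over a subset. -/
def UnitaryConnection.restrict (A : UnitaryConnection E Set.univ) (W : Set X) :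
    UnitaryConnection E W where
  form := A.form
  skew f x hx := A.skew f x ⟨hx.1, trivial⟩
  smooth f e he w a b := (A.smooth f e he w a b).mono fun _ hy => ⟨hy.1, hy.2.1, trivial⟩
  change_frame f f' e he z hz := A.change_frame f f' e he z ⟨hz.1, hz.2.1, trivial⟩

variable {q : QuadraticDifferential X}

lemma trace_covD (hW : IsOpen W) (Φ : HiggsField E W) (A : UnitaryConnection E W) (f : UnitaryFrame E)
    (he : e ∈ holAtlas X) {z : ℂ} (hz : z ∈ e.target) (hf : e.symm z ∈ f.dom)
    (hzW : e.symm z ∈ W) (w : ℂ) : (covD Φ A f e w z).trace = 0 := by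
  rw [covD, Matrix.trace_add, trace_dirDeriv (Φ.smoothMatAt f hW he hz hf hzW), Ring.lie_def,
    Matrix.trace_sub, Matrix.trace_mul_comm (A.matrix f e w z), sub_self, add_zero]
  have h : (fun ζ => (Φ.matrix f e ζ).trace) =ᶠ[𝓝 z] fun _ => (0 : ℂ) := by
    filter_upwards [eventually_symm_mem hW hz hzW] with ζ hζ using Φ.trace_matrix f hζ.2
  rw [h.fderiv_eq]
  simp

lemma trace_mul_covD (hq : q.IsHolomorphic) (hW : IsOpen W) {Φ : HiggsField E W} (hdet : Φ.HasDet q)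
    (A : UnitaryConnection E W) (f : UnitaryFrame E) (he : e ∈ holAtlas X) {z : ℂ} (hz : z ∈ e.target)
    (hf : e.symm z ∈ f.dom) (hzW : e.symm z ∈ W) (w : ℂ) :
    (Φ.matrix f e z * covD Φ A f e w z).trace = - (deriv (q.coeff e) z * w) := by
  have hφ := Φ.smoothMatAt f hW he hz hf hzW
  have h1 : (Φ.matrix f e z * ⁅A.matrix f e w z, Φ.matrix f e z⁆).trace = 0 := by
    rw [Matrix.trace_mul_comm, lie_trace_free_pair]
  have h2 : (fun ζ => (Φ.matrix f e ζ * Φ.matrix f e ζ).trace) =ᶠ[𝓝 z] fun ζ => -2 * q.coeff e ζ := by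
    filter_upwards [eventually_symm_mem hW hz hzW] with ζ hζ
    rw [mul_self_of_trace_eq_zero (Φ.trace_matrix f hζ.2), hdet.det_matrix f hζ.2, Matrix.trace_smul]
    simp; ring
  have h3 := trace_dirDeriv (hφ.mul hφ) w
  have hd := hq.differentiableAt he hz
  rw [h2.fderiv_eq, fderiv_real_of_complex (hd.const_mul (-2)), deriv_const_mul _ hd,
    dirDeriv_mul hφ hφ, Matrix.trace_add, Matrix.trace_mul_comm (dirDeriv _ _ _)] at h3
  rw [covD, mul_add, Matrix.trace_add, h1]
  linear_combination (1 / 2 : ℂ) * h3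

/-- For a normal Higgs field, some connection with the same trace makes it parallel up to the
scale that its determinant forces. -/
lemma exists_balanced_connection (hq : q.IsHolomorphic) {Φ : HiggsField E q.punctured}
    (hdet : Φ.HasDet q) (hn : Φ.IsNormal) (A : UnitaryConnection E q.punctured) :
    ∃ A' : UnitaryConnection E q.punctured,
      (∀ f : UnitaryFrame E, ∀ x ∈ f.dom ∩ q.punctured, ∀ v,
        (A'.form f x v).trace = (A.form f x v).trace) ∧
      ∀ f : UnitaryFrame E, ∀ e ∈ holAtlas X, ∀ z ∈ e.target, e.symm z ∈ f.dom →
        e.symm z ∈ q.punctured → ∀ w,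
        covD Φ A' f e w z = (deriv (q.coeff e) z / (2 * q.coeff e z) * w) • Φ.matrix f e z ∧
        A'.matrix f e w z = A.matrix f e w z +
          (1 / (2 * -q.coeff e z)) • traceFree (Φ.matrix f e z * covD Φ A f e w z) := by
  have hW := hq.isOpen_punctured
  have hglue : ∃ B : ∀ x : X, Tangent x →ₗ[ℝ] E.EndAt x, ∀ f : UnitaryFrame E, ∀ e ∈ holAtlas X,
      ∀ z ∈ e.target, e.symm z ∈ f.dom → e.symm z ∈ q.punctured → ∀ w,
      formCoeff (f.formMatrix B) e w z =
        (1 / (2 * -q.coeff e z)) • traceFree (Φ.matrix f e z * covD Φ A f e w z) := by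
    refine exists_form_of_local (fun f e w z =>
      (1 / (2 * -q.coeff e z)) • traceFree (Φ.matrix f e z * covD Φ A f e w z)) ?_ ?_ ?_
    · intro f e w z
      rw [covD_re_im, mul_add, traceFree_add, ← Complex.coe_smul, ← Complex.coe_smul, mul_smul_comm,
        mul_smul_comm, traceFree_smul, traceFree_smul, ← Complex.coe_smul, ← Complex.coe_smul]
      module
    · intro f f' e he z hz hf hf' hzW w
      have h1 : ∀ m, f.transition f' (e.symm z) * ((f.transition f' (e.symm z))ᴴ * m) = m := fun m => by
        rw [← mul_assoc, f.transition_mul_conjTranspose, one_mul]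
      rw [covD_change_frame Φ A f f' hW he hz hf hf' hzW, Φ.matrix_change_frame f f', mul_smul_comm,
        smul_mul_assoc, ← traceFree_conj (f.transition_conjTranspose_mul f' _)]
      simp only [mul_assoc, h1]
    · intro f e he e' he' z hz hs hf hzW w
      have hl : e.symm (e (e'.symm z)) = e'.symm z := e.left_inv hs
      have hq0 := q.coeff_ne_zero he hs hzW
      have hq0' : q.coeff e' z ≠ 0 := by
        rw [Ne, q.coeff_eq_zero_iff he' hz]; exact hzW
      rw [covD_change_chart Φ A f hW he he' hz hs hf hzW, Φ.matrix_change_chart f he he' hz hs]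
      have hc := q.coeff_change he he' hz hs
      have hd0 : deriv (e ∘ e'.symm) z ≠ 0 := by
        intro h0; rw [h0] at hc; exact hq0' (by rw [hc]; ring)
      rw [mul_add, traceFree_add, smul_mul_assoc, mul_smul_comm,
        mul_self_of_trace_eq_zero (Φ.trace_matrix f (by rwa [hl])), smul_smul, smul_smul,
        traceFree_smul_one, zero_add, smul_mul_assoc, mul_smul_comm, smul_smul, traceFree_smul,
        smul_smul, hc]
      congr 1
      field_simp
  obtain ⟨B, hB⟩ := hglue
  have hmat : ∀ f : UnitaryFrame E, ∀ e ∈ holAtlas X, ∀ z ∈ e.target, e.symm z ∈ f.dom →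
        e.symm z ∈ q.punctured → ∀ w, f.matrix (e.symm z) (B (e.symm z) (push e z w)) =
        (1 / (2 * -q.coeff e z)) • traceFree (Φ.matrix f e z * covD Φ A f e w z) := hB
  have hskew : ∀ x ∈ q.punctured, ∀ v, LinearMap.adjoint (B x v) = - B x v := by
    intro x hx v
    obtain ⟨f, hf⟩ := exists_frame E x
    have he := chartAt_mem_holAtlas x
    have hs := mem_chart_source ℂ x
    set e := chartAt ℂ x
    refine forall_tangent_of_coord (fun x v => LinearMap.adjoint (B x v) = - B x v) he hs (fun w => ?_) v
    have hz := e.map_source hs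
    have hl : e.symm (e x) = x := e.left_inv hs
    have hzf : e.symm (e x) ∈ f.dom := by rwa [hl]
    have hzW : e.symm (e x) ∈ q.punctured := by rwa [hl]
    apply f.matrix_injective
    rw [f.matrix_adjoint, show f.matrix (e.symm (e x)) (-B _ (push e (e x) w)) = -f.matrix _ (B _ _) from
      map_neg (LinearMap.toMatrix _ _) _, hmat f e he _ hz hzf hzW, ← hdet.det_matrix f hzW]
    refine balance_skew (Φ.smoothMatAt f hW he hz hzf hzW) (A.skew f _ ⟨hzf, hzW⟩ _) ?_ w
    filter_upwards [eventually_symm_mem hW hz hzW] with ζ hζ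
    refine ⟨Φ.trace_matrix f hζ.2, ?_, hn.lie_eq_zero f hζ.2⟩
    rw [hdet.det_matrix f hζ.2, Ne, q.coeff_eq_zero_iff he hζ.1]; exact hζ.2
  have hsm : ∀ x ∈ q.punctured, SmoothFormAt B x := by
    intro x hx
    obtain ⟨f, hf⟩ := exists_frame E x
    have he := chartAt_mem_holAtlas x
    have hs := mem_chart_source ℂ x
    refine SmoothFormAt.of_frame f hf he hs fun w => ?_
    set e := chartAt ℂ x
    have hz := e.map_source hs
    have hl : e.symm (e x) = x := e.left_inv hs
    have hzf : e.symm (e x) ∈ f.dom := by rwa [hl]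
    have hzW : e.symm (e x) ∈ q.punctured := by rwa [hl]
    have hφ := Φ.smoothMatAt f hW he hz hzf hzW
    have hcov : SmoothMatAt (covD Φ A f e w) (e x) :=
      (hφ.dirDeriv w).add ((A.smoothMatAt_target f hW he hz hzf hzW w).lie hφ)
    have hc := hq.contDiffAt he hz
    refine (SmoothMatAt.smul (contDiffAt_div (contDiffAt_const (c := (1 : ℂ)))
      ((contDiffAt_const (c := (2 : ℂ))).mul hc.neg) ?_) (hφ.mul hcov).traceFree).congr ?_
    · simpa using q.coeff_ne_zero he hs hx
    · filter_upwards [eventually_symm_mem (f.isOpen_dom.inter hW) hz ⟨hzf, hzW⟩] with ζ hζ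
      exact hB f e he ζ hζ.1 hζ.2.1 hζ.2.2 w
  refine ⟨A.add subset_rfl B hskew hsm, fun f x hx v => ?_, fun f e he z hz hf hzW w => ?_⟩
  · have h1 : (f.matrix x (B x v)).trace = 0 := by
      have he := chartAt_mem_holAtlas x
      have hs := mem_chart_source ℂ x
      set e := chartAt ℂ x
      refine forall_tangent_of_coord (fun x v => (f.matrix x (B x v)).trace = 0) he hs (fun w => ?_) v
      have hl : e.symm (e x) = x := e.left_inv hs
      rw [hmat f e he _ (e.map_source hs) (by rw [hl]; exact hx.1) (by rw [hl]; exact hx.2),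
        Matrix.trace_smul, trace_traceFree, smul_zero]
    change (A.form f x v + f.matrix x (B x v)).trace = _
    rw [Matrix.trace_add, h1, add_zero]
  · have h1 : (A.add subset_rfl B hskew hsm).matrix f e w z = A.matrix f e w z +
        (1 / (2 * -q.coeff e z)) • traceFree (Φ.matrix f e z * covD Φ A f e w z) :=
      congrArg (A.matrix f e w z + ·) (hmat f e he z hz hf hzW w)
    refine ⟨?_, h1⟩
    have hq0 : q.coeff e z ≠ 0 := by rw [Ne, q.coeff_eq_zero_iff he hz]; exact hzW
    have hdz := hdet.det_matrix f hzW
    have h2 := balance_identity (Φ.trace_matrix f hzW) (by rwa [hdz])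
      (trace_covD hW Φ A f he hz hf hzW w)
    rw [hdz, trace_mul_covD hq hW hdet A f he hz hf hzW] at h2
    rw [covD, h1]
    rw [covD, ← covD] at h2
    have h3 : deriv (q.coeff e) z / (2 * q.coeff e z) * w = -(deriv (q.coeff e) z * w) / (2 * -q.coeff e z) := by
      field_simp
    rw [h3, ← h2, Ring.lie_def, Ring.lie_def, add_mul, mul_add, covD, Ring.lie_def]
    abel

end Balanced

/-! ### Projective flatness -/

section PlanarFlat

variable {a b φ : ℂ → Matrix (Fin 2) (Fin 2) ℂ} {z : ℂ}

lemma curv_skew (ha : SmoothMatAt a z) (hb : SmoothMatAt b z) (ha' : ∀ᶠ ζ in 𝓝 z, (a ζ)ᴴ = - a ζ)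
    (hb' : ∀ᶠ ζ in 𝓝 z, (b ζ)ᴴ = - b ζ) : (curv a b z)ᴴ = - curv a b z := by
  have key : ∀ {M : ℂ → Matrix (Fin 2) (Fin 2) ℂ}, SmoothMatAt M z → (∀ᶠ ζ in 𝓝 z, (M ζ)ᴴ = - M ζ) →
      ∀ w, (dirDeriv M z w)ᴴ = - dirDeriv M z w := fun {M} hM h w => by
    have h2 : (fun ζ => (M ζ)ᴴ) =ᶠ[𝓝 z] fun ζ => (-1 : ℂ) • M ζ := h.mono fun ζ hζ => by simp [hζ]
    rw [← dirDeriv_conjTranspose hM, dirDeriv_congr h2, dirDeriv_const_smul _ hM]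
    simp
  rw [curv, Matrix.conjTranspose_add, Matrix.conjTranspose_sub, key hb hb', key ha ha', Ring.lie_def,
    Matrix.conjTranspose_sub, Matrix.conjTranspose_mul, Matrix.conjTranspose_mul,
    ha'.self_of_nhds, hb'.self_of_nhds]
  simp only [neg_mul_neg]
  abel

/-- The skew-hermitian matrix of the form `i (u Φ + (u Φ)*)` in the direction `w`. -/
def shift (u : ℂ → ℂ) (φ : ℂ → Matrix (Fin 2) (Fin 2) ℂ) (w ζ : ℂ) : Matrix (Fin 2) (Fin 2) ℂ :=
  Complex.I • ((u ζ * w) • φ ζ + ((u ζ * w) • φ ζ)ᴴ)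

lemma SmoothMatAt.shift {u : ℂ → ℂ} (hu : ContDiffAt ℝ ∞ u z) (hφ : SmoothMatAt φ z) (w : ℂ) :
    SmoothMatAt (HiggsSurface.shift u φ w) z := by
  have h := SmoothMatAt.smul (hu.mul (contDiffAt_const (c := w))) hφ
  exact (h.add h.conjTranspose).const_smul _

lemma dirDeriv_shift {u : ℂ → ℂ} (hu : ContDiffAt ℝ ∞ u z) (hφ : SmoothMatAt φ z) (w v : ℂ) :
    dirDeriv (shift u φ w) z v = Complex.I • (((fderiv ℝ u z v * w) • φ z + (u z * w) • dirDeriv φ z v) +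
      ((fderiv ℝ u z v * w) • φ z + (u z * w) • dirDeriv φ z v)ᴴ) := by
  have hc := hu.mul (contDiffAt_const (c := w))
  have h := SmoothMatAt.smul hc hφ
  have h2 : fderiv ℝ (fun ζ => u ζ * w) z v = fderiv ℝ u z v * w := by
    rw [fderiv_mul_const (differentiableAt_of_smooth hu)]
    simp [mul_comm]
  change dirDeriv (fun ζ => Complex.I • ((u ζ * w) • φ ζ + ((u ζ * w) • φ ζ)ᴴ)) z v = _
  rw [dirDeriv_const_smul _ (h.add h.conjTranspose), dirDeriv_add h h.conjTranspose,
    dirDeriv_conjTranspose h, dirDeriv_smul hc hφ, h2]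

/-- If `φ` is normal and holomorphic for the connection `a dx + b dy`, adding the form
`i (u φ dz + (u φ dz)*)` changes the curvature by the skew-hermitian part of `∂u/∂z̄ φ`. -/
lemma curv_add_shift {u : ℂ → ℂ} (hu : ContDiffAt ℝ ∞ u z) (ha : SmoothMatAt a z)
    (hb : SmoothMatAt b z) (hφ : SmoothMatAt φ z) (has : (a z)ᴴ = - a z) (hbs : (b z)ᴴ = - b z)
    (hn : ⁅φ z, (φ z)ᴴ⁆ = 0) {m : ℂ} (h1 : dirDeriv φ z 1 + ⁅a z, φ z⁆ = m • φ z)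
    (h2 : dirDeriv φ z Complex.I + ⁅b z, φ z⁆ = (m * Complex.I) • φ z) :
    curv (fun ζ => a ζ + shift u φ 1 ζ) (fun ζ => b ζ + shift u φ Complex.I ζ) z =
      curv a b z - (2 : ℂ) • (wirt u z • φ z - (wirt u z • φ z)ᴴ) := by
  have e1 := eq_sub_of_add_eq h1
  have e2 := eq_sub_of_add_eq h2
  rw [Ring.lie_def, sub_eq_zero] at hn
  rw [curv, curv, dirDeriv_add hb (hφ.shift hu _), dirDeriv_add ha (hφ.shift hu _),
    dirDeriv_shift hu hφ, dirDeriv_shift hu hφ, e1, e2, wirt, shift, shift]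
  generalize fderiv ℝ u z 1 = ux
  generalize fderiv ℝ u z Complex.I = uy
  generalize dirDeriv b z 1 = db
  generalize dirDeriv a z Complex.I = da
  generalize u z = c at *
  generalize a z = a at *
  generalize b z = b at *
  generalize φ z = φ at *
  simp only [Ring.lie_def, Matrix.conjTranspose_add, Matrix.conjTranspose_smul,
    Matrix.conjTranspose_sub, Matrix.conjTranspose_mul, has, hbs, Complex.star_def, map_mul, map_add,
    Complex.conj_I, map_one, map_div₀, map_ofNat, smul_add, smul_sub, smul_smul, mul_add, add_mul,
    smul_mul_assoc, mul_smul_comm, mul_neg, neg_mul, ← hn]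
  match_scalars <;> ring_nf <;> simp only [Complex.I_sq] <;> ring

end PlanarFlat

section Flat

variable {X : Type u} [TopologicalSpace X] [ChartedSpace ℂ X] [IsManifold 𝓘(ℂ) ω X]
  {E : HermitianBundle.{u, v} X} {e e' : OpenPartialHomeomorph X ℂ}
  {q : QuadraticDifferential X} {Φ : HiggsField E q.punctured}
  {A : UnitaryConnection E q.punctured}

/-- The Higgs field is parallel up to the scale that its determinant forces. -/
def IsBalanced (Φ : HiggsField E q.punctured) (A : UnitaryConnection E q.punctured) : Prop :=
  ∀ f : UnitaryFrame E, ∀ e ∈ holAtlas X, ∀ z ∈ e.target, e.symm z ∈ f.dom →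
    e.symm z ∈ q.punctured → ∀ w,
    covD Φ A f e w z = (deriv (q.coeff e) z / (2 * q.coeff e z) * w) • Φ.matrix f e z

/-- The coefficient of the (0,1)-form `κ` with `F^⊥ = 4 κ Φ`. -/
def curvCoeff (Φ : HiggsField E q.punctured) (A : UnitaryConnection E q.punctured)
    (f : UnitaryFrame E) (e : OpenPartialHomeomorph X ℂ) (z : ℂ) : ℂ :=
  (A.curvature f e z * Φ.matrix f e z).trace / (8 * -q.coeff e z)

lemma coeff_ne_zero_target (he : e ∈ holAtlas X) {z : ℂ} (hz : z ∈ e.target)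
    (h : e.symm z ∈ q.punctured) : q.coeff e z ≠ 0 := by
  rw [Ne, q.coeff_eq_zero_iff he hz]; exact h

lemma contDiffAt_logDeriv (hq : q.IsHolomorphic) (he : e ∈ holAtlas X) {z : ℂ} (hz : z ∈ e.target)
    (h : e.symm z ∈ q.punctured) :
    ContDiffAt ℝ ∞ (fun ζ => deriv (q.coeff e) ζ / (2 * q.coeff e ζ)) z := by
  refine contDiffAt_div ?_ (contDiffAt_const.mul (hq.contDiffAt he hz))
    (by simpa using coeff_ne_zero_target he hz h)
  exact ((hq.analyticAt he hz).deriv.contDiffAt.restrict_scalars ℝ).of_le (n := ω) le_top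

/-- The trace-free curvature of a balanced connection is a multiple of the Higgs field. -/
lemma IsBalanced.traceFree_curvature (h : IsBalanced Φ A) (hq : q.IsHolomorphic)
    (hdet : Φ.HasDet q) (f : UnitaryFrame E) (he : e ∈ holAtlas X) {z : ℂ} (hz : z ∈ e.target)
    (hf : e.symm z ∈ f.dom) (hzW : e.symm z ∈ q.punctured) :
    traceFree (A.curvature f e z) = (4 * curvCoeff Φ A f e z) • Φ.matrix f e z := by
  have hW := hq.isOpen_punctured
  have hq0 := coeff_ne_zero_target he hz hzW
  have hm := contDiffAt_logDeriv hq he hz hzW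
  have hd := hdet.det_matrix f hzW
  have hev : ∀ w, ∀ᶠ ζ in 𝓝 z, dirDeriv (Φ.matrix f e) ζ w + ⁅A.matrix f e w ζ, Φ.matrix f e ζ⁆ =
      (deriv (q.coeff e) ζ / (2 * q.coeff e ζ) * w) • Φ.matrix f e ζ := fun w => by
    filter_upwards [eventually_symm_mem (f.isOpen_dom.inter hW) hz ⟨hf, hzW⟩] with ζ hζ
    exact h f e he ζ hζ.1 hζ.2.1 hζ.2.2 w
  have hcomm : ⁅A.curvature f e z, Φ.matrix f e z⁆ = 0 :=
    curv_commutes (a := A.matrix f e 1) (b := A.matrix f e Complex.I)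
      (A.smoothMatAt_target f hW he hz hf hzW 1) (A.smoothMatAt_target f hW he hz hf hzW _)
      (Φ.smoothMatAt f hW he hz hf hzW) (hm.mul contDiffAt_const) (hm.mul contDiffAt_const)
      (hev 1) (hev Complex.I) (Φ.trace_matrix f hzW) (by rwa [hd])
  rw [traceFree_eq_of_commute (Φ.trace_matrix f hzW) (by rwa [hd]) hcomm, hd, curvCoeff]
  congr 1
  field_simp
  ring

lemma contDiffAt_curvCoeff (hq : q.IsHolomorphic) (f : UnitaryFrame E) (he : e ∈ holAtlas X) {z : ℂ}
    (hz : z ∈ e.target) (hf : e.symm z ∈ f.dom) (hzW : e.symm z ∈ q.punctured) :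
    ContDiffAt ℝ ∞ (curvCoeff Φ A f e) z := by
  have hW := hq.isOpen_punctured
  have h1 := A.smoothMatAt_target f hW he hz hf hzW 1
  have h2 := A.smoothMatAt_target f hW he hz hf hzW Complex.I
  have h3 : SmoothMatAt (A.curvature f e) z :=
    ((h2.dirDeriv 1).sub (h1.dirDeriv Complex.I)).add (h1.lie h2)
  refine contDiffAt_div (h3.mul (Φ.smoothMatAt f hW he hz hf hzW)).trace
    (contDiffAt_const.mul (hq.contDiffAt he hz).neg) ?_
  simpa using coeff_ne_zero_target he hz hzW

/-- The (0,1)-form `κ` with `F^⊥ = 4 κ Φ`, if the curvature vanishes near the zeros of `q`. -/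
lemma exists_curvature_form (hq : q.IsHolomorphic) (Φ : HiggsField E q.punctured)
    (A : UnitaryConnection E q.punctured)
    (hvan : ∀ p, q p = 0 → ∃ f : UnitaryFrame E, ∃ e ∈ holAtlas X, p ∈ f.dom ∧ p ∈ e.source ∧
      ∀ᶠ z in 𝓝 (e p), z ≠ e p → curvCoeff Φ A f e z = 0) :
    ∃ κ : AntiForm X, (∃ C, IsClosed C ∧ C ⊆ q.punctured ∧ κ.SupportedIn C) ∧
      ∀ f : UnitaryFrame E, ∀ e ∈ holAtlas X, ∀ z ∈ e.target, e.symm z ∈ f.dom →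
        e.symm z ∈ q.punctured → κ.coeff e z = curvCoeff Φ A f e z := by
  have hW := hq.isOpen_punctured
  have hglue : ∃ B : ∀ x : X, Tangent x →ₗ[ℝ] E.EndAt x, ∀ f : UnitaryFrame E, ∀ e ∈ holAtlas X,
      ∀ z ∈ e.target, e.symm z ∈ f.dom → e.symm z ∈ q.punctured → ∀ w,
      formCoeff (f.formMatrix B) e w z =
        (starRingEnd ℂ w * curvCoeff Φ A f e z) • (1 : Matrix (Fin 2) (Fin 2) ℂ) := by
    refine exists_form_of_local (fun f e w z =>
      (starRingEnd ℂ w * curvCoeff Φ A f e z) • (1 : Matrix (Fin 2) (Fin 2) ℂ)) ?_ ?_ ?_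
    · intro f e w z
      rw [← Complex.coe_smul, ← Complex.coe_smul, smul_smul, smul_smul, ← add_smul]
      congr 1
      have : starRingEnd ℂ w = w.re - w.im * Complex.I := by apply Complex.ext <;> simp
      rw [this, map_one, Complex.conj_I]
      ring
    · intro f f' e he z hz hf hf' hzW w
      have h1 : ∀ m, f.transition f' (e.symm z) * ((f.transition f' (e.symm z))ᴴ * m) = m := fun m => by
        rw [← mul_assoc, f.transition_mul_conjTranspose, one_mul]
      have h2 : curvCoeff Φ A f' e z = curvCoeff Φ A f e z := by
        rw [curvCoeff, curvCoeff, A.curvature_change_frame f f' hW he hz hf hf' hzW,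
          Φ.matrix_change_frame f f']
        congr 1
        simp only [mul_assoc, h1]
        rw [Matrix.trace_mul_comm]
        simp only [mul_assoc]
        rw [f.transition_mul_conjTranspose, mul_one]
      rw [h2, mul_smul_comm, smul_mul_assoc, mul_one, f.transition_conjTranspose_mul]
    · intro f e he e' he' z hz hs hf hzW w
      have hq0 := q.coeff_ne_zero he hs hzW
      have hq0' := coeff_ne_zero_target he' hz hzW
      have hc := q.coeff_change he he' hz hs
      have hd0 : deriv (e ∘ e'.symm) z ≠ 0 := by
        intro h0; rw [h0] at hc; exact hq0' (by rw [hc]; ring)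
      congr 1
      rw [curvCoeff, curvCoeff, A.curvature_change_chart f hW he he' hz hs hf hzW,
        Φ.matrix_change_chart f he he' hz hs, smul_mul_assoc, mul_smul_comm, smul_smul,
        Matrix.trace_smul, hc, Complex.normSq_eq_conj_mul_self, map_mul, smul_eq_mul]
      field_simp
  obtain ⟨B, hB⟩ := hglue
  have htr : ∀ f : UnitaryFrame E, ∀ e ∈ holAtlas X, ∀ z ∈ e.target, e.symm z ∈ f.dom →
      e.symm z ∈ q.punctured → ∀ w, LinearMap.trace ℂ _ (B (e.symm z) (push e z w)) =
        2 * (starRingEnd ℂ w * curvCoeff Φ A f e z) := by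
    intro f e he z hz hf hzW w
    rw [← f.trace_matrix, show f.matrix _ _ = _ from hB f e he z hz hf hzW w]
    simp [Matrix.trace_smul]; ring
  classical
  let k : ∀ x : X, Tangent x → ℂ := fun x v =>
    if x ∈ q.punctured then LinearMap.trace ℂ _ (B x v) / 2 else 0
  have hk : ∀ f : UnitaryFrame E, ∀ e ∈ holAtlas X, ∀ z ∈ e.target, e.symm z ∈ f.dom →
      e.symm z ∈ q.punctured → ∀ w, k (e.symm z) (push e z w) =
        starRingEnd ℂ w * curvCoeff Φ A f e z := by
    intro f e he z hz hf hzW w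
    simp only [k, if_pos hzW]
    rw [htr f e he z hz hf hzW]; ring
  have hzero : ∀ p, q p = 0 → ∀ᶠ y in 𝓝 p, ∀ v, k y v = 0 := by
    intro p hp
    obtain ⟨f, e, he, hf, hs, h⟩ := hvan p hp
    filter_upwards [(e.continuousAt hs).eventually h, f.isOpen_dom.mem_nhds hf,
      e.open_source.mem_nhds hs] with y h1 h2 h3 v
    by_cases hy : y ∈ q.punctured
    swap
    · simp only [k, if_neg hy]
    refine forall_tangent_of_coord (fun x v => k x v = 0) he h3 (fun w => ?_) v
    have hl := e.left_inv h3
    have hne : e y ≠ e p := fun h4 => hy (by rw [e.injOn h3 hs h4]; exact hp)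
    rw [hk f e he _ (e.map_source h3) (by rwa [hl]) (by rwa [hl]), h1 hne, mul_zero]
  let κ : AntiForm X :=
    { toFun := k
      map_smul := fun x c v => by
        by_cases hx : x ∈ q.punctured
        swap
        · simp only [k, if_neg hx, mul_zero]
        obtain ⟨f, hf⟩ := exists_frame E x
        have he := chartAt_mem_holAtlas x
        have hs := mem_chart_source ℂ x
        set e := chartAt ℂ x
        have hl : e.symm (e x) = x := e.left_inv hs
        refine forall_tangent_of_coord (fun x v => k x (c • v) = starRingEnd ℂ c * k x v) he hs
          (fun w => ?_) v
        rw [← push_smul, hk f e he _ (e.map_source hs) (by rwa [hl]) (by rwa [hl]),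
          hk f e he _ (e.map_source hs) (by rwa [hl]) (by rwa [hl]), map_mul, mul_assoc]
      smooth := fun e he z hz => by
        by_cases hx : e.symm z ∈ q.punctured
        · obtain ⟨f, hf⟩ := exists_frame E (e.symm z)
          refine (contDiffAt_curvCoeff (Φ := Φ) (A := A) hq f he hz hf hx).congr_of_eventuallyEq ?_
          filter_upwards [eventually_symm_mem (f.isOpen_dom.inter hW) hz ⟨hf, hx⟩] with ζ hζ
          rw [hk f e he ζ hζ.1 hζ.2.1 hζ.2.2, map_one, one_mul]
        · refine (contDiffAt_const (c := (0 : ℂ))).congr_of_eventuallyEq ?_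
          have hp : q (e.symm z) = 0 := not_not.1 hx
          filter_upwards [(e.continuousAt_symm hz).eventually (hzero _ hp)] with ζ hζ using hζ _ }
  refine ⟨κ, ⟨(interior {x | ∀ v, k x v = 0})ᶜ, isOpen_interior.isClosed_compl, ?_, ?_⟩, ?_⟩
  · intro x hx h0
    exact hx (mem_interior_iff_mem_nhds.2 (hzero x h0))
  · intro x hx v
    exact interior_subset (not_not.1 hx) v
  · intro f e he z hz hf hzW
    have := hk f e he z hz hf hzW 1
    rwa [map_one, one_mul] at this

/-- A balanced connection whose curvature vanishes near the zeros of `q` can be made projectively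
flat by a form that takes values in the skew-hermitian part of the centralizer of the Higgs field. -/
lemma IsBalanced.exists_flat [T2Space X] [CompactSpace X] [ConnectedSpace X] (h : IsBalanced Φ A)
    (hX : 2 ≤ genus X) (hq : q.IsHolomorphic) (hs : q.HasSimpleZeros) (hdet : Φ.HasDet q)
    (hn : Φ.IsNormal)
    (hvan : ∀ p, q p = 0 → ∃ f : UnitaryFrame E, ∃ e ∈ holAtlas X, p ∈ f.dom ∧ p ∈ e.source ∧
      ∀ᶠ z in 𝓝 (e p), z ≠ e p → curvCoeff Φ A f e z = 0) :
    ∃ A' : UnitaryConnection E q.punctured, IsBalanced Φ A' ∧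
      (∀ f : UnitaryFrame E, ∀ x ∈ f.dom ∩ q.punctured, ∀ v,
        (A'.form f x v).trace = (A.form f x v).trace) ∧
      (∀ f : UnitaryFrame E, ∀ e ∈ holAtlas X, ∀ z ∈ e.target, e.symm z ∈ f.dom →
        e.symm z ∈ q.punctured → traceFree (A'.curvature f e z) = 0) ∧
      ∀ p, q p = 0 → ∀ᶠ x in 𝓝 p, ∀ (f : UnitaryFrame E) v, A'.form f x v = A.form f x v := by
  have hW := hq.isOpen_punctured
  obtain ⟨κ, ⟨C, hC, hCq, hκC⟩, hκ⟩ := exists_curvature_form hq Φ A hvan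
  obtain ⟨u, hu, hu0, hsol⟩ := solvable_of_supported hq (exists_zero_of_two_le_genus hX hq)
    (fun p hp => exists_normal_coord hq hs hp) κ hC hCq hκC
  let B : ∀ x : X, Tangent x →ₗ[ℝ] E.EndAt x := fun x =>
    { toFun := fun v => Complex.I • (u x • Φ.toFun x v + LinearMap.adjoint (u x • Φ.toFun x v))
      map_add' := fun v w => by simp only [map_add, smul_add]; abel
      map_smul' := fun r v => by
        rw [← Complex.coe_smul, map_smul, RingHom.id_apply, smul_comm (u x), map_smulₛₗ,
          Complex.conj_ofReal, ← smul_add, smul_comm, Complex.coe_smul] }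
  have hBm : ∀ (f : UnitaryFrame E) (e : OpenPartialHomeomorph X ℂ) (w z : ℂ),
      formCoeff (f.formMatrix B) e w z = shift (fun ζ => u (e.symm ζ)) (Φ.matrix f e) w z := by
    intro f e w z
    change f.matrix _ (Complex.I • (u _ • Φ.toFun _ (push e z w) +
      LinearMap.adjoint (u _ • Φ.toFun _ (push e z w)))) = _
    rw [f.matrix_smul, f.matrix_add, f.matrix_adjoint, f.matrix_smul, push_eq_smul, map_smul,
      f.matrix_smul, smul_smul]
    rfl
  have hskew : ∀ x ∈ q.punctured, ∀ v, LinearMap.adjoint (B x v) = - B x v := by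
    intro x _ v
    change LinearMap.adjoint (Complex.I • (u x • Φ.toFun x v + LinearMap.adjoint (u x • Φ.toFun x v))) =
      -(Complex.I • (u x • Φ.toFun x v + LinearMap.adjoint (u x • Φ.toFun x v)))
    rw [map_smulₛₗ, map_add, LinearMap.adjoint_adjoint, Complex.conj_I, neg_smul, add_comm]
  have huz : ∀ e ∈ holAtlas X, ∀ z ∈ e.target, ContDiffAt ℝ ∞ (fun ζ => u (e.symm ζ)) z := by
    intro e he z hz
    have := (contMDiffAt_iff_coord he (e.map_target hz)).1 (hu (e.symm z))
    rwa [e.right_inv hz] at this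
  have hsm : ∀ x ∈ q.punctured, SmoothFormAt B x := by
    intro x hx f hf e he hxs w
    have hl := e.left_inv hxs
    have hz := e.map_source hxs
    refine ((Φ.smoothMatAt f hW he hz (by rwa [hl]) (by rwa [hl])).shift (huz e he _ hz) w).congr ?_
    exact Filter.Eventually.of_forall fun ζ => hBm f e w ζ
  set A' := A.add subset_rfl B hskew hsm with hA'
  have hmat : ∀ (f : UnitaryFrame E) (e : OpenPartialHomeomorph X ℂ) (w : ℂ),
      A'.matrix f e w = fun z => A.matrix f e w z + shift (fun ζ => u (e.symm ζ)) (Φ.matrix f e) w z :=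
    fun f e w => funext fun z => congrArg (A.matrix f e w z + ·) (hBm f e w z)
  refine ⟨A', fun f e he z hz hf hzW w => ?_, fun f x hx v => ?_, fun f e he z hz hf hzW => ?_,
    fun p hp => ?_⟩
  · rw [← h f e he z hz hf hzW w, covD, covD, hmat]
    have hn' := hn.lie_eq_zero f hzW
    rw [Ring.lie_def, sub_eq_zero] at hn'
    simp only [shift, Ring.lie_def, Matrix.conjTranspose_smul, smul_add, smul_smul, add_mul, mul_add,
      smul_mul_assoc, mul_smul_comm, hn']
    abel
  · have h1 : (f.matrix x (B x v)).trace = 0 := by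
      have ht := Φ.trace_eq_zero x hx.2 v
      rw [← f.trace_matrix] at ht
      change (f.matrix x (Complex.I • (u x • Φ.toFun x v + LinearMap.adjoint (u x • Φ.toFun x v)))).trace = 0
      rw [f.matrix_smul, f.matrix_add, f.matrix_adjoint, f.matrix_smul, Matrix.trace_smul,
        Matrix.trace_add, Matrix.trace_conjTranspose, Matrix.trace_smul, ht]
      simp
    change (A.form f x v + f.matrix x (B x v)).trace = _
    rw [Matrix.trace_add, h1, add_zero]
  · have ha := fun w => A.smoothMatAt_target f hW he hz hf hzW w
    have hask : ∀ w, ∀ᶠ ζ in 𝓝 z, (A.matrix f e w ζ)ᴴ = - A.matrix f e w ζ := fun w => by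
      filter_upwards [eventually_symm_mem (f.isOpen_dom.inter hW) hz ⟨hf, hzW⟩] with ζ hζ
      exact A.skew f _ hζ.2 _
    have hb1 := h f e he z hz hf hzW 1
    rw [mul_one] at hb1
    have hF : A'.curvature f e z = curv (A.matrix f e 1) (A.matrix f e Complex.I) z - (2 : ℂ) •
        (wirt (fun ζ => u (e.symm ζ)) z • Φ.matrix f e z -
          (wirt (fun ζ => u (e.symm ζ)) z • Φ.matrix f e z)ᴴ) := by
      change curv (A'.matrix f e 1) (A'.matrix f e Complex.I) z = _
      rw [hmat, hmat]
      exact curv_add_shift (huz e he z hz) (ha 1) (ha _) (Φ.smoothMatAt f hW he hz hf hzW)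
        (hask 1).self_of_nhds (hask _).self_of_nhds (hn.lie_eq_zero f hzW) hb1
        (h f e he z hz hf hzW _)
    have ht := Φ.trace_matrix f hzW
    have hd := hdet.det_matrix f hzW
    have hFt : traceFree (curv (A.matrix f e 1) (A.matrix f e Complex.I) z) =
        (4 * curvCoeff Φ A f e z) • Φ.matrix f e z := h.traceFree_curvature hq hdet f he hz hf hzW
    have hFs : (traceFree (curv (A.matrix f e 1) (A.matrix f e Complex.I) z))ᴴ =
        -traceFree (curv (A.matrix f e 1) (A.matrix f e Complex.I) z) := by
      rw [traceFree_conjTranspose, curv_skew (ha 1) (ha _) (hask 1) (hask _), ← neg_one_smul ℂ,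
        traceFree_smul, neg_one_smul]
    rw [hFt] at hFs
    set k := curvCoeff Φ A f e z with hk
    set b := wirt (fun ζ => u (e.symm ζ)) z with hb
    obtain ⟨l, hl⟩ := IsAlgClosed.exists_pow_nat_eq (-q.coeff e z) (n := 2) (by norm_num)
    have hs1 := hsol e he (e.symm z) (e.map_target hz) hzW l (by rwa [e.right_inv hz])
    rw [e.right_inv hz, hκ f e he z hz hf hzW, ← hb, ← hk] at hs1
    have hherm := isHermitian_smul_of_normal ht (by rw [hd]; exact coeff_ne_zero_target he hz hzW)
      (hn.lie_eq_zero f hzW) (by rw [hl, hd]) hs1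
    have htc : ∀ c : ℂ, traceFree (c • Φ.matrix f e z) = c • Φ.matrix f e z := fun c =>
      traceFree_of_trace_eq_zero (by rw [Matrix.trace_smul, ht, smul_zero])
    have htH : traceFree (Φ.matrix f e z)ᴴ = (Φ.matrix f e z)ᴴ :=
      traceFree_of_trace_eq_zero (by rw [Matrix.trace_conjTranspose, ht, star_zero])
    have e1 : traceFree (A'.curvature f e z) = (4 * k) • Φ.matrix f e z - (2 : ℂ) •
        (b • Φ.matrix f e z - (b • Φ.matrix f e z)ᴴ) := by
      rw [hF, traceFree_sub, hFt, traceFree_smul, traceFree_sub, htc, Matrix.conjTranspose_smul,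
        traceFree_smul, htH]
    rw [e1]
    rw [Matrix.conjTranspose_smul] at hFs hherm ⊢
    simp only [Complex.star_def, map_sub, map_mul, map_ofNat] at hFs hherm ⊢
    linear_combination (norm := module) (2 : ℂ) • hherm + (1 / 2 : ℂ) • hFs
  · filter_upwards [hu0 p hp] with x hx f v
    change A.form f x v + f.matrix x (Complex.I • (u x • Φ.toFun x v + LinearMap.adjoint (u x • Φ.toFun x v))) = _
    have hx' : u x = 0 := hx
    rw [hx', zero_smul, map_zero, add_zero, smul_zero, f.matrix_zero, add_zero]

end Flat

/-! ### Normal forms near the zeros -/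

section Adapted

variable {X : Type u} [TopologicalSpace X] [ChartedSpace ℂ X] [IsManifold 𝓘(ℂ) ω X]
  {E : HermitianBundle.{u, v} X} {e e' : OpenPartialHomeomorph X ℂ}
  {q : QuadraticDifferential X}

lemma exists_bump [T2Space X] {p : X} {U : Set X} (hU : IsOpen U) (hp : p ∈ U) :
    ∃ χ : X → ℝ, (∀ x, ContMDiffAt 𝓘(ℝ, ℂ) 𝓘(ℝ) ∞ χ x) ∧ (∀ x, 0 ≤ χ x ∧ χ x ≤ 1) ∧
      (∀ᶠ x in 𝓝 p, χ x = 1) ∧ tsupport χ ⊆ U := by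
  obtain ⟨χ, -, hχ⟩ := (SmoothBumpFunction.nhds_basis_tsupport (I := 𝓘(ℝ, ℂ)) p).mem_iff.1
    (hU.mem_nhds hp)
  exact ⟨χ, fun x => χ.contMDiff x, fun x => ⟨χ.nonneg, χ.le_one⟩, χ.eventuallyEq_one, hχ⟩

lemma contDiffAt_ofReal_symm {χ : X → ℝ} (hχ : ∀ x, ContMDiffAt 𝓘(ℝ, ℂ) 𝓘(ℝ) ∞ χ x)
    (he : e ∈ holAtlas X) {z : ℂ} (hz : z ∈ e.target) :
    ContDiffAt ℝ ∞ (fun ζ => (χ (e.symm ζ) : ℂ)) z := by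
  have h := (contMDiffAt_iff_coord he (e.map_target hz)).1 (hχ (e.symm z))
  rw [e.right_inv hz] at h
  exact Complex.ofRealCLM.contDiff.contDiffAt.comp z h

lemma eventually_eq_zero_of_notMem_tsupport {χ : X → ℝ} {x : X} (hx : x ∉ tsupport χ) :
    ∀ᶠ y in 𝓝 x, y ∉ tsupport χ ∧ χ y = 0 := by
  filter_upwards [(isClosed_tsupport χ).isOpen_compl.mem_nhds hx] with y hy
  exact ⟨hy, image_eq_zero_of_notMem_tsupport hy⟩

lemma smoothFormAt_zero (x : X) : SmoothFormAt (fun _ => 0 : ∀ x : X, Tangent x →ₗ[ℝ] E.EndAt x) x :=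
  fun f _ _ _ _ _ => (SmoothMatAt.const 0).congr (Filter.Eventually.of_forall fun _ => f.matrix_zero _)

/-- A connection with the same trace whose trace-free part vanishes in a given frame near a point,
unchanged near a given finite set. -/
lemma UnitaryConnection.exists_traceFree_eq_zero_near [T2Space X] (A : UnitaryConnection E Set.univ)
    (f : UnitaryFrame E) {p : X} (hp : p ∈ f.dom) {S : Set X} (hS : S.Finite) (hpS : p ∉ S) :
    ∃ A' : UnitaryConnection E Set.univ,
      (∀ g : UnitaryFrame E, ∀ x v, (A'.form g x v).trace = (A.form g x v).trace) ∧
      (∀ᶠ x in 𝓝 p, ∀ v, traceFree (A'.form f x v) = 0) ∧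
      ∀ p' ∈ S, ∀ᶠ x in 𝓝 p', ∀ (g : UnitaryFrame E) v, A'.form g x v = A.form g x v := by
  obtain ⟨χ, hχs, hχ, hχ1, hχU⟩ := exists_bump (f.isOpen_dom.inter hS.isClosed.isOpen_compl) ⟨hp, hpS⟩
  let B : ∀ x : X, Tangent x →ₗ[ℝ] E.EndAt x := fun x =>
    { toFun := fun v => f.toEnd x ((-(χ x : ℂ)) • traceFree (A.form f x v))
      map_add' := fun v w => by
        rw [map_add, traceFree_add, smul_add]; exact map_add (Matrix.toLin _ _) _ _
      map_smul' := fun r v => by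
        rw [map_smul, ← Complex.coe_smul, traceFree_smul, smul_comm, RingHom.id_apply]
        exact map_smul (Matrix.toLin _ _) _ _ }
  have hBf : ∀ x v, f.matrix x (B x v) = (-(χ x : ℂ)) • traceFree (A.form f x v) := fun x v =>
    f.matrix_toEnd x _
  have hB0 : ∀ x, χ x = 0 → B x = 0 := fun x hx => LinearMap.ext fun v => by
    apply f.matrix_injective
    rw [hBf, hx]
    simp [f.matrix_zero]
  have hskew : ∀ x ∈ Set.univ, ∀ v, LinearMap.adjoint (B x v) = - B x v := by
    intro x _ v
    by_cases hx : x ∈ f.dom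
    · apply f.matrix_injective
      rw [f.matrix_adjoint, show f.matrix x (- B x v) = - f.matrix x (B x v) from
        map_neg (LinearMap.toMatrix _ _) _, hBf, Matrix.conjTranspose_smul, traceFree_conjTranspose,
        A.skew f x ⟨hx, trivial⟩, ← neg_one_smul ℂ (A.form f x v), traceFree_smul]
      simp
    · have : χ x = 0 := image_eq_zero_of_notMem_tsupport fun h => hx (hχU h).1
      simp [hB0 x this]
  have hsm : ∀ x ∈ Set.univ, SmoothFormAt B x := by
    intro x _
    by_cases hx : x ∈ f.dom
    · have he := chartAt_mem_holAtlas x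
      have hs := mem_chart_source ℂ x
      refine SmoothFormAt.of_frame f hx he hs fun w => ?_
      refine (SmoothMatAt.smul (contDiffAt_ofReal_symm hχs he (mem_chart_target ℂ x)).neg
        (A.smoothMatAt isOpen_univ f he hs hx trivial w).traceFree).congr ?_
      exact Filter.Eventually.of_forall fun ζ => hBf _ _
    · refine (smoothFormAt_zero x).congr ?_
      filter_upwards [eventually_eq_zero_of_notMem_tsupport fun h => hx (hχU h).1] with y hy
      exact hB0 y hy.2
  refine ⟨A.add subset_rfl B hskew hsm, fun g x v => ?_, ?_, fun p' hp' => ?_⟩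
  · change (A.form g x v + g.matrix x (B x v)).trace = _
    rw [Matrix.trace_add, g.trace_matrix, ← f.trace_matrix, hBf, Matrix.trace_smul, trace_traceFree]
    simp
  · filter_upwards [hχ1] with x hx v
    change traceFree (A.form f x v + f.matrix x (B x v)) = 0
    rw [hBf, hx, traceFree_add, traceFree_smul, traceFree_of_trace_eq_zero (trace_traceFree _)]
    simp
  · filter_upwards [eventually_eq_zero_of_notMem_tsupport fun h => (hχU h).2 hp'] with x hx g v
    change A.form g x v + g.matrix x (B x v) = _
    rw [hB0 x hx.2, LinearMap.zero_apply, g.matrix_zero, add_zero]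

lemma UnitaryConnection.exists_adapted [T2Space X] (A : UnitaryConnection E Set.univ) {S : Set X}
    (hS : S.Finite) (f : X → UnitaryFrame E) (hf : ∀ p ∈ S, p ∈ (f p).dom) :
    ∃ A' : UnitaryConnection E Set.univ,
      (∀ g : UnitaryFrame E, ∀ x v, (A'.form g x v).trace = (A.form g x v).trace) ∧
      ∀ p ∈ S, ∀ᶠ x in 𝓝 p, ∀ v, traceFree (A'.form (f p) x v) = 0 := by
  induction S, hS using Set.Finite.induction_on with
  | empty => exact ⟨A, fun _ _ _ => rfl, fun p hp => hp.elim⟩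
  | @insert p S hpS hS ih =>
    obtain ⟨A₁, h1, h2⟩ := ih fun p hp => hf p (Set.mem_insert_of_mem _ hp)
    obtain ⟨A₂, h3, h4, h5⟩ :=
      A₁.exists_traceFree_eq_zero_near (f p) (hf p (Set.mem_insert _ _)) hS hpS
    refine ⟨A₂, fun g x v => (h3 g x v).trans (h1 g x v), fun p' hp' => ?_⟩
    rcases hp' with rfl | hp'
    · exact h4
    · filter_upwards [h2 p' hp', h5 p' hp'] with x hx hx' v
      rw [hx', hx]

/-- A nilpotent matrix has a positive upper right entry in some unitary frame. -/
lemma exists_unitary_entry_pos {M : Matrix (Fin 2) (Fin 2) ℂ} (ht : M.trace = 0) (hd : M.det = 0)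
    (h0 : M ≠ 0) : ∃ g : Matrix (Fin 2) (Fin 2) ℂ, gᴴ * g = 1 ∧ 0 < ((gᴴ * M * g) 0 1).re := by
  have hphase : ∀ c : ℂ, c ≠ 0 → ∃ s : ℂ, starRingEnd ℂ s * s = 1 ∧ 0 < (c * s).re := by
    intro c hc
    have hn : (‖c‖ : ℂ) ≠ 0 := by simpa using hc
    refine ⟨starRingEnd ℂ c / ‖c‖, ?_, ?_⟩
    · rw [map_div₀, Complex.conj_conj, Complex.conj_ofReal, div_mul_div_comm, Complex.mul_conj,
        Complex.normSq_eq_norm_sq]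
      push_cast
      field_simp
    · rw [← mul_div_assoc, Complex.mul_conj, Complex.normSq_eq_norm_sq]
      have : ((‖c‖ ^ 2 : ℝ) : ℂ) / ‖c‖ = (‖c‖ : ℝ) := by push_cast; field_simp
      rw [this, Complex.ofReal_re]
      exact norm_pos_iff.2 hc
  by_cases hb : M 0 1 = 0
  · rw [Matrix.trace_fin_two] at ht
    rw [Matrix.det_fin_two, hb, zero_mul, sub_zero] at hd
    have ha : M 0 0 = 0 := by
      have h1 : M 1 1 = - M 0 0 := by linear_combination ht
      rw [h1] at hd
      simpa using hd
    have hd' : M 1 1 = 0 := by rw [ha, zero_add] at ht; exact ht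
    have hc : M 1 0 ≠ 0 := by
      intro hc
      apply h0
      ext i j
      fin_cases i <;> fin_cases j <;> simp [ha, hb, hc, hd']
    obtain ⟨s, hs, hpos⟩ := hphase _ hc
    refine ⟨!![0, s; 1, 0], ?_, ?_⟩
    · ext i j
      fin_cases i <;> fin_cases j <;>
        simp [Matrix.mul_apply, Fin.sum_univ_two, Matrix.conjTranspose_apply, hs]
    · simpa [Matrix.mul_apply, Fin.sum_univ_two, Matrix.conjTranspose_apply, hd', ha, hb] using hpos
  · obtain ⟨s, hs, hpos⟩ := hphase _ hb
    refine ⟨!![1, 0; 0, s], ?_, ?_⟩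
    · ext i j
      fin_cases i <;> fin_cases j <;>
        simp [Matrix.mul_apply, Fin.sum_univ_two, Matrix.conjTranspose_apply, hs]
    · simpa [Matrix.mul_apply, Fin.sum_univ_two, Matrix.conjTranspose_apply] using hpos

/-- A path of trace-free matrices with determinant `-z` from `M` (at `t = 0`) to `(0, 1; z, 0)`. -/
def normalize (t : ℂ) (M : Matrix (Fin 2) (Fin 2) ℂ) (z : ℂ) : Matrix (Fin 2) (Fin 2) ℂ :=
  !![(1 - t) * M 0 0, t + (1 - t) * M 0 1;
    (z - ((1 - t) * M 0 0) ^ 2) / (t + (1 - t) * M 0 1), -((1 - t) * M 0 0)]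

lemma normalize_zero {M : Matrix (Fin 2) (Fin 2) ℂ} {z : ℂ} (ht : M.trace = 0) (hd : M.det = -z)
    (hb : M 0 1 ≠ 0) : normalize 0 M z = M := by
  rw [Matrix.trace_fin_two] at ht
  have h1 : M 1 1 = - M 0 0 := by linear_combination ht
  rw [Matrix.det_fin_two, h1] at hd
  ext i j
  fin_cases i <;> fin_cases j <;> simp [normalize, h1]
  field_simp
  linear_combination hd

lemma normalize_one (M : Matrix (Fin 2) (Fin 2) ℂ) (z : ℂ) : normalize 1 M z = !![0, 1; z, 0] := by
  simp [normalize]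

lemma trace_normalize (t : ℂ) (M : Matrix (Fin 2) (Fin 2) ℂ) (z : ℂ) :
    (normalize t M z).trace = 0 := by
  simp [normalize, Matrix.trace_fin_two]

lemma det_normalize {t : ℂ} {M : Matrix (Fin 2) (Fin 2) ℂ} (z : ℂ)
    (h : t + (1 - t) * M 0 1 ≠ 0) : (normalize t M z).det = -z := by
  rw [Matrix.det_fin_two]
  simp only [normalize, Matrix.of_apply, Matrix.cons_val', Matrix.cons_val_zero, Matrix.cons_val_one,
    Matrix.cons_val_fin_one]
  field_simp
  ring

/-- The path never leaves the matrices with nonzero upper right entry. -/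
lemma normalize_denom_ne_zero {t : ℝ} (h : 0 ≤ t ∧ t ≤ 1) {b : ℂ} (hb : 0 < b.re) :
    (t : ℂ) + (1 - t) * b ≠ 0 := by
  intro h0
  have h1 := congrArg Complex.re h0
  have h2 : ((t : ℂ) + (1 - t) * b).re = t + (1 - t) * b.re := by simp
  rw [h2, Complex.zero_re] at h1
  rcases h.2.lt_or_eq with h3 | h3
  · nlinarith [mul_pos (sub_pos.2 h3) hb]
  · rw [h3] at h1; norm_num at h1

lemma SmoothMatAt.normalize {t : ℂ → ℂ} {M : ℂ → Matrix (Fin 2) (Fin 2) ℂ} {z : ℂ}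
    (ht : ContDiffAt ℝ ∞ t z) (hM : SmoothMatAt M z) (h : t z + (1 - t z) * M z 0 1 ≠ 0) :
    SmoothMatAt (fun ζ => HiggsSurface.normalize (t ζ) (M ζ) ζ) z := by
  have h1 : ContDiffAt ℝ ∞ (fun ζ => 1 - t ζ) z := contDiffAt_const.sub ht
  have ha := h1.mul (hM 0 0)
  have hb := ht.add (h1.mul (hM 0 1))
  intro i j
  fin_cases i <;> fin_cases j
  · exact ha
  · exact hb
  · exact contDiffAt_div (contDiffAt_id.sub (ha.pow 2)) hb h
  · exact ha.neg

/-- The matrix of `Φ` at a simple zero of its determinant does not vanish. -/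
lemma ne_zero_of_det_eq_neg {φ : ℂ → Matrix (Fin 2) (Fin 2) ℂ} (hφ : SmoothMatAt φ 0)
    (h : ∀ᶠ z in 𝓝 0, (φ z).det = -z) : φ 0 ≠ 0 := by
  intro h0
  have h1 : (fun z => φ z 0 0 * φ z 1 1 - φ z 0 1 * φ z 1 0) =ᶠ[𝓝 0] fun z => -z := by
    filter_upwards [h] with z hz
    rw [← hz, Matrix.det_fin_two]
  have h2 := congrArg (fun L => L 1) (h1.fderiv_eq (𝕜 := ℝ))
  rw [fderiv_fun_sub ((hφ.diff 0 0).fun_mul (hφ.diff 1 1)) ((hφ.diff 0 1).fun_mul (hφ.diff 1 0)),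
    fderiv_fun_mul (hφ.diff 0 0) (hφ.diff 1 1), fderiv_fun_mul (hφ.diff 0 1) (hφ.diff 1 0), h0, fderiv_fun_neg, fderiv_fun_id] at h2
  simp at h2

/-- In some frame and coordinate near `p` one has `q = -z dz²` and `Φ = (0, 1; z, 0) dz`. -/
def NormalFormAt {W : Set X} (Φ : HiggsField E W) (q : QuadraticDifferential X) (p : X) : Prop :=
  ∃ f : UnitaryFrame E, ∃ e ∈ holAtlas X, p ∈ f.dom ∧ p ∈ e.source ∧ e p = 0 ∧
    ∀ᶠ z in 𝓝 (0 : ℂ), q.coeff e z = -z ∧ Φ.matrix f e z = !![0, 1; z, 0]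

/-- A Higgs field can be brought into the normal form near a zero of its determinant, leaving it
unchanged near a given finite set. -/
lemma HiggsField.exists_normalFormAt [T2Space X] (hq : q.IsHolomorphic) (hs : q.HasSimpleZeros)
    (Φ : HiggsField E Set.univ) (hdet : Φ.HasDet q) {p : X} (hp : q p = 0) {S : Set X}
    (hS : S.Finite) (hpS : p ∉ S) :
    ∃ Φ' : HiggsField E Set.univ, Φ'.HasDet q ∧ NormalFormAt Φ' q p ∧
      ∀ p' ∈ S, ∀ᶠ x in 𝓝 p', Φ'.toFun x = Φ.toFun x := by
  obtain ⟨e, he, R, hR, hpe, hp0, hRe, hqe⟩ := exists_normal_coord hq hs hp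
  have h0t : (0 : ℂ) ∈ e.target := hRe (Metric.mem_ball_self hR)
  have hs0 : e.symm 0 = p := by rw [← hp0, e.left_inv hpe]
  obtain ⟨f, hf, hpos⟩ : ∃ f : UnitaryFrame E, p ∈ f.dom ∧ 0 < (Φ.matrix f e 0 0 1).re := by
    obtain ⟨f₀, hf₀⟩ := exists_frame E p
    have hsm := Φ.smoothMatAt f₀ isOpen_univ he h0t (by rwa [hs0]) trivial
    have hev : ∀ᶠ z in 𝓝 (0 : ℂ), (Φ.matrix f₀ e z).det = -z := by
      filter_upwards [Metric.ball_mem_nhds (0 : ℂ) hR] with z hz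
      rw [hdet.det_matrix f₀ trivial, hqe z hz]
    obtain ⟨g, hg, hpos⟩ := exists_unitary_entry_pos (Φ.trace_matrix f₀ trivial)
      (by simpa using hev.self_of_nhds) (ne_zero_of_det_eq_neg hsm hev)
    refine ⟨f₀.rotate g hg, hf₀, ?_⟩
    rwa [Φ.matrix_change_frame f₀, f₀.transition_rotate]
  have hsm := Φ.smoothMatAt f isOpen_univ he h0t (by rwa [hs0]) trivial
  -- the neighbourhood of `p` on which the Higgs field is changed
  obtain ⟨V, hV, hVo, hpV⟩ : ∃ V : Set X, (∀ x ∈ V, x ∈ f.dom ∧ x ∈ e.source ∧ x ∉ S ∧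
      e x ∈ Metric.ball 0 R ∧ 0 < (Φ.matrix f e (e x) 0 1).re) ∧ IsOpen V ∧ p ∈ V := by
    rw [← eventually_nhds_iff]
    have h1 : ∀ᶠ z in 𝓝 (e p), z ∈ Metric.ball (0 : ℂ) R ∧ 0 < (Φ.matrix f e z 0 1).re := by
      rw [hp0]
      refine Filter.Eventually.and (Metric.ball_mem_nhds (0 : ℂ) hR) ?_
      exact (Complex.continuous_re.continuousAt.comp (hsm 0 1).continuousAt).eventually (lt_mem_nhds hpos)
    filter_upwards [f.isOpen_dom.mem_nhds hf, e.open_source.mem_nhds hpe,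
      hS.isClosed.isOpen_compl.mem_nhds hpS, (e.continuousAt hpe).eventually h1] with x h2 h3 h4 h5
    exact ⟨h2, h3, h4, h5⟩
  obtain ⟨χ, hχs, hχ, hχ1, hχV⟩ := exists_bump hVo hpV
  classical
  let N : ℂ → Matrix (Fin 2) (Fin 2) ℂ := fun z => normalize (χ (e.symm z)) (Φ.matrix f e z) z
  let Ψ : ∀ x : X, Tangent x →ₗ[ℂ] E.EndAt x := fun x =>
    if x ∈ V then
      { toFun := fun v => (vecCoord v / vecCoord (push e (e x) 1)) • f.toEnd x (N (e x))
        map_add' := fun v w => by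
          rw [← add_smul, ← add_div]; rfl
        map_smul' := fun c v => by
          rw [RingHom.id_apply, smul_smul, ← mul_div_assoc]; rfl }
    else Φ.toFun x
  have hΨV : ∀ z ∈ e.target, e.symm z ∈ V → ∀ w,
      f.matrix (e.symm z) (Ψ (e.symm z) (push e z w)) = w • N z := by
    intro z hz hzV w
    have h1 : Ψ (e.symm z) (push e z w) = (vecCoord (push e z w) /
        vecCoord (push e (e (e.symm z)) 1)) • f.toEnd (e.symm z) (N (e (e.symm z))) := by
      simp only [Ψ, if_pos hzV]; rfl
    rw [h1, e.right_inv hz, f.matrix_smul, f.matrix_toEnd]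
    congr 1
    rw [push_eq_smul]
    exact mul_div_cancel_right₀ w (vecCoord_push_ne_zero he hz)
  have hVt : ∀ x ∈ V, e x ∈ e.target ∧ e.symm (e x) ∈ V := fun x hx =>
    ⟨e.map_source (hV x hx).2.1, by rwa [e.left_inv (hV x hx).2.1]⟩
  have hden : ∀ z ∈ e.target, e.symm z ∈ V →
      (χ (e.symm z) : ℂ) + (1 - χ (e.symm z)) * Φ.matrix f e z 0 1 ≠ 0 := fun z hz hzV => by
    have := (hV _ hzV).2.2.2.2
    rw [e.right_inv hz] at this
    exact normalize_denom_ne_zero (hχ _) this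
  have hball : ∀ z ∈ e.target, e.symm z ∈ V → q.coeff e z = -z := fun z hz hzV => by
    have := (hV _ hzV).2.2.2.1
    rw [e.right_inv hz] at this
    exact hqe z this
  have hΨ0 : ∀ x, χ x = 0 → Ψ x = Φ.toFun x := by
    intro x hx
    by_cases hxV : x ∈ V
    swap
    · simp only [Ψ, if_neg hxV]
    refine LinearMap.ext fun v => ?_
    have hxe := (hV x hxV).2.1
    obtain ⟨hz, hzV⟩ := hVt x hxV
    refine forall_tangent_of_coord (fun x v => Ψ x v = Φ.toFun x v) he hxe (fun w => ?_) v
    apply f.matrix_injective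
    rw [hΨV _ hz hzV, push_eq_smul, map_smul, f.matrix_smul]
    congr 1
    have hb := (hV x hxV).2.2.2.2
    have hd := hdet.det_matrix (e := e) (z := e x) f trivial
    rw [hball _ hz hzV] at hd
    simp only [N]
    have hχ0 : χ (e.symm (e x)) = 0 := by rw [e.left_inv hxe, hx]
    rw [hχ0, Complex.ofReal_zero]
    exact normalize_zero (Φ.trace_matrix f trivial) hd fun h => by rw [h] at hb; simp at hb
  have hoff : ∀ x, x ∉ tsupport χ → ∀ᶠ y in 𝓝 x, Ψ y = Φ.toFun y := fun x hx =>
    (eventually_eq_zero_of_notMem_tsupport hx).mono fun y hy => hΨ0 y hy.2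
  have hsmooth : ∀ x ∈ Set.univ, SmoothFormAt (realForm Ψ) x := by
    intro x _
    by_cases hxV : x ∈ V
    · have hxe := (hV x hxV).2.1
      obtain ⟨hz, hzV⟩ := hVt x hxV
      refine SmoothFormAt.of_frame f (hV x hxV).1 he hxe fun w => ?_
      refine ((SmoothMatAt.normalize (contDiffAt_ofReal_symm hχs he hz)
        (Φ.smoothMatAt f isOpen_univ he hz (by rw [e.left_inv hxe]; exact (hV x hxV).1) trivial)
        (hden _ hz hzV)).const_smul w).congr ?_
      filter_upwards [eventually_symm_mem hVo hz hzV] with ζ hζ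
      exact hΨV ζ hζ.1 hζ.2 w
    · refine (Φ.smoothFormAt isOpen_univ trivial).congr ?_
      filter_upwards [hoff x fun h => hxV (hχV h)] with y hy
      rw [realForm, hy]; rfl
  have htrace : ∀ x ∈ Set.univ, ∀ v, LinearMap.trace ℂ (E.fiber x) (Ψ x v) = 0 := by
    intro x _ v
    by_cases hxV : x ∈ V
    · obtain ⟨hz, hzV⟩ := hVt x hxV
      refine forall_tangent_of_coord (fun x v => LinearMap.trace ℂ (E.fiber x) (Ψ x v) = 0) he
        (hV x hxV).2.1 (fun w => ?_) v
      rw [← f.trace_matrix, hΨV _ hz hzV, Matrix.trace_smul, trace_normalize, smul_zero]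
    · rw [hΨ0 x (image_eq_zero_of_notMem_tsupport fun h => hxV (hχV h))]
      exact Φ.trace_eq_zero x trivial v
  refine ⟨HiggsField.ofSmooth Ψ htrace hsmooth, fun x _ v => ?_, ⟨f, e, he, hf, hpe, hp0, ?_⟩,
    fun p' hp' => hoff p' fun h => (hV _ (hχV h)).2.2.1 hp'⟩
  · change LinearMap.det (Ψ x v) = q x v
    by_cases hxV : x ∈ V
    · obtain ⟨hz, hzV⟩ := hVt x hxV
      refine forall_tangent_of_coord (fun x v => LinearMap.det (Ψ x v) = q x v) he
        (hV x hxV).2.1 (fun w => ?_) v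
      rw [← f.det_matrix, hΨV _ hz hzV, Matrix.det_smul, det_normalize _ (hden _ hz hzV),
        ← hball _ hz hzV, push_eq_smul, QuadraticMap.map_smul]
      simp [QuadraticDifferential.coeff, sq]
    · rw [hΨ0 x (image_eq_zero_of_notMem_tsupport fun h => hxV (hχV h))]
      exact hdet x trivial v
  · have h1 : ∀ᶠ z in 𝓝 (0 : ℂ), χ (e.symm z) = 1 := by
      have := e.continuousAt_symm h0t
      rw [ContinuousAt, hs0] at this
      exact this.eventually hχ1
    filter_upwards [h1, eventually_symm_mem hVo h0t (by rwa [hs0])] with z hz1 hz2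
    refine ⟨hball z hz2.1 hz2.2, ?_⟩
    change f.matrix _ (Ψ _ (push e z 1)) = _
    rw [hΨV z hz2.1 hz2.2, one_smul]
    simp only [N]
    rw [hz1, Complex.ofReal_one, normalize_one]

lemma NormalFormAt.congr {W : Set X} {Φ Φ' : HiggsField E W} {p : X} (h : NormalFormAt Φ q p)
    (hΦ : ∀ᶠ x in 𝓝 p, Φ'.toFun x = Φ.toFun x) : NormalFormAt Φ' q p := by
  obtain ⟨f, e, he, hf, hpe, hp0, hev⟩ := h
  refine ⟨f, e, he, hf, hpe, hp0, ?_⟩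
  have h1 := e.continuousAt_symm (e.map_source hpe)
  rw [ContinuousAt, e.left_inv hpe, hp0] at h1
  filter_upwards [hev, h1.eventually hΦ] with z hz hz'
  refine ⟨hz.1, ?_⟩
  rw [← hz.2, HiggsField.matrix, HiggsField.matrix, hz']

lemma HiggsField.exists_adapted [T2Space X] (hq : q.IsHolomorphic) (hs : q.HasSimpleZeros)
    (Φ : HiggsField E Set.univ) (hdet : Φ.HasDet q) {S : Set X} (hS : S.Finite)
    (hSq : ∀ p ∈ S, q p = 0) :
    ∃ Φ' : HiggsField E Set.univ, Φ'.HasDet q ∧ ∀ p ∈ S, NormalFormAt Φ' q p := by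
  induction S, hS using Set.Finite.induction_on with
  | empty => exact ⟨Φ, hdet, fun p hp => hp.elim⟩
  | @insert p S hpS hS ih =>
    obtain ⟨Φ₁, h1, h2⟩ := ih fun p hp => hSq p (Set.mem_insert_of_mem _ hp)
    obtain ⟨Φ₂, h3, h4, h5⟩ :=
      Φ₁.exists_normalFormAt hq hs h1 (hSq p (Set.mem_insert _ _)) hS hpS
    refine ⟨Φ₂, h3, fun p' hp' => ?_⟩
    rcases hp' with rfl | hp'
    · exact h4
    · exact (h2 p' hp').congr (h5 p' hp')

end Adapted

/-! ### The normal Higgs field with a given determinant -/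

section Polar

/-- The normal matrix with the same determinant obtained from a trace-free matrix `M` by
normalizing `M - (det M / |det M|) Mᴴ`. -/
def polarMat (M : Matrix (Fin 2) (Fin 2) ℂ) : Matrix (Fin 2) (Fin 2) ℂ :=
  ((Real.sqrt ((M * Mᴴ).trace.re / ‖M.det‖ + 2))⁻¹ : ℂ) • (M - (M.det / (‖M.det‖ : ℂ)) • Mᴴ)

variable {M : Matrix (Fin 2) (Fin 2) ℂ}

lemma trace_mul_conjTranspose_self (M : Matrix (Fin 2) (Fin 2) ℂ) :
    (M * Mᴴ).trace = ((M * Mᴴ).trace.re : ℂ) ∧ 0 ≤ (M * Mᴴ).trace.re := by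
  have h : (M * Mᴴ).trace = ((Complex.normSq (M 0 0) + Complex.normSq (M 0 1) +
      Complex.normSq (M 1 0) + Complex.normSq (M 1 1) : ℝ) : ℂ) := by
    simp only [Matrix.trace_fin_two, Matrix.mul_apply, Fin.sum_univ_two, Matrix.conjTranspose_apply]
    push_cast
    simp only [Complex.normSq_eq_conj_mul_self, Complex.star_def]
    ring
  have := Complex.normSq_nonneg
  refine ⟨by rw [h, Complex.ofReal_re], ?_⟩
  rw [h, Complex.ofReal_re]
  linarith [this (M 0 0), this (M 0 1), this (M 1 0), this (M 1 1)]

lemma polar_radicand_pos (M : Matrix (Fin 2) (Fin 2) ℂ) : 0 < (M * Mᴴ).trace.re / ‖M.det‖ + 2 := by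
  have := div_nonneg (trace_mul_conjTranspose_self M).2 (norm_nonneg M.det)
  linarith

lemma trace_polarMat (h : M.trace = 0) : (polarMat M).trace = 0 := by
  rw [polarMat, Matrix.trace_smul, Matrix.trace_sub, Matrix.trace_smul, Matrix.trace_conjTranspose, h]
  simp

lemma conj_div_norm_mul {d : ℂ} (hd : d ≠ 0) :
    starRingEnd ℂ (d / (‖d‖ : ℂ)) * (d / (‖d‖ : ℂ)) = 1 := by
  have hn : (‖d‖ : ℂ) ≠ 0 := by simpa using hd
  rw [map_div₀, Complex.conj_ofReal, div_mul_div_comm, Complex.conj_mul']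
  field_simp

lemma polarMat_normal (hd : M.det ≠ 0) : ⁅polarMat M, (polarMat M)ᴴ⁆ = 0 := by
  have h1 := conj_div_norm_mul hd
  set s := M.det / (‖M.det‖ : ℂ)
  have h2 : (M - s • Mᴴ)ᴴ = (-starRingEnd ℂ s) • (M - s • Mᴴ) := by
    rw [Matrix.conjTranspose_sub, Matrix.conjTranspose_smul, Matrix.conjTranspose_conjTranspose,
      Complex.star_def, smul_sub, smul_smul, neg_mul, h1]
    module
  rw [polarMat, Matrix.conjTranspose_smul, h2, Ring.lie_def]
  simp only [smul_mul_assoc, mul_smul_comm, smul_smul]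
  rw [sub_eq_zero]
  congr 1
  ring

lemma det_polarMat (ht : M.trace = 0) (hd : M.det ≠ 0) : (polarMat M).det = M.det := by
  have hn : (‖M.det‖ : ℂ) ≠ 0 := by simpa using hd
  have hpos := polar_radicand_pos M
  obtain ⟨htr, -⟩ := trace_mul_conjTranspose_self M
  have hsq : ((Real.sqrt ((M * Mᴴ).trace.re / ‖M.det‖ + 2) : ℝ) : ℂ) ^ 2 =
      (M * Mᴴ).trace / ‖M.det‖ + 2 := by
    rw [← Complex.ofReal_pow, Real.sq_sqrt hpos.le, htr]; push_cast; rfl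
  have hs0 : ((Real.sqrt ((M * Mᴴ).trace.re / ‖M.det‖ + 2) : ℝ) : ℂ) ≠ 0 := by
    simpa using (Real.sqrt_pos.2 hpos).ne'
  have h1 := conj_div_norm_mul hd
  have hdn : M.det = (M.det / ‖M.det‖) * ‖M.det‖ := by field_simp
  have hc : starRingEnd ℂ M.det * (M.det / (‖M.det‖ : ℂ)) ^ 2 = M.det := by
    have h3 : starRingEnd ℂ (M.det / (‖M.det‖ : ℂ)) = starRingEnd ℂ M.det / ‖M.det‖ := by
      rw [map_div₀, Complex.conj_ofReal]
    rw [h3] at h1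
    field_simp at h1 ⊢
    linear_combination h1
  have hdet : (M - (M.det / (‖M.det‖ : ℂ)) • Mᴴ).det = M.det + (M.det / (‖M.det‖ : ℂ)) * (M * Mᴴ).trace +
      (M.det / (‖M.det‖ : ℂ)) ^ 2 * starRingEnd ℂ M.det := by
    generalize M.det / (‖M.det‖ : ℂ) = s
    rw [Matrix.trace_fin_two] at ht
    have h4 : M 1 1 = - M 0 0 := by linear_combination ht
    simp only [Matrix.det_fin_two, Matrix.sub_apply, Matrix.smul_apply, Matrix.conjTranspose_apply,
      Matrix.trace_fin_two, Matrix.mul_apply, Fin.sum_univ_two, smul_eq_mul, h4, map_sub, map_mul,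
      Complex.star_def, map_neg]
    ring
  rw [polarMat, Matrix.det_smul, hdet, mul_comm _ (starRingEnd ℂ _), hc, Fintype.card_fin]
  have h5 : M.det + M.det / ‖M.det‖ * (M * Mᴴ).trace + M.det =
      M.det * ((M * Mᴴ).trace / ‖M.det‖ + 2) := by ring
  rw [h5, ← hsq]
  generalize ((Real.sqrt ((M * Mᴴ).trace.re / ‖M.det‖ + 2) : ℝ) : ℂ) = s at hs0 ⊢
  field_simp

lemma polarMat_smul {c : ℂ} (hc : c ≠ 0) (hd : M.det ≠ 0) :
    polarMat (c • M) = c • polarMat M := by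
  have hn : ‖M.det‖ ≠ 0 := by simpa using hd
  have hnc : ‖c‖ ≠ 0 := by simpa using hc
  have h1 : (c • M * (c • M)ᴴ).trace.re = ‖c‖ ^ 2 * (M * Mᴴ).trace.re := by
    rw [Matrix.conjTranspose_smul, smul_mul_assoc, mul_smul_comm, smul_smul, Matrix.trace_smul,
      Complex.star_def, Complex.mul_conj, smul_eq_mul, Complex.re_ofReal_mul, Complex.normSq_eq_norm_sq]
  have h2 : (c • M).det = c ^ 2 * M.det := by rw [Matrix.det_smul, Fintype.card_fin]
  have hd2 : ‖c ^ 2 * M.det‖ = ‖c‖ ^ 2 * ‖M.det‖ := by rw [norm_mul, norm_pow]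
  rw [polarMat, polarMat, h1, h2, hd2, mul_div_mul_left _ _ (pow_ne_zero 2 hnc),
    Matrix.conjTranspose_smul, smul_comm c (_⁻¹ : ℂ)]
  congr 1
  rw [smul_sub, smul_smul, smul_smul]
  congr 2
  have h3 : (‖c‖ : ℂ) ^ 2 = starRingEnd ℂ c * c := (Complex.conj_mul' c).symm
  have hn' : (‖M.det‖ : ℂ) ≠ 0 := by simpa using hd
  have hcc : starRingEnd ℂ c ≠ 0 := by simpa using hc
  push_cast
  rw [h3, Complex.star_def]
  field_simp

lemma SmoothMatAt.polarMat {M : ℂ → Matrix (Fin 2) (Fin 2) ℂ} {z : ℂ} (hM : SmoothMatAt M z)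
    (hd : (M z).det ≠ 0) : SmoothMatAt (fun ζ => HiggsSurface.polarMat (M ζ)) z := by
  have hdet : ContDiffAt ℝ ∞ (fun ζ => (M ζ).det) z := by
    simp only [Matrix.det_fin_two]
    exact ((hM 0 0).mul (hM 1 1)).sub ((hM 0 1).mul (hM 1 0))
  have hn : ContDiffAt ℝ ∞ (fun ζ => ‖(M ζ).det‖) z := hdet.norm ℝ hd
  have hn0 : ‖(M z).det‖ ≠ 0 := by simpa using hd
  have htr : ContDiffAt ℝ ∞ (fun ζ => (M ζ * (M ζ)ᴴ).trace.re) z :=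
    Complex.reCLM.contDiff.contDiffAt.comp z (hM.mul hM.conjTranspose).trace
  have hpos := polar_radicand_pos (M z)
  have hs := ((htr.div hn hn0).add (contDiffAt_const (c := (2 : ℝ)))).sqrt hpos.ne'
  have hs' := (Complex.ofRealCLM.contDiff.contDiffAt.comp z hs).inv
    (by simpa using (Real.sqrt_pos.2 hpos).ne')
  refine SmoothMatAt.smul hs' (hM.sub (SmoothMatAt.smul (contDiffAt_div hdet
    (Complex.ofRealCLM.contDiff.contDiffAt.comp z hn) ?_) hM.conjTranspose))
  simpa using hd

lemma polarMat_conj {g : Matrix (Fin 2) (Fin 2) ℂ} (hg : gᴴ * g = 1) (M : Matrix (Fin 2) (Fin 2) ℂ) :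
    polarMat (gᴴ * M * g) = gᴴ * polarMat M * g := by
  have hg' : g * gᴴ = 1 := mul_eq_one_comm.1 hg
  have h1 : ∀ m, g * (gᴴ * m) = m := fun m => by rw [← mul_assoc, hg', one_mul]
  have h2 : (gᴴ * M * g)ᴴ = gᴴ * Mᴴ * g := by
    simp only [Matrix.conjTranspose_mul, Matrix.conjTranspose_conjTranspose, mul_assoc]
  have h3 : (gᴴ * M * g).det = M.det := by
    rw [mul_assoc, Matrix.det_mul_comm, mul_assoc, hg', mul_one]
  have h4 : (gᴴ * M * g * (gᴴ * Mᴴ * g)).trace = (M * Mᴴ).trace := by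
    simp only [mul_assoc, h1]
    rw [Matrix.trace_mul_comm]
    simp only [mul_assoc, hg', mul_one]
  rw [polarMat, polarMat, h2, h3, h4]
  simp only [mul_smul_comm, smul_mul_assoc, mul_sub, sub_mul]

/-- The normal form at a simple zero is sent to the limiting fiducial Higgs field. -/
lemma polarMat_fiducial {z : ℂ} (hz : z ≠ 0) : polarMat !![0, 1; z, 0] = fiducialHiggs z := by
  have hr : 0 < ‖z‖ := norm_pos_iff.2 hz
  have hdet : (!![0, 1; z, 0] : Matrix (Fin 2) (Fin 2) ℂ).det = -z := by simp [Matrix.det_fin_two]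
  have htr : ((!![0, 1; z, 0] : Matrix (Fin 2) (Fin 2) ℂ) * !![0, 1; z, 0]ᴴ).trace.re = 1 + ‖z‖ ^ 2 := by
    simp only [Matrix.trace_fin_two, Matrix.mul_apply, Fin.sum_univ_two, Matrix.conjTranspose_apply]
    simp [Complex.mul_conj, Complex.normSq_eq_norm_sq, -Complex.ofReal_pow]
  have hsqrt : Real.sqrt ((1 + ‖z‖ ^ 2) / ‖z‖ + 2) = (1 + ‖z‖) / Real.sqrt ‖z‖ := by
    have h2 : (1 + ‖z‖ ^ 2) / ‖z‖ + 2 = (1 + ‖z‖) ^ 2 / ‖z‖ := by field_simp; ring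
    rw [h2, Real.sqrt_div (sq_nonneg _), Real.sqrt_sq (by positivity)]
  have hzz : z * starRingEnd ℂ z = (‖z‖ : ℂ) ^ 2 := Complex.mul_conj' z
  have hr' : (‖z‖ : ℂ) ≠ 0 := by simpa using hz
  have hr1 : (1 + ‖z‖ : ℂ) ≠ 0 := by
    have h3 : (1 + ‖z‖ : ℝ) ≠ 0 := by positivity
    exact_mod_cast h3
  have hs0 : (Real.sqrt ‖z‖ : ℂ) ≠ 0 := by
    have := (Real.sqrt_pos.2 hr).ne'
    exact_mod_cast this
  rw [polarMat, hdet, htr, norm_neg, hsqrt]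
  push_cast
  ext i j
  fin_cases i <;> fin_cases j <;>
    simp [fiducialHiggs, Matrix.conjTranspose_apply]
  · field_simp
    linear_combination hzz
  · field_simp
    ring

variable {X : Type u} [TopologicalSpace X] [ChartedSpace ℂ X] [IsManifold 𝓘(ℂ) ω X]
  {E : HermitianBundle.{u, v} X} {e e' : OpenPartialHomeomorph X ℂ}
  {q : QuadraticDifferential X}

/-- A Higgs field with determinant `q` yields a normal one with determinant `q` off the zeros. -/
lemma HiggsField.exists_polar (hq : q.IsHolomorphic) (Φ : HiggsField E Set.univ) (hdet : Φ.HasDet q) :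
    ∃ Φ' : HiggsField E q.punctured, Φ'.HasDet q ∧ Φ'.IsNormal ∧
      ∀ (f : UnitaryFrame E), ∀ e ∈ holAtlas X, ∀ z ∈ e.target, e.symm z ∈ q.punctured →
        Φ'.matrix f e z = polarMat (Φ.matrix f e z) := by
  choose fr hfr using fun x : X => exists_frame E x
  let P : ∀ x : X, E.EndAt x := fun x =>
    (fr x).toEnd x (polarMat ((fr x).matrix x (Φ.toFun x (unitVec x))))
  let Ψ : ∀ x : X, Tangent x →ₗ[ℂ] E.EndAt x := fun x =>
    { toFun := fun v => vecCoord v • P x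
      map_add' := fun v w => add_smul (vecCoord v) (vecCoord w) (P x)
      map_smul' := fun c v => mul_smul c (vecCoord v) (P x) }
  have hP : ∀ (f : UnitaryFrame E) x, f.matrix x (P x) = polarMat (f.matrix x (Φ.toFun x (unitVec x))) := by
    intro f x
    rw [(fr x).matrix_change f, (fr x).matrix_change f x (Φ.toFun x (unitVec x)),
      polarMat_conj ((fr x).transition_conjTranspose_mul f x)]
    simp only [P, UnitaryFrame.matrix_toEnd]
  have hdx : ∀ (f : UnitaryFrame E), ∀ x ∈ q.punctured, (f.matrix x (Φ.toFun x (unitVec x))).det ≠ 0 := by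
    intro f x hx
    rw [f.det_matrix, hdet x trivial, Ne, quadratic_eq_zero_iff (unitVec_ne_zero x)]
    exact hx
  have hΨ : ∀ (f : UnitaryFrame E), ∀ e ∈ holAtlas X, ∀ z ∈ e.target, e.symm z ∈ q.punctured →
        f.matrix (e.symm z) (Ψ (e.symm z) (push e z 1)) = polarMat (Φ.matrix f e z) := by
    intro f e he z hz hzW
    change f.matrix _ (vecCoord (push e z 1) • P _) = _
    rw [f.matrix_smul, hP, ← polarMat_smul (vecCoord_push_ne_zero he hz) (hdx f _ hzW), ← f.matrix_smul,
      ← map_smul]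
    exact congrArg (fun v => polarMat (f.matrix _ (Φ.toFun (e.symm z) v))) (eq_vecCoord_smul _).symm
  have htr : ∀ x ∈ q.punctured, ∀ v, LinearMap.trace ℂ (E.fiber x) (Ψ x v) = 0 := by
    intro x _ v
    change LinearMap.trace ℂ (E.fiber x) (vecCoord v • P x) = 0
    rw [map_smul, ← (fr x).trace_matrix, hP, trace_polarMat, smul_zero]
    rw [(fr x).trace_matrix, Φ.trace_eq_zero x trivial]
  have hsm : ∀ x ∈ q.punctured, SmoothFormAt (realForm Ψ) x := by
    intro x hx
    have he := chartAt_mem_holAtlas x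
    have hs := mem_chart_source ℂ x
    have ht := mem_chart_target ℂ x
    have hl : (chartAt ℂ x).symm (chartAt ℂ x x) = x := (chartAt ℂ x).left_inv hs
    refine SmoothFormAt.of_frame (fr x) (hfr x) he hs fun w => ?_
    refine (((Φ.smoothMatAt (fr x) isOpen_univ he ht (by rw [hl]; exact hfr x) trivial).polarMat
      ?_).const_smul w).congr ?_
    · rw [hdet.det_matrix (fr x) trivial]
      exact q.coeff_ne_zero he hs hx
    · filter_upwards [eventually_symm_mem hq.isOpen_punctured ht (by rwa [hl])] with ζ hζ
      rw [formCoeff_realForm, hΨ _ _ he ζ hζ.1 hζ.2]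
  refine ⟨HiggsField.ofSmooth Ψ htr hsm, fun x hx v => ?_, fun x hx v v' => ?_, hΨ⟩
  · change LinearMap.det (vecCoord v • P x) = q x v
    rw [← (fr x).det_matrix, (fr x).matrix_smul, hP, Matrix.det_smul,
      det_polarMat (by rw [(fr x).trace_matrix, Φ.trace_eq_zero x trivial]) (hdx _ x hx),
      (fr x).det_matrix, hdet x trivial, Fintype.card_fin]
    conv_rhs => rw [eq_vecCoord_smul v, QuadraticMap.map_smul]
    rw [smul_eq_mul, sq]
  · have h1 : ⁅P x, LinearMap.adjoint (P x)⁆ = 0 := by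
      apply (fr x).matrix_injective
      rw [(fr x).matrix_lie, (fr x).matrix_adjoint, hP, polarMat_normal (hdx _ x hx), (fr x).matrix_zero]
    change ⁅vecCoord v • P x, LinearMap.adjoint (vecCoord v' • P x)⁆ -
      ⁅vecCoord v' • P x, LinearMap.adjoint (vecCoord v • P x)⁆ = 0
    rw [Ring.lie_def, sub_eq_zero] at h1
    rw [map_smulₛₗ, map_smulₛₗ]
    simp only [Ring.lie_def, smul_mul_assoc, mul_smul_comm, h1, smul_smul]
    rw [mul_comm (starRingEnd ℂ _), mul_comm (starRingEnd ℂ (vecCoord v))]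
    abel

end Polar

/-! ### The fiducial solution -/

section Fiducial

lemma sqrt_norm_pow_four (z : ℂ) : (Real.sqrt ‖z‖ : ℂ) ^ 4 = z * starRingEnd ℂ z := by
  have h : Real.sqrt ‖z‖ ^ 4 = ‖z‖ ^ 2 := by
    rw [show 4 = 2 * 2 by norm_num, pow_mul, Real.sq_sqrt (norm_nonneg z)]
  rw [Complex.mul_conj', ← Complex.ofReal_pow, h, Complex.ofReal_pow]

lemma sqrt_norm_ne_zero {z : ℂ} (hz : z ≠ 0) : (Real.sqrt ‖z‖ : ℂ) ≠ 0 := by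
  have := (Real.sqrt_pos.2 (norm_pos_iff.2 hz)).ne'
  exact_mod_cast this

lemma contDiffAt_sqrt_norm {z : ℂ} (hz : z ≠ 0) :
    ContDiffAt ℝ ∞ (fun ζ : ℂ => (Real.sqrt ‖ζ‖ : ℂ)) z := by
  have h : ContDiffAt ℝ ∞ (fun ζ : ℂ => ‖ζ‖) z := contDiffAt_norm ℝ hz
  exact Complex.ofRealCLM.contDiff.contDiffAt.comp z (h.sqrt (by simpa using hz))

lemma fderiv_sqrt_norm {z : ℂ} (hz : z ≠ 0) (w : ℂ) :
    4 * (Real.sqrt ‖z‖ : ℂ) ^ 3 * fderiv ℝ (fun ζ : ℂ => (Real.sqrt ‖ζ‖ : ℂ)) z w =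
      w * starRingEnd ℂ z + z * starRingEnd ℂ w := by
  have hd := differentiableAt_of_smooth (contDiffAt_sqrt_norm hz)
  have h1 : (fun ζ : ℂ => (Real.sqrt ‖ζ‖ : ℂ) ^ 4) = fun ζ : ℂ => ζ * starRingEnd ℂ ζ :=
    funext sqrt_norm_pow_four
  have h2 := congrArg (fun g => fderiv ℝ g z w) h1
  have hcd : DifferentiableAt ℝ (fun ζ : ℂ => starRingEnd ℂ ζ) z := Complex.conjCLE.differentiableAt
  rw [fderiv_fun_pow _ hd, fderiv_fun_mul differentiableAt_fun_id hcd] at h2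
  have h3 : fderiv ℝ (fun ζ : ℂ => starRingEnd ℂ ζ) z w = starRingEnd ℂ w := by
    rw [fderiv_conj differentiableAt_fun_id, fderiv_fun_id]; rfl
  simp only [add_apply, smul_apply, h3, fderiv_fun_id, smul_eq_mul] at h2
  simp at h2
  linear_combination h2

lemma fiducialHiggs_eq {z : ℂ} (hz : z ≠ 0) :
    fiducialHiggs z = !![0, (Real.sqrt ‖z‖ : ℂ); z / (Real.sqrt ‖z‖ : ℂ), 0] := by
  have h0 := sqrt_norm_ne_zero hz
  have h1 : (‖z‖ : ℂ) = (Real.sqrt ‖z‖ : ℂ) ^ 2 := by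
    rw [← Complex.ofReal_pow, Real.sq_sqrt (norm_nonneg z)]
  have h2 : (Real.sqrt ‖z‖ : ℂ) * (z / (‖z‖ : ℂ)) = z / (Real.sqrt ‖z‖ : ℂ) := by
    rw [h1]; field_simp
  rw [fiducialHiggs, h2]

/-- The connection that balances the limiting fiducial Higgs field is the fiducial one. -/
lemma fiducial_balance {z : ℂ} (hz : z ≠ 0) (w : ℂ) :
    (1 / (2 * z)) • traceFree (fiducialHiggs z * dirDeriv fiducialHiggs z w) =
      fiducialConnection z w := by
  have h0 := sqrt_norm_ne_zero hz
  have h4 := sqrt_norm_pow_four z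
  have hps := contDiffAt_sqrt_norm hz
  have hd := fderiv_sqrt_norm hz w
  have hzc : starRingEnd ℂ z ≠ 0 := by simpa using hz
  have hev : fiducialHiggs =ᶠ[𝓝 z] fun ζ =>
      !![0, (Real.sqrt ‖ζ‖ : ℂ); ζ / (Real.sqrt ‖ζ‖ : ℂ), 0] := by
    filter_upwards [isOpen_ne.mem_nhds hz] with ζ hζ using fiducialHiggs_eq hζ
  have hmul : fderiv ℝ (fun ζ : ℂ => ζ / (Real.sqrt ‖ζ‖ : ℂ)) z w * (Real.sqrt ‖z‖ : ℂ) +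
      z / (Real.sqrt ‖z‖ : ℂ) * fderiv ℝ (fun ζ : ℂ => (Real.sqrt ‖ζ‖ : ℂ)) z w = w := by
    have h5 : (fun ζ : ℂ => ζ / (Real.sqrt ‖ζ‖ : ℂ) * (Real.sqrt ‖ζ‖ : ℂ)) =ᶠ[𝓝 z] fun ζ => ζ := by
      filter_upwards [isOpen_ne.mem_nhds hz] with ζ hζ
      exact div_mul_cancel₀ _ (sqrt_norm_ne_zero hζ)
    have h6 := congrArg (fun L => L w) (h5.fderiv_eq (𝕜 := ℝ))
    have hrd : DifferentiableAt ℝ (fun ζ : ℂ => ζ / (Real.sqrt ‖ζ‖ : ℂ)) z :=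
      differentiableAt_of_smooth (contDiffAt_div contDiffAt_id hps h0)
    rw [fderiv_fun_mul hrd
      (differentiableAt_of_smooth hps), fderiv_fun_id] at h6
    simp only [add_apply, smul_apply, smul_eq_mul] at h6
    rw [mul_comm, add_comm]
    exact h6
  rw [dirDeriv_congr hev, fiducialHiggs_eq hz]
  have hD : dirDeriv (fun ζ : ℂ => !![0, (Real.sqrt ‖ζ‖ : ℂ); ζ / (Real.sqrt ‖ζ‖ : ℂ), 0]) z w =
      !![0, fderiv ℝ (fun ζ : ℂ => (Real.sqrt ‖ζ‖ : ℂ)) z w;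
        fderiv ℝ (fun ζ : ℂ => ζ / (Real.sqrt ‖ζ‖ : ℂ)) z w, 0] := by
    ext i j
    fin_cases i <;> fin_cases j <;> simp [dirDeriv]
  rw [hD]
  generalize fderiv ℝ (fun ζ : ℂ => (Real.sqrt ‖ζ‖ : ℂ)) z w = dp at *
  generalize fderiv ℝ (fun ζ : ℂ => ζ / (Real.sqrt ‖ζ‖ : ℂ)) z w = dr at *
  generalize (Real.sqrt ‖z‖ : ℂ) = p at *
  have key : 1 / (2 * z) * ((p * dr - z / p * dp) / 2) =
      1 / 8 * (w / z - starRingEnd ℂ w / starRingEnd ℂ z) := by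
    have e1 : p * dr = w - z / p * dp := by linear_combination hmul
    have e2 : z / p * dp = (w * starRingEnd ℂ z + z * starRingEnd ℂ w) / (4 * starRingEnd ℂ z) := by
      rw [← hd]
      have : z / p * dp = z * starRingEnd ℂ z * p ^ 3 * dp / (p ^ 4 * starRingEnd ℂ z) := by
        field_simp
      rw [this, h4]
      field_simp
    rw [e1, e2]
    field_simp
    ring
  have hmat : traceFree (!![0, p; z / p, 0] * !![0, dp; dr, 0]) =
      ((p * dr - z / p * dp) / 2) • (!![1, 0; 0, -1] : Matrix (Fin 2) (Fin 2) ℂ) := by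
    ext i j
    fin_cases i <;> fin_cases j <;> simp [traceFree, Matrix.trace_fin_two] <;> ring
  rw [fiducialConnection, ← key, hmat, smul_smul]

end Fiducial

/-! ### Existence of limiting configurations -/

section Existence

variable {X : Type u} [TopologicalSpace X] [ChartedSpace ℂ X] [IsManifold 𝓘(ℂ) ω X]
  {E : HermitianBundle.{u, v} X} {e e' : OpenPartialHomeomorph X ℂ}
  {q : QuadraticDifferential X}

lemma IsBalanced.dbar_eq_zero {Φ : HiggsField E q.punctured} {A : UnitaryConnection E q.punctured}
    (h : IsBalanced Φ A) (f : UnitaryFrame E) (he : e ∈ holAtlas X) {z : ℂ} (hz : z ∈ e.target)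
    (hf : e.symm z ∈ f.dom) (hzW : e.symm z ∈ q.punctured) : dbar A Φ f e z = 0 := by
  have h1 := h f e he z hz hf hzW 1
  have h2 := h f e he z hz hf hzW Complex.I
  have h3 : dbar A Φ f e z = (1 / 2 : ℂ) • (covD Φ A f e 1 z + Complex.I • covD Φ A f e Complex.I z) := by
    rw [dbar, covD, covD]
    simp only [Ring.lie_def, smul_add, smul_sub, add_mul, mul_add, smul_mul_assoc, mul_smul_comm]
    abel
  rw [h3, h1, h2, smul_smul, ← add_smul]
  have h4 : ∀ m : ℂ, m * 1 + Complex.I * (m * Complex.I) = 0 := fun m => by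
    linear_combination m * Complex.I_mul_I
  rw [h4, zero_smul, smul_zero]

lemma eq_smul_one_of_traceFree_eq_zero {M : Matrix (Fin 2) (Fin 2) ℂ} (h : traceFree M = 0) :
    M = (M.trace / 2) • (1 : Matrix (Fin 2) (Fin 2) ℂ) := sub_eq_zero.1 h

/-- The curvature of a diagonal connection form is diagonal. -/
lemma curv_off_diagonal {a b : ℂ → Matrix (Fin 2) (Fin 2) ℂ} {z : ℂ} {i j : Fin 2}
    (hij : i ≠ j) (ha : ∀ᶠ ζ in 𝓝 z, ∀ i j : Fin 2, i ≠ j → a ζ i j = 0)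
    (hb : ∀ᶠ ζ in 𝓝 z, ∀ i j : Fin 2, i ≠ j → b ζ i j = 0) : curv a b z i j = 0 := by
  have key : ∀ {M : ℂ → Matrix (Fin 2) (Fin 2) ℂ}, (∀ᶠ ζ in 𝓝 z, ∀ i j : Fin 2, i ≠ j → M ζ i j = 0) →
      ∀ w, dirDeriv M z w i j = 0 := fun {M} hM w => by
    rw [dirDeriv, Matrix.of_apply, Filter.EventuallyEq.fderiv_eq (f := fun _ => (0 : ℂ))
      (hM.mono fun ζ hζ => hζ i j hij)]
    simp
  have ha0 := ha.self_of_nhds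
  have hb0 := hb.self_of_nhds
  rw [curv, Matrix.add_apply, Matrix.sub_apply, key hb, key ha, Ring.lie_def, Matrix.sub_apply,
    Matrix.mul_apply, Matrix.mul_apply, Fin.sum_univ_two, Fin.sum_univ_two]
  fin_cases i <;> fin_cases j <;> first | exact absurd rfl hij | skip
  · simp [ha0 0 1 (by decide), hb0 0 1 (by decide)]
  · simp [ha0 1 0 (by decide), hb0 1 0 (by decide)]

theorem exists_limitingConfiguration [T2Space X] [CompactSpace X] [ConnectedSpace X]
    (hX : 2 ≤ genus X) (A₀ : UnitaryConnection E Set.univ) (hq : q.IsHolomorphic)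
    (hs : q.HasSimpleZeros) (Φ : HiggsField E Set.univ) (hdet : Φ.HasDet q) :
    ∃ (A' : UnitaryConnection E q.punctured) (Φ' : HiggsField E q.punctured),
      IsLimitingConfiguration A₀ q A' Φ' := by
  have hfin := QuadraticDifferential.finite_zeros hq hs
  obtain ⟨Φ₁, hdet₁, hform⟩ := Φ.exists_adapted hq hs hdet hfin fun p hp => hp
  have hfr : ∀ p, ∃ f : UnitaryFrame E, p ∈ f.dom ∧ (q p = 0 → ∃ e ∈ holAtlas X, p ∈ e.source ∧
      e p = 0 ∧ ∀ᶠ z in 𝓝 (0 : ℂ), q.coeff e z = -z ∧ Φ₁.matrix f e z = !![0, 1; z, 0]) := by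
    intro p
    by_cases hp : q p = 0
    · obtain ⟨f, e, he, hf, h⟩ := hform p hp
      exact ⟨f, hf, fun _ => ⟨e, he, h⟩⟩
    · obtain ⟨f, hf⟩ := exists_frame E p
      exact ⟨f, hf, fun h => absurd h hp⟩
  choose f hf hfe using hfr
  obtain ⟨A₁, htr₁, hA₁⟩ := A₀.exists_adapted hfin f fun p _ => hf p
  obtain ⟨Φ', hdet', hn', hpolar⟩ := Φ₁.exists_polar hq hdet₁
  obtain ⟨A₂, htr₂, hA₂⟩ := exists_balanced_connection hq hdet' hn' (A₁.restrict q.punctured)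
  have hbal : IsBalanced Φ' A₂ := fun f e he z hz hf hzW w => (hA₂ f e he z hz hf hzW w).1
  -- near the zeros the pair is the fiducial one
  have hnear : ∀ p, q p = 0 → ∃ e ∈ holAtlas X, p ∈ e.source ∧ e p = 0 ∧ ∃ ε > 0,
      Metric.ball 0 ε ⊆ e.target ∩ e.symm ⁻¹' (f p).dom ∧
      (∀ z ∈ Metric.ball (0 : ℂ) ε, q.coeff e z = -z) ∧
      ∀ z ∈ Metric.ball (0 : ℂ) ε, z ≠ 0 → e.symm z ∈ q.punctured ∧
        Φ'.matrix (f p) e z = fiducialHiggs z ∧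
        ∀ w, traceFree (A₂.matrix (f p) e w z) = fiducialConnection z w := by
    intro p hp
    obtain ⟨e, he, hpe, hp0, hev⟩ := hfe p hp
    have h0t : (0 : ℂ) ∈ e.target := hp0 ▸ e.map_source hpe
    have hs0 : e.symm 0 = p := by rw [← hp0, e.left_inv hpe]
    have hc := e.continuousAt_symm h0t
    rw [ContinuousAt, hs0] at hc
    obtain ⟨ε, hε, hball⟩ := Metric.eventually_nhds_iff_ball.1 (hev.and
      ((eventually_symm_mem (f p).isOpen_dom h0t (by rw [hs0]; exact hf p)).and
        (hc.eventually (hA₁ p hp))))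
    have hpun : ∀ z ∈ Metric.ball (0 : ℂ) ε, z ≠ 0 → e.symm z ∈ q.punctured := by
      intro z hz hz0
      obtain ⟨⟨hqz, -⟩, ⟨hzt, -⟩, -⟩ := hball z hz
      change q (e.symm z) ≠ 0
      rw [Ne, ← q.coeff_eq_zero_iff he hzt, hqz]
      simpa using hz0
    have hhiggs : ∀ z ∈ Metric.ball (0 : ℂ) ε, z ≠ 0 → Φ'.matrix (f p) e z = fiducialHiggs z := by
      intro z hz hz0
      obtain ⟨⟨-, hM⟩, ⟨hzt, -⟩, -⟩ := hball z hz
      rw [hpolar (f p) e he z hzt (hpun z hz hz0), hM, polarMat_fiducial hz0]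
    refine ⟨e, he, hpe, hp0, ε, hε, fun z hz => (hball z hz).2.1, fun z hz => (hball z hz).1.1,
      fun z hz hz0 => ⟨hpun z hz hz0, hhiggs z hz hz0, fun w => ?_⟩⟩
    obtain ⟨⟨hqz, -⟩, ⟨hzt, hzf⟩, hAz⟩ := hball z hz
    have hA : traceFree ((A₁.restrict q.punctured).matrix (f p) e w z) = 0 := hAz _
    have hcov : covD Φ' (A₁.restrict q.punctured) (f p) e w z = dirDeriv fiducialHiggs z w := by
      have hev2 : Φ'.matrix (f p) e =ᶠ[𝓝 z] fiducialHiggs := by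
        filter_upwards [Metric.isOpen_ball.mem_nhds hz, isOpen_ne.mem_nhds hz0] with ζ h1 h2
        exact hhiggs ζ h1 h2
      rw [covD, dirDeriv_congr hev2, eq_smul_one_of_traceFree_eq_zero hA, Ring.lie_def,
        smul_mul_assoc, mul_smul_comm, one_mul, mul_one, sub_self, add_zero]
    rw [(hA₂ (f p) e he z hzt hzf (hpun z hz hz0) w).2, traceFree_add, hA, zero_add, hcov, hqz,
      hhiggs z hz hz0, traceFree_smul, traceFree_of_trace_eq_zero (trace_traceFree _), neg_neg,
      fiducial_balance hz0]
  have hvan : ∀ p, q p = 0 → ∃ g : UnitaryFrame E, ∃ e ∈ holAtlas X, p ∈ g.dom ∧ p ∈ e.source ∧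
      ∀ᶠ z in 𝓝 (e p), z ≠ e p → curvCoeff Φ' A₂ g e z = 0 := by
    intro p hp
    obtain ⟨e, he, hpe, hp0, ε, hε, -, -, hfid⟩ := hnear p hp
    refine ⟨f p, e, he, hf p, hpe, ?_⟩
    rw [hp0]
    filter_upwards [Metric.ball_mem_nhds (0 : ℂ) hε] with z hz hz0
    have hdiag : ∀ w, ∀ᶠ ζ in 𝓝 z, ∀ i j : Fin 2, i ≠ j → A₂.matrix (f p) e w ζ i j = 0 := fun w => by
      filter_upwards [Metric.isOpen_ball.mem_nhds hz, isOpen_ne.mem_nhds hz0] with ζ h1 h2 i j hij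
      have h3 := congrFun (congrFun ((hfid ζ h1 h2).2.2 w) i) j
      have h4 : (!![1, 0; 0, -1] : Matrix (Fin 2) (Fin 2) ℂ) i j = 0 := by
        fin_cases i <;> fin_cases j <;> first | exact absurd rfl hij | rfl
      rw [fiducialConnection, Matrix.smul_apply, h4, traceFree, Matrix.sub_apply, Matrix.smul_apply,
        Matrix.one_apply_ne hij] at h3
      simpa using h3
    have h01 : A₂.curvature (f p) e z 0 1 = 0 := curv_off_diagonal (by decide) (hdiag 1) (hdiag _)
    have h10 : A₂.curvature (f p) e z 1 0 = 0 := curv_off_diagonal (by decide) (hdiag 1) (hdiag _)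
    rw [curvCoeff, (hfid z hz hz0).2.1]
    simp [Matrix.trace_fin_two, Matrix.mul_apply, Fin.sum_univ_two, h01, h10, fiducialHiggs]
  obtain ⟨A', hbal', htr', hflat, heq⟩ := hbal.exists_flat hX hq hs hdet' hn' hvan
  refine ⟨A', Φ', ⟨hdet', fun g x hx v => ?_, fun g e he z hz => ?_, hn', fun g e he z hz => ?_,
    fun p hp => ?_⟩⟩
  · rw [htr' g x hx v, htr₂ g x hx v]
    exact htr₁ g x v
  · exact hflat g e (atlas_subset_holAtlas he) z hz.1 hz.2.1 hz.2.2
  · exact hbal'.dbar_eq_zero g (atlas_subset_holAtlas he) hz.1 hz.2.1 hz.2.2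
  · obtain ⟨e, he, hpe, hp0, ε, hε, hsub, hqe, hfid⟩ := hnear p hp
    have h0t : (0 : ℂ) ∈ e.target := hp0 ▸ e.map_source hpe
    have hs0 : e.symm 0 = p := by rw [← hp0, e.left_inv hpe]
    have hc := e.continuousAt_symm h0t
    rw [ContinuousAt, hs0] at hc
    obtain ⟨δ, hδ, hball⟩ := Metric.eventually_nhds_iff_ball.1 (hc.eventually (heq p hp))
    have hle : ∀ z ∈ Metric.ball (0 : ℂ) (min ε δ), z ∈ Metric.ball (0 : ℂ) ε := fun z hz =>
      Metric.ball_subset_ball (min_le_left _ _) hz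
    refine ⟨f p, e, min ε δ, he, hpe, hp0, lt_min hε hδ, fun z hz => hsub (hle z hz),
      fun z hz => hqe z (hle z hz), fun z hz hz0 => ⟨(hfid z (hle z hz) hz0).2.1, fun w => ?_⟩⟩
    have h1 : A'.matrix (f p) e w z = A₂.matrix (f p) e w z :=
      hball z (Metric.ball_subset_ball (min_le_right _ _) hz) (f p) _
    rw [h1]
    exact (hfid z (hle z hz) hz0).2.2 w

end Existence

/-! ### Centralizer bundles -/

section Centralizer

variable {X : Type u} [TopologicalSpace X] [ChartedSpace ℂ X] [IsManifold 𝓘(ℂ) ω X]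
  {E : HermitianBundle.{u, v} X} {e : OpenPartialHomeomorph X ℂ} {q : QuadraticDifferential X}

/-- A Higgs field over a subset. -/
def HiggsField.restrict (Φ : HiggsField E Set.univ) (W : Set X) : HiggsField E W where
  toFun := Φ.toFun
  trace_eq_zero x _ := Φ.trace_eq_zero x trivial
  smooth f e he a b := (Φ.smooth f e he a b).mono fun _ hy => ⟨hy.1, hy.2.1, trivial⟩

lemma HiggsField.centralizer_restrict (Φ : HiggsField E Set.univ) (W : Set X) :
    (Φ.restrict W).centralizer = Φ.centralizer := rfl

lemma HiggsField.centralizerLine_restrict (Φ : HiggsField E Set.univ) (W : Set X) :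
    (Φ.restrict W).centralizerLine = Φ.centralizerLine := rfl

lemma smoothOn_iff {γ : ∀ x, E.EndAt x} {U : Set X} (hU : IsOpen U) :
    SmoothOn γ U ↔ ∀ f : UnitaryFrame E, ∀ x ∈ f.dom ∩ U,
      SmoothMatAt (fun z => f.matrix ((chartAt ℂ x).symm z) (γ ((chartAt ℂ x).symm z)))
        (chartAt ℂ x x) := by
  have h : ∀ (f : UnitaryFrame E) (x : X) (a b : Fin 2),
      ContMDiffAt 𝓘(ℝ, ℂ) 𝓘(ℝ, ℂ) ∞ (fun x => f.matrix x (γ x) a b) x ↔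
      ContDiffAt ℝ ∞ (fun z => f.matrix ((chartAt ℂ x).symm z) (γ ((chartAt ℂ x).symm z)) a b)
        (chartAt ℂ x x) := fun f x a b =>
    contMDiffAt_iff_coord (chartAt_mem_holAtlas x) (mem_chart_source ℂ x)
  constructor
  · intro hs f x hx a b
    exact (h f x a b).1 ((hs f a b).contMDiffAt ((f.isOpen_dom.inter hU).mem_nhds hx))
  · intro hs f a b x hx
    exact ((h f x a b).2 (hs f x hx a b)).contMDiffWithinAt

variable {W : Set X} {Φ Φ' : HiggsField E q.punctured} {x : X} {v w : Tangent x}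

lemma exists_smul_of_ne_zero (hv : v ≠ 0) (w : Tangent x) : ∃ c : ℂ, w = c • v :=
  ⟨vecCoord w / vecCoord v, (div_mul_cancel₀ (vecCoord w) (b := vecCoord v) hv).symm⟩

lemma HiggsField.mem_centralizer_iff (Φ : HiggsField E W) (hv : v ≠ 0) {γ : E.EndAt x} :
    γ ∈ Φ.centralizer x ↔ ⁅Φ.toFun x v, γ⁆ = 0 := by
  refine ⟨fun h => h v, fun h w => ?_⟩
  obtain ⟨c, rfl⟩ := exists_smul_of_ne_zero hv w
  rw [map_smul, Ring.lie_def, smul_mul_assoc, mul_smul_comm, ← smul_sub, ← Ring.lie_def, h, smul_zero]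

lemma apply_ne_zero (hx : x ∈ q.punctured) (hv : v ≠ 0) : q x v ≠ 0 := by
  rw [Ne, quadratic_eq_zero_iff hv]; exact hx

/-- An endomorphism that commutes with the Higgs field is a combination of the identity and the
Higgs field. -/
lemma HiggsField.HasDet.eq_of_mem_centralizer (hdet : Φ.HasDet q) (hx : x ∈ q.punctured) (hv : v ≠ 0)
    {γ : E.EndAt x} (h : γ ∈ Φ.centralizer x) :
    γ = (LinearMap.trace ℂ _ γ / 2) • (1 : E.EndAt x) +
      (LinearMap.trace ℂ _ (γ * Φ.toFun x v) / (2 * -q x v)) • Φ.toFun x v := by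
  obtain ⟨f, -⟩ := exists_frame E x
  have h1 : ⁅f.matrix x γ, f.matrix x (Φ.toFun x v)⁆ = 0 := by
    rw [← f.matrix_lie, Ring.lie_def, ← neg_sub, ← Ring.lie_def, h v, neg_zero, f.matrix_zero]
  have ht : (f.matrix x (Φ.toFun x v)).trace = 0 := by
    rw [f.trace_matrix]; exact Φ.trace_eq_zero x hx v
  have hd : (f.matrix x (Φ.toFun x v)).det = q x v := by rw [f.det_matrix]; exact hdet x hx v
  have h2 := traceFree_eq_of_commute ht (by rw [hd]; exact apply_ne_zero hx hv) h1
  rw [hd, ← f.matrix_mul, f.trace_matrix, traceFree, f.trace_matrix] at h2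
  apply f.matrix_injective
  rw [f.matrix_add, f.matrix_smul, f.matrix_smul, f.matrix_one, ← h2]
  abel

lemma trace_one_endAt (x : X) : LinearMap.trace ℂ (E.fiber x) (1 : E.EndAt x) = 2 := by
  obtain ⟨f, -⟩ := exists_frame E x
  rw [← f.trace_matrix, f.matrix_one]
  simp

lemma HiggsField.HasDet.trace_mul_self (hdet : Φ.HasDet q) (hx : x ∈ q.punctured) (v : Tangent x) :
    LinearMap.trace ℂ (E.fiber x) (Φ.toFun x v * Φ.toFun x v) = -2 * q x v := by
  obtain ⟨f, -⟩ := exists_frame E x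
  rw [← f.trace_matrix, f.matrix_mul, mul_self_of_trace_eq_zero
    (by rw [f.trace_matrix]; exact Φ.trace_eq_zero x hx v), f.det_matrix, hdet x hx v, Matrix.trace_smul]
  simp; ring

/-- The map of centralizers that fixes the identity and sends `Φ(v)` to `Φ'(v)`, extended to all
endomorphisms; it does not depend on `v ≠ 0`. -/
def transfer (Φ Φ' : HiggsField E q.punctured) (x : X) : E.EndAt x →ₗ[ℂ] E.EndAt x where
  toFun γ := (LinearMap.trace ℂ _ γ / 2) • (1 : E.EndAt x) +
    (LinearMap.trace ℂ _ (γ * Φ.toFun x (unitVec x)) / (2 * -q x (unitVec x))) • Φ'.toFun x (unitVec x)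
  map_add' γ γ' := by
    rw [add_mul, map_add, map_add, add_div, add_div, add_smul, add_smul]; abel
  map_smul' c γ := by
    rw [smul_mul_assoc, map_smul, map_smul, smul_eq_mul, smul_eq_mul, mul_div_assoc, mul_div_assoc,
      RingHom.id_apply, smul_add, smul_smul, smul_smul]

lemma transfer_apply (Φ Φ' : HiggsField E q.punctured) (hv : v ≠ 0) (γ : E.EndAt x) :
    transfer Φ Φ' x γ = (LinearMap.trace ℂ _ γ / 2) • (1 : E.EndAt x) +
      (LinearMap.trace ℂ _ (γ * Φ.toFun x v) / (2 * -q x v)) • Φ'.toFun x v := by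
  change _ + (LinearMap.trace ℂ _ (γ * Φ.toFun x (unitVec x)) / (2 * -q x (unitVec x))) •
    Φ'.toFun x (unitVec x) = _
  obtain ⟨c, hc⟩ := exists_smul_of_ne_zero (unitVec_ne_zero x) v
  have hc0 : c ≠ 0 := by rintro rfl; exact hv (by rw [hc, zero_smul])
  rw [hc, (Φ.toFun x).map_smul, (Φ'.toFun x).map_smul, QuadraticMap.map_smul, mul_smul_comm,
    (LinearMap.trace ℂ (E.fiber x)).map_smul, smul_smul]
  congr 2
  by_cases h0 : q x (unitVec x) = 0
  · simp [h0]
  · simp only [smul_eq_mul]; field_simp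

lemma transfer_smul_add (hdet : Φ.HasDet q) (Φ' : HiggsField E q.punctured) (hx : x ∈ q.punctured)
    (hv : v ≠ 0) (a b : ℂ) : transfer Φ Φ' x (a • (1 : E.EndAt x) + b • Φ.toFun x v) =
      a • (1 : E.EndAt x) + b • Φ'.toFun x v := by
  have hq := apply_ne_zero hx hv
  rw [transfer_apply Φ Φ' hv, add_mul, smul_mul_assoc, smul_mul_assoc, one_mul, map_add, map_add,
    map_smul, map_smul, map_smul, map_smul, trace_one_endAt, Φ.trace_eq_zero x hx, hdet.trace_mul_self hx]
  congr 2
  · simp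
  · simp only [smul_eq_mul]; field_simp; ring

lemma transfer_mem (Φ Φ' : HiggsField E q.punctured) (γ : E.EndAt x) :
    transfer Φ Φ' x γ ∈ Φ'.centralizer x := by
  rw [Φ'.mem_centralizer_iff (unitVec_ne_zero x), transfer_apply Φ Φ' (unitVec_ne_zero x), Ring.lie_def]
  simp only [mul_add, add_mul, mul_smul_comm, smul_mul_assoc, mul_one, one_mul, sub_self]

lemma trace_transfer (Φ Φ' : HiggsField E q.punctured) (hx : x ∈ q.punctured) (γ : E.EndAt x) :
    LinearMap.trace ℂ _ (transfer Φ Φ' x γ) = LinearMap.trace ℂ _ γ := by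
  rw [transfer_apply Φ Φ' (unitVec_ne_zero x), map_add, map_smul, map_smul, trace_one_endAt,
    Φ'.trace_eq_zero x hx]
  simp

lemma transfer_transfer (hdet : Φ.HasDet q) (hdet' : Φ'.HasDet q) (hx : x ∈ q.punctured)
    {γ : E.EndAt x} (h : γ ∈ Φ.centralizer x) : transfer Φ' Φ x (transfer Φ Φ' x γ) = γ := by
  rw [hdet.eq_of_mem_centralizer hx (unitVec_ne_zero x) h, transfer_smul_add hdet Φ' hx (unitVec_ne_zero x),
    transfer_smul_add hdet' Φ hx (unitVec_ne_zero x)]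

lemma smoothOn_transfer (hq : q.IsHolomorphic) (Φ Φ' : HiggsField E q.punctured) {U : Set X}
    (hU : IsOpen U) (hUq : U ⊆ q.punctured) {σ : ∀ x, E.EndAt x} (hσ : SmoothOn σ U) :
    SmoothOn (fun x => transfer Φ Φ' x (σ x)) U := by
  rw [smoothOn_iff hU] at hσ ⊢
  intro f x hx
  have h1 := hσ f x hx
  have he := chartAt_mem_holAtlas x
  have ht := mem_chart_target ℂ x
  have hl : (chartAt ℂ x).symm (chartAt ℂ x x) = x := (chartAt ℂ x).left_inv (mem_chart_source ℂ x)
  set e := chartAt ℂ x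
  have hf : e.symm (e x) ∈ f.dom := by rw [hl]; exact hx.1
  have hxq : e.symm (e x) ∈ q.punctured := by rw [hl]; exact hUq hx.2
  have hW := hq.isOpen_punctured
  have hφ := Φ.smoothMatAt f hW he ht hf hxq
  have hφ' := Φ'.smoothMatAt f hW he ht hf hxq
  have h2 := contDiffAt_div (h1.mul hφ).trace ((contDiffAt_const (c := (2 : ℂ))).mul
    (hq.contDiffAt he ht).neg) (by simpa using coeff_ne_zero_target he ht hxq)
  refine ((SmoothMatAt.smul (h1.trace.div_const 2) (SmoothMatAt.const 1)).add
    (SmoothMatAt.smul h2 hφ')).congr ?_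
  filter_upwards [e.open_target.mem_nhds ht] with z hz
  rw [transfer_apply Φ Φ' (push_one_ne_zero he hz), f.matrix_add, f.matrix_smul, f.matrix_smul,
    f.matrix_one, ← f.trace_matrix, ← f.trace_matrix, f.matrix_mul]
  rfl

lemma centralizer_isomorphic (hq : q.IsHolomorphic) (hdet : Φ.HasDet q) (hdet' : Φ'.HasDet q) :
    BundleIsomorphic Φ.centralizer Φ'.centralizer q.punctured :=
  ⟨transfer Φ Φ', transfer Φ' Φ,
    ⟨fun _ _ _ _ => transfer_mem Φ Φ' _, fun _ hU hUq _ _ => smoothOn_transfer hq Φ Φ' hU hUq⟩,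
    ⟨fun _ _ _ _ => transfer_mem Φ' Φ _, fun _ hU hUq _ _ => smoothOn_transfer hq Φ' Φ hU hUq⟩,
    fun _ hx => ⟨fun _ hγ => transfer_transfer hdet hdet' hx hγ,
      fun _ hγ => transfer_transfer hdet' hdet hx hγ⟩⟩

lemma centralizerLine_isomorphic (hq : q.IsHolomorphic) (hdet : Φ.HasDet q) (hdet' : Φ'.HasDet q) :
    BundleIsomorphic Φ.centralizerLine Φ'.centralizerLine q.punctured :=
  ⟨transfer Φ Φ', transfer Φ' Φ,
    ⟨fun _ hx _ hγ => ⟨transfer_mem Φ Φ' _, (trace_transfer Φ Φ' hx _).trans hγ.2⟩,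
      fun _ hU hUq _ _ => smoothOn_transfer hq Φ Φ' hU hUq⟩,
    ⟨fun _ hx _ hγ => ⟨transfer_mem Φ' Φ _, (trace_transfer Φ' Φ hx _).trans hγ.2⟩,
      fun _ hU hUq _ _ => smoothOn_transfer hq Φ' Φ hU hUq⟩,
    fun _ hx => ⟨fun _ hγ => transfer_transfer hdet hdet' hx hγ.1,
      fun _ hγ => transfer_transfer hdet' hdet hx hγ.1⟩⟩

/-- The coordinate vector field `∂_z` of a holomorphic coordinate. -/
def coordVec (e : OpenPartialHomeomorph X ℂ) (y : X) : Tangent y :=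
  vecCoord (push e (e y) 1) • unitVec y

lemma coordVec_ne_zero (he : e ∈ holAtlas X) {y : X} (hy : y ∈ e.source) : coordVec e y ≠ 0 :=
  smul_ne_zero (vecCoord_push_ne_zero he (e.map_source hy)) (unitVec_ne_zero y)

lemma coordVec_symm {z : ℂ} (hz : z ∈ e.target) : coordVec e (e.symm z) = push e z 1 := by
  rw [coordVec, congrArg (fun t => vecCoord (push e t 1)) (e.right_inv hz)]
  exact (eq_vecCoord_smul _).symm

lemma smoothOn_apply_coordVec (hq : q.IsHolomorphic) (Φ : HiggsField E q.punctured)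
    (he : e ∈ holAtlas X) :
    SmoothOn (fun y => Φ.toFun y (coordVec e y)) (e.source ∩ q.punctured) := by
  have hW := hq.isOpen_punctured
  intro f a b x hx
  refine ContMDiffAt.contMDiffWithinAt ?_
  rw [contMDiffAt_iff_coord he hx.2.1]
  have hl := e.left_inv hx.2.1
  have hz := e.map_source hx.2.1
  refine (Φ.smoothMatAt f hW he hz (by rw [hl]; exact hx.1) (by rw [hl]; exact hx.2.2) a
    b).congr_of_eventuallyEq ?_
  filter_upwards [e.open_target.mem_nhds hz] with z hz
  rw [coordVec_symm hz]; rfl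

lemma HiggsField.HasDet.apply_ne_zero (hdet : Φ.HasDet q) (hx : x ∈ q.punctured) (hv : v ≠ 0) :
    Φ.toFun x v ≠ 0 := by
  intro h
  have h1 := hdet.trace_mul_self hx v
  rw [h, mul_zero, map_zero] at h1
  exact HiggsSurface.apply_ne_zero hx hv (by simpa using h1.symm)

lemma HiggsField.apply_mem_centralizer (Φ : HiggsField E W) (hv : v ≠ 0) :
    Φ.toFun x v ∈ Φ.centralizer x := by
  rw [Φ.mem_centralizer_iff hv, Ring.lie_def, sub_self]

lemma isSubbundle_centralizerLine (hq : q.IsHolomorphic) (hdet : Φ.HasDet q) :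
    IsSubbundle Φ.centralizerLine 1 q.punctured := by
  intro x hx
  have he := chartAt_mem_holAtlas x
  refine ⟨(chartAt ℂ x).source ∩ q.punctured, (chartAt ℂ x).open_source.inter hq.isOpen_punctured,
    ⟨mem_chart_source ℂ x, hx⟩, Set.inter_subset_right, fun _ y => Φ.toFun y (coordVec (chartAt ℂ x) y),
    fun _ => smoothOn_apply_coordVec hq Φ he, fun y hy => ⟨?_, ?_⟩⟩
  · exact LinearIndependent.of_subsingleton 0 (hdet.apply_ne_zero hy.2 (coordVec_ne_zero he hy.1))
  · have hv := coordVec_ne_zero he hy.1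
    rw [Set.range_const]
    refine le_antisymm (Submodule.span_le.2 ?_) fun γ hγ => ?_
    · rintro _ rfl
      exact ⟨Φ.apply_mem_centralizer hv, Φ.trace_eq_zero y hy.2 _⟩
    · rw [hdet.eq_of_mem_centralizer hy.2 hv hγ.1, show LinearMap.trace ℂ _ γ = 0 from hγ.2, zero_div,
        zero_smul, zero_add]
      exact Submodule.smul_mem _ _ (Submodule.mem_span_singleton_self _)

lemma isSubbundle_centralizer (hq : q.IsHolomorphic) (hdet : Φ.HasDet q) :
    IsSubbundle Φ.centralizer 2 q.punctured := by
  intro x hx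
  have he := chartAt_mem_holAtlas x
  refine ⟨(chartAt ℂ x).source ∩ q.punctured, (chartAt ℂ x).open_source.inter hq.isOpen_punctured,
    ⟨mem_chart_source ℂ x, hx⟩, Set.inter_subset_right,
    fun k y => ![1, Φ.toFun y (coordVec (chartAt ℂ x) y)] k, fun k => ?_, fun y hy => ⟨?_, ?_⟩⟩
  · fin_cases k
    · intro f a b
      simp only [Fin.zero_eta, Matrix.cons_val_zero, f.matrix_one]
      exact contMDiffOn_const
    · exact smoothOn_apply_coordVec hq Φ he
  · have hv := coordVec_ne_zero he hy.1
    rw [LinearIndependent.pair_iff]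
    intro s t hst
    have h1 := congrArg (LinearMap.trace ℂ _) hst
    rw [map_add, map_smul, map_smul, trace_one_endAt, Φ.trace_eq_zero y hy.2, map_zero] at h1
    have hs : s = 0 := by simpa using h1
    rw [hs, zero_smul, zero_add, smul_eq_zero] at hst
    exact ⟨hs, hst.resolve_right (hdet.apply_ne_zero hy.2 hv)⟩
  · have hv := coordVec_ne_zero he hy.1
    have hr : (Set.range fun k => ![1, Φ.toFun y (coordVec (chartAt ℂ x) y)] k) =
        {1, Φ.toFun y (coordVec (chartAt ℂ x) y)} := Matrix.range_cons_cons_empty _ _ _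
    rw [hr]
    refine le_antisymm (Submodule.span_le.2 ?_) fun γ hγ => ?_
    · rintro _ (rfl | rfl)
      · refine (Φ.mem_centralizer_iff hv).2 ?_
        rw [Ring.lie_def, mul_one, one_mul, sub_self]
      · exact Φ.apply_mem_centralizer hv
    · rw [hdet.eq_of_mem_centralizer hy.2 hv hγ]
      exact Submodule.mem_span_pair.2 ⟨_, _, rfl⟩

end Centralizer

end HiggsSurface

end

theorem mainTheorem3 {X : Type*} [TopologicalSpace X] [T2Space X] [CompactSpace X]
    [ConnectedSpace X] [ChartedSpace ℂ X] [IsManifold 𝓘(ℂ) ω X]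
    (hX : 2 ≤ HiggsSurface.genus X)
    (E : HiggsSurface.HermitianBundle X)
    (A₀ : HiggsSurface.UnitaryConnection E Set.univ)
    (q : HiggsSurface.QuadraticDifferential X) (hq : q.IsHolomorphic) (hs : q.HasSimpleZeros)
    (Φ : HiggsSurface.HiggsField E Set.univ) (hΦ : Φ.HasDet q) :
    (∃ (A' : HiggsSurface.UnitaryConnection E q.punctured)
        (Φ' : HiggsSurface.HiggsField E q.punctured),
        HiggsSurface.IsLimitingConfiguration A₀ q A' Φ') ∧
    ∀ Φ' : HiggsSurface.HiggsField E q.punctured, Φ'.IsNormal → Φ'.HasDet q →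
      (HiggsSurface.IsSubbundle Φ.centralizerLine 1 q.punctured ∧
        HiggsSurface.IsSubbundle Φ'.centralizerLine 1 q.punctured ∧
        HiggsSurface.BundleIsomorphic Φ.centralizerLine Φ'.centralizerLine q.punctured) ∧
      (HiggsSurface.IsSubbundle Φ.centralizer 2 q.punctured ∧
        HiggsSurface.IsSubbundle Φ'.centralizer 2 q.punctured ∧
        HiggsSurface.BundleIsomorphic Φ.centralizer Φ'.centralizer q.punctured) := by
  refine ⟨HiggsSurface.exists_limitingConfiguration hX A₀ hq hs Φ hΦ, fun Φ' _ hΦ' => ?_⟩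
  have hr : (Φ.restrict q.punctured).HasDet q := fun x _ v => hΦ x trivial v
  rw [← Φ.centralizer_restrict q.punctured, ← Φ.centralizerLine_restrict q.punctured]
  exact ⟨⟨HiggsSurface.isSubbundle_centralizerLine hq hr,
      HiggsSurface.isSubbundle_centralizerLine hq hΦ',
      HiggsSurface.centralizerLine_isomorphic hq hr hΦ'⟩,
    HiggsSurface.isSubbundle_centralizer hq hr, HiggsSurface.isSubbundle_centralizer hq hΦ',
    HiggsSurface.centralizer_isomorphic hq hr hΦ'⟩
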